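/- **Setting.** Let $N\ge 2$ agents communicate over an undirected connected graph on $\{1,\dots,N\}$ with adjacency entries $a_{ij}\in\{0,1\}$, and let $0=\lambda_1<\lambda_2\le\dots\le\lambda_N$ be the eigenvalues of its Laplacian. Agent $i$ has the dynamics $\dot x_i=A_ix_i+B_iu_i$, $y_i=C_ix_i$ with $x_i\in\mathbb R^{n_i}$, $u_i\in\mathbb R^{m_i}$, $y_i\in\mathbb R^p$, $n_i\ge p$, in state coordinates in which $C_i=[I_p,0]$. $\|\cdot\|$ is the Euclidean norm and the induced matrix norm. **Assumptions.** (1) Each $f_i:\mathbb R^p\to\mathbb R$ is differentiable and $\nabla f_i$ is $\sigma_i$-strongly monotone and $L_i$-Lipschitz, $\sigma_i,L_i>0$. (2) $\Omega\subset\mathbb R^p$ is convex and compact with nonempty interior. (3) $\partial\Omega$ is a $C^2$ hypersurface with bounded normal curvature. (4) $(A_i,B_i)$ is stabilizable (e.g. controllable) and $(C_i,A_i)$ is detectable. (5) $\operatorname{rank}\begin{bmatrix}A_i&B_i\\C_i&0\end{bmatrix}=n_i+p$ for all $i$. **Expanding sets.** For $t\ge0$ let $\bar\Omega(t)\subseteq\operatorname{Int}\Omega$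 be nonempty, closed and convex, with $\bar\Omega(t_1)\subseteq\bar\Omega(t_2)$ for $t_1\le t_2$, $\bar\Omega(t)\to\Omega$ in the Hausdorff distance as $t\to\infty$, and with $\partial\bar\Omega(t)$ a $C^2$ hypersurface whose normal curvatures are bounded by a constant $M_1\ge0$ independent of $t$. Let $y^*(t)$ be the minimizer of $\sum_if_i$ over $\bar\Omega(t)$ and let $G$ satisfy $\|\frac1N\sum_i\nabla f_i(y^*(t))\|\le G$ for all $t\ge 0$. **Protocol.** With parameters $\alpha,\beta,k_1,k_2>0$, $$\dot z_i=\tfrac{k_2}{\beta}\sum_ja_{ij}(z_j-z_i)+\tfrac{d}{dt}\nabla f_i(y_i),\qquad \dot\eta_i=\beta k_1\sum_ja_{ij}(\eta_j-\eta_i)+\beta(s_i-\eta_i)-\alpha\beta z_i,$$ $$s_i(t)=P_{\bar\Omega(t)}(\eta_i(t)),\qquad u_i=K_{1i}x_i+K_{2i}s_i,$$ $z_i(0)=\nabla f_i(y_i(0))$, $\eta_i(0)\in\operatorname{Int}\Omega$, where $P_K$ is the Euclidean projection onto $K$, $A_i+B_iK_{1i}$ is Hurwitz, $K_{2i}=\Psi_i-K_{1i}\Pi_i$,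 and $(\Pi_i,\Psi_i)$ solves $A_i\Pi_i+B_i\Psi_i=0$, $C_i\Pi_i=I_p$. Solutions are understood in the sense of Carathéodory on $[0,\infty)$. **Constants.** Let $c$ be a constant with $0<c<-2\max_{i,j}\operatorname{Re}\lambda_j(A_i+B_iK_{1i})$ and let $P_i$ be symmetric positive definite, scaled so that $\lambda_{\min}(P_i)\ge1$, with $(A_i+B_iK_{1i})^TP_i+P_i(A_i+B_iK_{1i})+cP_i\preceq0$. Put $L_m=\max_iL_i$, $\sigma=\frac1N\sum_i\sigma_i$, $\sigma_1=\min\{\sigma,\frac1{16}\}$, $D=\max_i\|P_i\|\|\Pi_i\|^2$, $C=\max_i\|C_i\|$, $C_\Pi=\max_i\|C_i\Pi_i\|$, $\underline\lambda=\min_i\lambda_{\min}(P_i)$, and $$\beta_1=\min\{\tfrac{\sigma\alpha}4-\alpha^2(L_m+GM_1)^2-3\alpha^2L_m^2,\ \tfrac16-2\sigma\alpha,\ \tfrac12(\sigma_1-2\alpha^2L_m^2),\ \tfrac14\},$$ $$\beta_2=\max\{\tfrac{6\alpha L_m^2+3}{N\sigma}+\tfrac{2+4\alpha^2L_m^2}N,\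 \tfrac6{\alpha^2L_m^2N^2}+\tfrac{12}{N^2}\},\qquad \beta_3=\max\{\tfrac{6\alpha L_m^2}{\sigma N}+\tfrac{4\alpha^2L_m^2}N,\ \tfrac{12}{N^2}\},$$ $$\gamma_\eta=\min\{\tfrac{\alpha^2}{k_1\lambda_2},\tfrac12(k_1\lambda_2-3),\tfrac{\beta_1}2\},\quad \gamma_\eta^{e}=\tfrac{N\beta_3}2+\tfrac{36\alpha^2L_m^4}{k_2},\quad \gamma_\eta^{\dot e}=\tfrac{4L_m^2}{k_2},$$ $$\gamma_\theta'=\max\{4\gamma_\eta^{\dot e}(\lambda_Nk_1+2+L_m\alpha)C_\Pi,\ 2\gamma_\eta^{\dot e}\alpha C_\Pi\},\quad \gamma_x=\tfrac{18D\beta^2\alpha^2L_m^2C^4}{c\,\underline\lambda^2},$$ $$\gamma_x^{\hat\eta}=\tfrac{2D}c(3\lambda_N^2k_1^2+12+9\alpha^2L_m^2),\quad \gamma_x^{\tilde z}=\tfrac{18D\alpha^2}c,$$ $$\gamma_\theta^{\tilde x}=\gamma_\eta^eC+\gamma_\eta^{\dot e}\max_i\|C_i(A_i+B_iK_{1i})\|+\gamma_\eta^{\dot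 e}C_\Pi C\alpha L_m.$$ The gains satisfy $$k_1\lambda_2-3\ge\tfrac{N\beta_2}2,\qquad k_2\lambda_2-\tfrac{72\alpha^2L_m^2}{k_2}\ge\tfrac{2\beta\alpha^2}{k_1\lambda_2},$$ $$\tfrac{8L_m^2}{k_2}Q\le k_1\lambda_2-3,\qquad \tfrac{8L_m^2N}{k_2}Q\le\tfrac{\beta_1}2,\qquad Q=6\lambda_N^2k_1^2+24+18\alpha^2L_m^2 .$$ **Theorem.** If $$0<\beta<\min\Big\{1,\ \frac{\gamma_\eta}{2\gamma_\theta'},\ \sqrt{\frac c{4\gamma_x}},\ \frac14\sqrt{\frac{c\,\gamma_\eta}{\gamma_\theta^{\tilde x}\max(\gamma_x^{\tilde z},2\gamma_x^{\hat\eta})}}\Big\},$$ then $\sum_if_i$ has a unique minimizer $y^*$ over $\Omega$, and for every solution of the closed loop $\lim_{t\to\infty}y_i(t)=y^*$ for all $i$. -/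

import Mathlib

open Filter Topology
open scoped Matrix.Norms.L2Operator

noncomputable section

namespace SafeConsensus

/-- The output space `ℝ^p` with its Euclidean norm. -/
abbrev Out (p : ℕ) := EuclideanSpace ℝ (Fin p)

/-- Index set of the state of an agent: `p` output coordinates followed by `q` further ones. -/
abbrev StIdx (p q : ℕ) := Fin p ⊕ Fin q

/-- The matrix `A` acting on Euclidean vectors. -/
abbrev act {a b : Type*} [Fintype b] [DecidableEq b] (A : Matrix a b ℝ)
    (v : EuclideanSpace ℝ b) : EuclideanSpace ℝ a :=
  Matrix.toEuclideanLin A v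

/-! ### Graph spectrum -/

/-- Second smallest eigenvalue `λ₂` of the Laplacian (`eigenvalues₀` is sorted decreasingly). -/
def lam2 {N : ℕ} (hN : 2 ≤ N) (Gr : SimpleGraph (Fin N)) [DecidableRel Gr.Adj] : ℝ :=
  (Gr.isHermitian_lapMatrix ℝ).eigenvalues₀ ⟨N - 2, by rw [Fintype.card_fin]; omega⟩

/-- Largest eigenvalue `λ_N` of the Laplacian. -/
def lamN {N : ℕ} (hN : 2 ≤ N) (Gr : SimpleGraph (Fin N)) [DecidableRel Gr.Adj] : ℝ :=
  (Gr.isHermitian_lapMatrix ℝ).eigenvalues₀ ⟨0, by rw [Fintype.card_fin]; omega⟩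

/-! ### Linear agents -/

/-- A square real matrix is Hurwitz: all its complex eigenvalues have negative real part. -/
def IsHurwitz {a : Type*} [Fintype a] [DecidableEq a] (M : Matrix a a ℝ) : Prop :=
  ∀ μ ∈ spectrum ℂ (M.map (algebraMap ℝ ℂ)), μ.re < 0

/-- Stabilizability of the pair `(A, B)` (in particular every controllable pair). -/
def IsStabilizable {a b : Type*} [Fintype a] [DecidableEq a] [Fintype b]
    (A : Matrix a a ℝ) (B : Matrix a b ℝ) : Prop :=
  ∃ K : Matrix b a ℝ, IsHurwitz (A + B * K)

/-- Detectability of the pair `(C, A)`. -/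
def IsDetectable {a b : Type*} [Fintype a] [DecidableEq a] [Fintype b]
    (C : Matrix b a ℝ) (A : Matrix a a ℝ) : Prop :=
  ∃ F : Matrix a b ℝ, IsHurwitz (A + F * C)

/-- Heterogeneous linear agents `ẋᵢ = Aᵢ xᵢ + Bᵢ uᵢ`, `yᵢ = Cᵢ xᵢ` with `nᵢ = p + qᵢ` states,
`mᵢ` inputs and `p` outputs, in coordinates in which `Cᵢ = [I_p, 0]`. -/
structure MAS (N p : ℕ) where
  q : Fin N → ℕ
  m : Fin N → ℕ
  A : ∀ i, Matrix (StIdx p (q i)) (StIdx p (q i)) ℝ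
  B : ∀ i, Matrix (StIdx p (q i)) (Fin (m i)) ℝ

/-- The output matrix `Cᵢ = [I_p, 0]`. -/
def MAS.C {N p : ℕ} (S : MAS N p) (i : Fin N) : Matrix (Fin p) (StIdx p (S.q i)) ℝ :=
  Matrix.fromCols 1 0

/-- Zero is not a transmission zero of agent `i`: `rank [A B; C 0] = nᵢ + p`. -/
def MAS.NoTransmissionZeroAtZero {N p : ℕ} (S : MAS N p) (i : Fin N) : Prop :=
  (Matrix.fromBlocks (S.A i) (S.B i) (S.C i) 0).rank = (p + S.q i) + p

/-- The matrices from which the controllers `uᵢ = K₁ᵢ xᵢ + K₂ᵢ sᵢ` are built. -/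
structure Controller {N p : ℕ} (S : MAS N p) where
  K1 : ∀ i, Matrix (Fin (S.m i)) (StIdx p (S.q i)) ℝ
  Pi : ∀ i, Matrix (StIdx p (S.q i)) (Fin p) ℝ
  Psi : ∀ i, Matrix (Fin (S.m i)) (Fin p) ℝ

/-- `K₂ᵢ = Ψᵢ - K₁ᵢ Πᵢ`. -/
def Controller.K2 {N p : ℕ} {S : MAS N p} (K : Controller S) (i : Fin N) :
    Matrix (Fin (S.m i)) (Fin p) ℝ :=
  K.Psi i - K.K1 i * K.Pi i

/-- The closed-loop matrix `Aᵢ + Bᵢ K₁ᵢ`. -/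
def Controller.cl {N p : ℕ} {S : MAS N p} (K : Controller S) (i : Fin N) :
    Matrix (StIdx p (S.q i)) (StIdx p (S.q i)) ℝ :=
  S.A i + S.B i * K.K1 i

/-- The design rules of the controller: `Aᵢ + Bᵢ K₁ᵢ` is Hurwitz and `(Πᵢ, Ψᵢ)` solves
`Aᵢ Πᵢ + Bᵢ Ψᵢ = 0`, `Cᵢ Πᵢ = I_p`. -/
structure Controller.Admissible {N p : ℕ} {S : MAS N p} (K : Controller S) : Prop where
  hurwitz : ∀ i, IsHurwitz (K.cl i)
  regulator : ∀ i, S.A i * K.Pi i + S.B i * K.Psi i = 0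
  output : ∀ i, S.C i * K.Pi i = 1

/-- Smallest eigenvalue of a symmetric matrix. -/
def lamMin {a : Type*} [Fintype a] [DecidableEq a] {P : Matrix a a ℝ} (hP : P.IsHermitian) : ℝ :=
  ⨅ j, hP.eigenvalues j

/-- Lyapunov certificate for the closed-loop matrices: `0 < c < -2 max Re λ(Aᵢ + Bᵢ K₁ᵢ)`, each
`Pᵢ` is positive definite, scaled so that `λ_min(Pᵢ) ≥ 1` (that is, `Pᵢ - I ≥ 0`), and
`(Aᵢ + Bᵢ K₁ᵢ)ᵀ Pᵢ + Pᵢ (Aᵢ + Bᵢ K₁ᵢ) + c Pᵢ ≤ 0`. -/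
structure Controller.Certificate {N p : ℕ} {S : MAS N p} (K : Controller S) where
  c : ℝ
  P : ∀ i, Matrix (StIdx p (S.q i)) (StIdx p (S.q i)) ℝ
  c_pos : 0 < c
  c_lt : ∀ i, ∀ μ ∈ spectrum ℂ ((K.cl i).map (algebraMap ℝ ℂ)), c < -2 * μ.re
  posDef : ∀ i, (P i).PosDef
  normalized : ∀ i, (P i - 1).PosSemidef
  lyapunov : ∀ i, (-((K.cl i).transpose * P i + P i * K.cl i + c • P i)).PosSemidef

/-! ### Costs and constraint sets -/

/-- `f` is differentiable and its gradient is `σ`-strongly monotone and `L`-Lipschitz. -/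
structure IsNiceCost {p : ℕ} (f : Out p → ℝ) (σ L : ℝ) : Prop where
  differentiable : Differentiable ℝ f
  strong_pos : 0 < σ
  lip_pos : 0 < L
  strongly_monotone : ∀ x y,
    σ * ‖x - y‖ ^ 2 ≤ inner ℝ (gradient f x - gradient f y) (x - y)
  lipschitz : ∀ x y, ‖gradient f x - gradient f y‖ ≤ L * ‖x - y‖

/-- `y` is a minimizer of `∑ fᵢ` over `K`. -/
def IsMinimizer {N p : ℕ} (f : Fin N → Out p → ℝ) (K : Set (Out p)) (y : Out p) : Prop :=
  y ∈ K ∧ IsMinOn (fun v => ∑ i, f i v) K y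

/-- `s` is the Euclidean projection of `v` onto `K`. -/
def IsProj {p : ℕ} (K : Set (Out p)) (v s : Out p) : Prop :=
  s ∈ K ∧ ∀ w ∈ K, ‖s - v‖ ≤ ‖w - v‖

/-- The boundary of `K` is a `C²` hypersurface, with `K` locally on one side of it, whose normal
curvatures are bounded by `M`: near each boundary point `K = {φ ≤ 0}` with `φ` of class `C²`,
`φ = 0` and `∇φ ≠ 0` at the point, and the normal curvature `|D²φ(v,v)| / (‖∇φ‖ ‖v‖²)` in
every tangent direction `v` is at most `M`. -/
def NormalCurvatureBoundedBy {p : ℕ} (K : Set (Out p)) (M : ℝ) : Prop :=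
  ∀ x ∈ frontier K, ∃ φ : Out p → ℝ,
    ContDiffAt ℝ 2 φ x ∧ φ x = 0 ∧ gradient φ x ≠ 0 ∧ (∀ᶠ y in 𝓝 x, y ∈ K ↔ φ y ≤ 0) ∧
    ∀ v : Out p, inner ℝ (gradient φ x) v = 0 →
      |fderiv ℝ (fderiv ℝ φ) x v v| ≤ M * ‖gradient φ x‖ * ‖v‖ ^ 2

/-- Assumptions on the safety zone: convex, compact, nonempty interior, and a boundary surface
of bounded normal curvature. -/
structure IsSafetyZone {p : ℕ} (Ω : Set (Out p)) : Prop where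
  convex : Convex ℝ Ω
  compact : IsCompact Ω
  interior_nonempty : (interior Ω).Nonempty
  curvature : ∃ M, NormalCurvatureBoundedBy Ω M

/-- An expanding family of constraint sets: nonempty closed convex sets that increase with time,
stay in the interior of `Ω`, converge to `Ω` in the Hausdorff distance, and whose boundary
surfaces have normal curvatures bounded by `M₁`. -/
structure IsExpandingFamily {p : ℕ} (Ω : Set (Out p)) (Ωb : ℝ → Set (Out p)) (M₁ : ℝ) :
    Prop where
  nonempty : ∀ t, 0 ≤ t → (Ωb t).Nonempty
  closed : ∀ t, 0 ≤ t → IsClosed (Ωb t)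
  convex : ∀ t, 0 ≤ t → Convex ℝ (Ωb t)
  subset_interior : ∀ t, 0 ≤ t → Ωb t ⊆ interior Ω
  mono : ∀ t₁ t₂, 0 ≤ t₁ → t₁ ≤ t₂ → Ωb t₁ ⊆ Ωb t₂
  tendsto : Tendsto (fun t => Metric.hausdorffDist (Ωb t) Ω) atTop (𝓝 0)
  bound_nonneg : 0 ≤ M₁
  curvature : ∀ t, 0 ≤ t → NormalCurvatureBoundedBy (Ωb t) M₁

/-- `G` bounds the norm of the averaged gradient `N⁻¹ ∑ ∇fᵢ` at the minimizers `y*(t)` of `∑ fᵢ`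
over the sets `Ωb t`. -/
def GradientBound {N p : ℕ} (f : Fin N → Out p → ℝ) (Ωb : ℝ → Set (Out p)) (G : ℝ) : Prop :=
  ∀ t, 0 ≤ t → ∀ y, IsMinimizer f (Ωb t) y →
    ‖(N : ℝ)⁻¹ • ∑ i, gradient (f i) y‖ ≤ G

/-! ### Closed-loop trajectories -/

/-- The signals of the closed loop. -/
structure Signals {N p : ℕ} (S : MAS N p) where
  x : ∀ i, ℝ → EuclideanSpace ℝ (StIdx p (S.q i))
  z : Fin N → ℝ → Out p
  η : Fin N → ℝ → Out p
  s : Fin N → ℝ → Out p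

/-- The outputs `yᵢ = Cᵢ xᵢ`. -/
def Signals.y {N p : ℕ} {S : MAS N p} (w : Signals S) (i : Fin N) (t : ℝ) : Out p :=
  act (S.C i) (w.x i t)

/-- The inputs `uᵢ = K₁ᵢ xᵢ + K₂ᵢ sᵢ`. -/
def Signals.u {N p : ℕ} {S : MAS N p} (w : Signals S) (K : Controller S) (i : Fin N) (t : ℝ) :
    EuclideanSpace ℝ (Fin (S.m i)) :=
  act (K.K1 i) (w.x i t) + act (K.K2 i) (w.s i t)

/-- `w` is a (Carathéodory) solution on `[0, ∞)` of the closed loop of the agents and the protocol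
`żᵢ = (k₂/β) ∑ⱼ aᵢⱼ (zⱼ - zᵢ) + d/dt ∇fᵢ(yᵢ)`,
`η̇ᵢ = β k₁ ∑ⱼ aᵢⱼ (ηⱼ - ηᵢ) + β (sᵢ - ηᵢ) - α β zᵢ`,
`sᵢ = P_{Ωb t}(ηᵢ)`, `uᵢ = K₁ᵢ xᵢ + K₂ᵢ sᵢ`,
with `zᵢ(0) = ∇fᵢ(yᵢ(0))` and `ηᵢ(0) ∈ Int Ω`. The differential equations are written in
integrated form, which every differentiable solution satisfies; the integral of
`d/dt ∇fᵢ(yᵢ)` over `[0, t]` is `∇fᵢ(yᵢ(t)) - ∇fᵢ(yᵢ(0))`. -/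
structure IsClosedLoopSolution {N p : ℕ} {S : MAS N p} (K : Controller S)
    (Gr : SimpleGraph (Fin N)) [DecidableRel Gr.Adj] (f : Fin N → Out p → ℝ)
    (Ω : Set (Out p)) (Ωb : ℝ → Set (Out p)) (α β k₁ k₂ : ℝ) (w : Signals S) : Prop where
  x_cont : ∀ i, ContinuousOn (w.x i) (Set.Ici 0)
  z_cont : ∀ i, ContinuousOn (w.z i) (Set.Ici 0)
  η_cont : ∀ i, ContinuousOn (w.η i) (Set.Ici 0)
  s_int : ∀ i t, 0 ≤ t → IntervalIntegrable (w.s i) MeasureTheory.volume 0 t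
  x_eq : ∀ i t, 0 ≤ t → w.x i t = w.x i 0 +
    ∫ τ in (0 : ℝ)..t, (act (S.A i) (w.x i τ) + act (S.B i) (w.u K i τ))
  z_eq : ∀ i t, 0 ≤ t → w.z i t = w.z i 0 +
    (∫ τ in (0 : ℝ)..t, (k₂ / β) • ∑ j, Gr.adjMatrix ℝ i j • (w.z j τ - w.z i τ)) +
    (gradient (f i) (w.y i t) - gradient (f i) (w.y i 0))
  η_eq : ∀ i t, 0 ≤ t → w.η i t = w.η i 0 +
    ∫ τ in (0 : ℝ)..t, ((β * k₁) • (∑ j, Gr.adjMatrix ℝ i j • (w.η j τ - w.η i τ)) +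
      β • (w.s i τ - w.η i τ) - (α * β) • w.z i τ)
  s_eq : ∀ i t, 0 ≤ t → IsProj (Ωb t) (w.η i t) (w.s i t)
  z_init : ∀ i, w.z i 0 = gradient (f i) (w.y i 0)
  η_init : ∀ i, w.η i 0 ∈ interior Ω

/-! ### Scalar design constants -/

/-- The scalars entering the gain conditions. -/
structure Scalars where
  /-- number of agents -/
  N : ℝ
  α : ℝ
  β : ℝ
  k₁ : ℝ
  k₂ : ℝ
  /-- average strong monotonicity constant `N⁻¹ ∑ σᵢ` -/
  σ : ℝ
  /-- largest gradient Lipschitz constant -/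
  Lmax : ℝ
  lam2 : ℝ
  lamN : ℝ
  /-- bound of the gradient at the minimizers over the constraint sets -/
  G : ℝ
  /-- bound of the normal curvatures of the constraint sets -/
  M₁ : ℝ
  c : ℝ
  /-- `max ‖Pᵢ‖ ‖Πᵢ‖²` -/
  Dmax : ℝ
  /-- `max ‖Cᵢ‖` -/
  Cmax : ℝ
  /-- `max ‖Cᵢ Πᵢ‖` -/
  CPi : ℝ
  /-- `max ‖Cᵢ (Aᵢ + Bᵢ K₁ᵢ)‖` -/
  Ccl : ℝ
  /-- `min λ_min(Pᵢ)` -/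
  lamP : ℝ

namespace Scalars

variable (d : Scalars)

def σ₁ : ℝ := min d.σ (1 / 16)

def β₁ : ℝ :=
  min (min (d.σ * d.α / 4 - d.α ^ 2 * (d.Lmax + d.G * d.M₁) ^ 2 - 3 * d.α ^ 2 * d.Lmax ^ 2)
      (1 / 6 - 2 * d.σ * d.α))
    (min (1 / 2 * (d.σ₁ - 2 * d.α ^ 2 * d.Lmax ^ 2)) (1 / 4))

def β₂ : ℝ :=
  max ((6 * d.α * d.Lmax ^ 2 + 3) / (d.N * d.σ) + (2 + 4 * d.α ^ 2 * d.Lmax ^ 2) / d.N)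
    (6 / (d.α ^ 2 * d.Lmax ^ 2 * d.N ^ 2) + 12 / d.N ^ 2)

def β₃ : ℝ :=
  max (6 * d.α * d.Lmax ^ 2 / (d.σ * d.N) + 4 * d.α ^ 2 * d.Lmax ^ 2 / d.N) (12 / d.N ^ 2)

/-- `γ_η` -/
def γη : ℝ :=
  min (d.α ^ 2 / (d.k₁ * d.lam2)) (min (1 / 2 * (d.k₁ * d.lam2 - 3)) (d.β₁ / 2))

/-- `γ_η^e` -/
def γηe : ℝ := d.N * d.β₃ / 2 + 36 * d.α ^ 2 * d.Lmax ^ 4 / d.k₂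

/-- `γ_η^ė` -/
def γηde : ℝ := 4 * d.Lmax ^ 2 / d.k₂

/-- `γ'_θ` -/
def γθ' : ℝ :=
  max (4 * d.γηde * (d.lamN * d.k₁ + 2 + d.Lmax * d.α) * d.CPi) (2 * d.γηde * d.α * d.CPi)

/-- `γ_x` -/
def γx : ℝ :=
  18 * d.Dmax * d.β ^ 2 * d.α ^ 2 * d.Lmax ^ 2 * d.Cmax ^ 4 / (d.c * d.lamP ^ 2)

/-- `γ_x^η̂` -/
def γxη : ℝ :=
  2 * d.Dmax / d.c * (3 * d.lamN ^ 2 * d.k₁ ^ 2 + 12 + 9 * d.α ^ 2 * d.Lmax ^ 2)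

/-- `γ_x^z̃` -/
def γxz : ℝ := 18 * d.Dmax * d.α ^ 2 / d.c

/-- `γ_θ^x̃` -/
def γθx : ℝ :=
  d.γηe * d.Cmax + d.γηde * d.Ccl + d.γηde * d.CPi * d.Cmax * d.α * d.Lmax

/-- The requirements on the gains `k₁` and `k₂`. -/
structure GainsLarge : Prop where
  k₁_pos : 0 < d.k₁
  k₂_pos : 0 < d.k₂
  consensus : d.N * d.β₂ / 2 ≤ d.k₁ * d.lam2 - 3
  tracking : 2 * d.β * d.α ^ 2 / (d.k₁ * d.lam2) ≤
    d.k₂ * d.lam2 - 72 * d.α ^ 2 * d.Lmax ^ 2 / d.k₂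
  cross₁ : 8 * d.Lmax ^ 2 / d.k₂ *
    (6 * d.lamN ^ 2 * d.k₁ ^ 2 + 24 + 18 * d.α ^ 2 * d.Lmax ^ 2) ≤ d.k₁ * d.lam2 - 3
  cross₂ : 8 * d.Lmax ^ 2 * d.N / d.k₂ *
    (6 * d.lamN ^ 2 * d.k₁ ^ 2 + 24 + 18 * d.α ^ 2 * d.Lmax ^ 2) ≤ d.β₁ / 2

/-- The small-gain bound on `β`. -/
def SmallGain : Prop :=
  0 < d.β ∧
  d.β < min (min 1 (d.γη / (2 * d.γθ')))
    (min (√(d.c / (4 * d.γx))) (1 / 4 * √(d.c * d.γη / (d.γθx * max d.γxz (2 * d.γxη)))))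

end Scalars

/-- The scalar constants of a concrete closed loop. -/
def scalars {N p : ℕ} (hN : 2 ≤ N) (S : MAS N p) (K : Controller S) (T : K.Certificate)
    (Gr : SimpleGraph (Fin N)) [DecidableRel Gr.Adj] (σ L : Fin N → ℝ)
    (α β k₁ k₂ G M₁ : ℝ) : Scalars where
  N := N
  α := α
  β := β
  k₁ := k₁
  k₂ := k₂
  σ := (∑ i, σ i) / N
  Lmax := ⨆ i, L i
  lam2 := lam2 hN Gr
  lamN := lamN hN Gr
  G := G
  M₁ := M₁
  c := T.c
  Dmax := ⨆ i, ‖T.P i‖ * ‖K.Pi i‖ ^ 2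
  Cmax := ⨆ i, ‖S.C i‖
  CPi := ⨆ i, ‖S.C i * K.Pi i‖
  Ccl := ⨆ i, ‖S.C i * K.cl i‖
  lamP := ⨅ i, lamMin (T.posDef i).isHermitian

end SafeConsensus

end

/-!
The proof compares the closed loop with the one in which every `sᵢ` is the projection `P(ηᵢ)` onto
the fixed set `Ω`. By the variational inequality for projections, `sᵢ` differs from `P(ηᵢ)` by an
amount whose square is at most `h (2 ‖ηᵢ - P(ηᵢ)‖ + h)`, where `h` is the Hausdorff distance of
`Ωb t` and `Ω` (`norm_sub_sq_le_of_subset`); as `h → 0`, this is a vanishing perturbation that grows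
at most linearly with the error of `ηᵢ`.

The fixed loop has the equilibrium `ηᵢ = e = y* - α N⁻¹ ∑ ∇fᵢ(y*)`, and `P(e) = y*` is the
optimality condition for `y*`. Stability comes from a composite Lyapunov function with three parts.

* The slow variables `η`, with `½ ‖η - e‖²` (`inner_slow_dynamics_le`). Since `P` is firmly
  nonexpansive, `η - e` splits into a projected part and a normal part that form an acute angle;
  strong monotonicity of the average gradient makes the mean of the projected part decay, the
  relaxation `sᵢ - ηᵢ` the normal part, and the coupling `k₁` the disagreement of the agents.
* The gradient tracking (`tracking_storage_le`). The variables `ζᵢ = zᵢ - ∇fᵢ(yᵢ)` keep zero sum, so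
  `z` is the average gradient at the points `P(ηᵢ)`, plus a mismatch due to the output errors, plus
  an error `v` with zero mean. Measuring `v` by the pseudo-inverse of the Laplacian makes the
  coupling `k₂` act on it as a pure contraction.
* The agents (`agent_storage_le`), with the quadratic forms `Pᵢ` in `xᵢ - Πᵢ P(ηᵢ)`. By the regulator
  equations these errors follow the Hurwitz dynamics `Aᵢ + Bᵢ K₁ᵢ`, driven by the speed of `P(ηᵢ)`.

The conditions on the gains (`Scalars.gainBounds`) bound the cross terms between the parts by their
decay (`GainBounds.dissipation`). A Carathéodory solution is Lipschitz on bounded time intervals, and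
hence so are `P(ηᵢ)` and the gradients there: the Lyapunov function is absolutely continuous and
satisfies `V' ≤ -c₀ V + ρ(t) (1 + V)` almost everywhere, with `ρ → 0`. Gronwall's inequality
(`tendsto_zero_of_ae_deriv_le`) gives `V → 0`, so that `ηᵢ → e` and
`yᵢ - P(ηᵢ) = Cᵢ (xᵢ - Πᵢ P(ηᵢ)) → 0`.
-/

set_option autoImplicit false
set_option linter.unusedSectionVars false

noncomputable section

namespace SafeConsensus

/-! ### Stacked vectors and the graph Laplacian -/

/-- The space `F^N` of stacked vectors of `N` agents, with its Euclidean norm. -/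
abbrev Stack (N : ℕ) (F : Type*) := PiLp 2 (fun _ : Fin N => F)

/-- The stacked vector all of whose blocks are `c`. -/
def diagVec (N : ℕ) {F : Type*} (c : F) : Stack N F := WithLp.toLp 2 (fun _ => c)

@[simp] lemma diagVec_apply {N : ℕ} {F : Type*} (c : F) (i : Fin N) : diagVec N c i = c := rfl

section Stack

variable {N : ℕ} {F : Type*} [NormedAddCommGroup F] [InnerProductSpace ℝ F]

/-- The operator `A ⊗ I` on stacked vectors, as a linear map. -/
def blockLin (A : Matrix (Fin N) (Fin N) ℝ) : Stack N F →ₗ[ℝ] Stack N F where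
  toFun x := WithLp.toLp 2 (fun i => ∑ j, A i j • x j)
  map_add' x y := by
    ext i : 1
    simp [smul_add, Finset.sum_add_distrib]
  map_smul' c x := by
    ext i : 1
    simp [Finset.smul_sum, smul_comm c]

/-- The operator `A ⊗ I` on stacked vectors. -/
def blockMap [FiniteDimensional ℝ F] (A : Matrix (Fin N) (Fin N) ℝ) : Stack N F →L[ℝ] Stack N F :=
  ⟨blockLin A, LinearMap.continuous_of_finiteDimensional _⟩

/-- The mean of the blocks of a stacked vector. -/
def blockMean (x : Stack N F) : F := (N : ℝ)⁻¹ • ∑ i, x i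

@[simp] lemma blockMap_apply [FiniteDimensional ℝ F] (A : Matrix (Fin N) (Fin N) ℝ)
    (x : Stack N F) (i : Fin N) : blockMap A x i = ∑ j, A i j • x j := rfl

lemma diagVec_sub (c c' : F) : diagVec N (c - c') = diagVec N c - diagVec N c' := rfl

lemma diagVec_smul (r : ℝ) (c : F) : diagVec N (r • c) = r • diagVec N c := rfl

lemma blockMap_mul [FiniteDimensional ℝ F] (A B : Matrix (Fin N) (Fin N) ℝ) (x : Stack N F) :
    blockMap (A * B) x = blockMap A (blockMap B x) := by
  ext i : 1
  simp only [blockMap_apply, Matrix.mul_apply, Finset.sum_smul, Finset.smul_sum, smul_smul]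
  exact Finset.sum_comm

lemma blockMap_one [FiniteDimensional ℝ F] (x : Stack N F) : blockMap 1 x = x := by
  ext i : 1
  simp [Matrix.one_apply]

lemma inner_blockMap [FiniteDimensional ℝ F] (A : Matrix (Fin N) (Fin N) ℝ) (x y : Stack N F) :
    inner ℝ (blockMap A x) y = inner ℝ x (blockMap A.transpose y) := by
  rw [PiLp.inner_apply, PiLp.inner_apply]
  simp only [blockMap_apply, sum_inner, inner_sum, real_inner_smul_left,
    real_inner_smul_right, Matrix.transpose_apply]
  exact Finset.sum_comm

lemma sum_eq_smul_blockMean (hN : N ≠ 0) (x : Stack N F) :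
    ∑ i, x i = (N : ℝ) • blockMean x := by
  rw [blockMean, smul_inv_smul₀ (by exact_mod_cast hN)]

lemma blockMean_diagVec (hN : N ≠ 0) (c : F) : blockMean (diagVec N c) = c := by
  simp only [blockMean, diagVec_apply, Finset.sum_const, Finset.card_univ, Fintype.card_fin]
  rw [← Nat.cast_smul_eq_nsmul ℝ, inv_smul_smul₀ (by exact_mod_cast hN)]

lemma blockMean_sub (x y : Stack N F) : blockMean (x - y) = blockMean x - blockMean y := by
  simp [blockMean, smul_sub]

lemma blockMean_add (x y : Stack N F) : blockMean (x + y) = blockMean x + blockMean y := by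
  simp [blockMean, smul_add, Finset.sum_add_distrib]

lemma blockMean_smul (r : ℝ) (x : Stack N F) : blockMean (r • x) = r • blockMean x := by
  simp [blockMean, ← Finset.smul_sum, smul_comm r]

lemma blockMean_sub_diagVec (hN : N ≠ 0) (x : Stack N F) :
    blockMean (x - diagVec N (blockMean x)) = 0 := by
  rw [blockMean_sub, blockMean_diagVec hN, sub_self]

lemma inner_diagVec (hN : N ≠ 0) (x : Stack N F) (c : F) :
    inner ℝ x (diagVec N c) = N * inner ℝ (blockMean x) c := by
  rw [PiLp.inner_apply]
  simp only [diagVec_apply]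
  rw [← sum_inner]
  rw [sum_eq_smul_blockMean hN, real_inner_smul_left]

lemma norm_diagVec_sq (c : F) : ‖diagVec N c‖ ^ 2 = N * ‖c‖ ^ 2 := by
  simp [PiLp.norm_sq_eq_of_L2]

/-- Stacked vectors split orthogonally into their mean and the deviation from it. -/
lemma norm_sq_eq_mean_add_deviation (hN : N ≠ 0) (x : Stack N F) :
    ‖x‖ ^ 2 = ‖diagVec N (blockMean x)‖ ^ 2 + ‖x - diagVec N (blockMean x)‖ ^ 2 := by
  have h : inner ℝ (x - diagVec N (blockMean x)) (diagVec N (blockMean x)) = (0 : ℝ) := by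
    rw [inner_diagVec hN, blockMean_sub_diagVec hN, inner_zero_left, mul_zero]
  have := norm_add_sq_eq_norm_sq_add_norm_sq_of_inner_eq_zero _ _ h
  rw [sub_add_cancel] at this
  nlinarith [this]

/-- The mean minimizes the distance to the diagonal. -/
lemma norm_sub_blockMean_le (hN : N ≠ 0) (x : Stack N F) (c : F) :
    ‖x - diagVec N (blockMean x)‖ ≤ ‖x - diagVec N c‖ := by
  have h := norm_sq_eq_mean_add_deviation hN (x - diagVec N c)
  rw [blockMean_sub, blockMean_diagVec hN, diagVec_sub, sub_sub_sub_cancel_right] at h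
  refine abs_le_of_sq_le_sq' ?_ (norm_nonneg _) |>.2
  nlinarith [sq_nonneg ‖diagVec N (blockMean x) - diagVec N c‖]

end Stack

section Graph

variable {N : ℕ} {F : Type*} [NormedAddCommGroup F] [InnerProductSpace ℝ F]
  [FiniteDimensional ℝ F] (hN : 2 ≤ N) (Gr : SimpleGraph (Fin N)) [DecidableRel Gr.Adj]

lemma lapMatrix_eigenvalues_nonneg (k : Fin N) :
    0 ≤ (Gr.isHermitian_lapMatrix ℝ).eigenvalues k :=
  (Gr.posSemidef_lapMatrix ℝ).eigenvalues_nonneg k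

lemma eigenvalues_le_lamN (k : Fin N) :
    (Gr.isHermitian_lapMatrix ℝ).eigenvalues k ≤ lamN hN Gr :=
  (Gr.isHermitian_lapMatrix ℝ).eigenvalues₀_antitone (Nat.zero_le _)

lemma lam2_le_lamN : lam2 hN Gr ≤ lamN hN Gr :=
  (Gr.isHermitian_lapMatrix ℝ).eigenvalues₀_antitone (Nat.zero_le _)

/-- The only eigenvalue that can lie below `λ₂` is the last one; since the Laplacian is
singular, that one is `0` as soon as `λ₂ > 0`. -/
lemma eigenvalues_eq_zero_or_lam2_le (h2 : 0 < lam2 hN Gr) (k : Fin N) :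
    (Gr.isHermitian_lapMatrix ℝ).eigenvalues k = 0 ∨
      lam2 hN Gr ≤ (Gr.isHermitian_lapMatrix ℝ).eigenvalues k := by
  set hH := Gr.isHermitian_lapMatrix ℝ
  have key : ∀ j : Fin (Fintype.card (Fin N)), (j : ℕ) ≤ N - 2 → lam2 hN Gr ≤ hH.eigenvalues₀ j :=
    fun j hj => hH.eigenvalues₀_antitone hj
  -- the reindexing by which `eigenvalues` is defined from the sorted list `eigenvalues₀`
  set e := (Fintype.equivOfCardEq (Fintype.card_fin (Fintype.card (Fin N)))).symm with he
  have hek : ∀ k, hH.eigenvalues k = hH.eigenvalues₀ (e k) := fun k => rfl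
  by_cases hk : ((e k : Fin _) : ℕ) ≤ N - 2
  · exact Or.inr (by rw [hek]; exact key _ hk)
  · left
    have : Nonempty (Fin N) := ⟨⟨0, by omega⟩⟩
    have hdet := Gr.det_lapMatrix_eq_zero
    rw [hH.det_eq_prod_eigenvalues, Finset.prod_eq_zero_iff] at hdet
    obtain ⟨j, -, hj⟩ := hdet
    have hj0 : hH.eigenvalues j = 0 := by simpa using hj
    have hjk : ¬ ((e j : Fin _) : ℕ) ≤ N - 2 := fun h => by
      have := key _ h
      rw [← hek, hj0] at this
      linarith
    have : e j = e k := by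
      have h1 := (e j).2
      have h2 := (e k).2
      simp only [Fintype.card_fin] at h1 h2
      ext
      omega
    rw [e.injective this] at hj0
    exact hj0

/-- Graph Fourier transform: an orthogonal matrix diagonalizing the Laplacian of a connected
graph. Its rows with eigenvalue `0` annihilate the vectors with zero mean. -/
lemma exists_graphFourier (hGr : Gr.Connected) (h2 : 0 < lam2 hN Gr) :
    ∃ (U : Matrix (Fin N) (Fin N) ℝ) (l : Fin N → ℝ), U.transpose * U = 1 ∧
      U * Gr.lapMatrix ℝ = Matrix.diagonal l * U ∧
      (∀ k, l k = 0 ∨ lam2 hN Gr ≤ l k) ∧ (∀ k, 0 ≤ l k) ∧ (∀ k, l k ≤ lamN hN Gr) ∧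
      ∀ k, l k = 0 → ∀ i j, U k i = U k j := by
  set hH := Gr.isHermitian_lapMatrix ℝ with hHdef
  have hsym : (Gr.lapMatrix ℝ).transpose = Gr.lapMatrix ℝ := Gr.isSymm_lapMatrix ℝ
  have hrow : ∀ k, Matrix.mulVec (Gr.lapMatrix ℝ) (fun i => hH.eigenvectorBasis k i) =
      hH.eigenvalues k • (fun i => hH.eigenvectorBasis k i) := fun k =>
    hH.mulVec_eigenvectorBasis k
  refine ⟨Matrix.of fun k i => hH.eigenvectorBasis k i, hH.eigenvalues, ?_, ?_,
    eigenvalues_eq_zero_or_lam2_le hN Gr h2, lapMatrix_eigenvalues_nonneg Gr,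
    eigenvalues_le_lamN hN Gr, ?_⟩
  · have h1 : (Matrix.of fun k i => hH.eigenvectorBasis k i) *
        (Matrix.of fun k i => hH.eigenvectorBasis k i).transpose = 1 := by
      ext k j
      have := orthonormal_iff_ite.mp hH.eigenvectorBasis.orthonormal k j
      simp only [PiLp.inner_apply] at this
      simp only [Matrix.mul_apply, Matrix.transpose_apply, Matrix.of_apply, Matrix.one_apply]
      rw [← this]
      exact Finset.sum_congr rfl fun i _ => by simp [mul_comm]
    exact mul_eq_one_comm.mp h1
  · ext k i
    have h := congrFun (hrow k) i
    simp only [Matrix.mulVec, dotProduct, Pi.smul_apply, smul_eq_mul] at h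
    rw [Matrix.diagonal_mul, Matrix.mul_apply, Matrix.of_apply, ← h]
    refine Finset.sum_congr rfl fun j _ => ?_
    have : Gr.lapMatrix ℝ j i = Gr.lapMatrix ℝ i j := congrFun (congrFun hsym i) j
    rw [this, Matrix.of_apply, mul_comm]
  · intro k hk i j
    have h0 : Matrix.mulVec (Gr.lapMatrix ℝ) (fun i => hH.eigenvectorBasis k i) = 0 := by
      rw [hrow k, hk, zero_smul]
    exact (Gr.lapMatrix_mulVec_eq_zero_iff_forall_reachable.mp h0) i j (hGr.preconnected i j)

/-- The coupling term of the protocol is minus the Laplacian. -/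
lemma blockMap_lapMatrix_apply (x : Stack N F) (i : Fin N) :
    ∑ j, Gr.adjMatrix ℝ i j • (x j - x i) = -(blockMap (Gr.lapMatrix ℝ) x i) := by
  simp only [smul_sub, Finset.sum_sub_distrib, blockMap_apply, SimpleGraph.lapMatrix,
    Matrix.sub_apply, sub_smul, neg_sub, SimpleGraph.degMatrix, Matrix.diagonal_apply, ite_smul,
    zero_smul, Finset.sum_ite_eq, Finset.mem_univ, if_true]
  rw [← Finset.sum_smul]
  congr 2
  rw [← SimpleGraph.card_neighborFinset_eq_degree, SimpleGraph.neighborFinset_eq_filter]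
  simp [SimpleGraph.adjMatrix_apply]

lemma blockMap_lapMatrix_diagVec (c : F) : blockMap (Gr.lapMatrix ℝ) (diagVec N c) = 0 := by
  ext i : 1
  rw [← neg_eq_zero.mpr rfl, ← neg_inj]
  have := blockMap_lapMatrix_apply Gr (diagVec N c) i
  simp only [diagVec_apply, sub_self, smul_zero, Finset.sum_const_zero] at this
  rw [← this]
  simp

lemma blockMap_lapMatrix_sub_diagVec (x : Stack N F) (c : F) :
    blockMap (Gr.lapMatrix ℝ) (x - diagVec N c) = blockMap (Gr.lapMatrix ℝ) x := by
  rw [map_sub, blockMap_lapMatrix_diagVec, sub_zero]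

lemma inner_blockMap_lapMatrix_comm (x y : Stack N F) :
    inner ℝ (blockMap (Gr.lapMatrix ℝ) x) y = inner ℝ x (blockMap (Gr.lapMatrix ℝ) y) := by
  rw [inner_blockMap, Gr.isSymm_lapMatrix ℝ]

lemma blockMean_blockMap_lapMatrix (hN0 : N ≠ 0) (x : Stack N F) :
    blockMean (blockMap (Gr.lapMatrix ℝ) x) = 0 := by
  have h : ∀ c : F, inner ℝ (blockMean (blockMap (Gr.lapMatrix ℝ) x)) c = (0 : ℝ) := by
    intro c
    have h1 := inner_diagVec hN0 (blockMap (Gr.lapMatrix ℝ) x) c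
    rw [inner_blockMap_lapMatrix_comm, blockMap_lapMatrix_diagVec, inner_zero_right] at h1
    rcases mul_eq_zero.mp h1.symm with h | h
    · exact absurd (by exact_mod_cast h) hN0
    · exact h
  exact inner_self_eq_zero.mp (h _)

/-- Spectral facts on the Laplacian of a connected graph acting on stacked vectors: the
Rayleigh bounds, and a square root `R` of its pseudo-inverse. -/
lemma exists_sqrt_pseudoinverse (hGr : Gr.Connected) (h2 : 0 < lam2 hN Gr) :
    (∀ x : Stack N F, lam2 hN Gr * ‖x - diagVec N (blockMean x)‖ ^ 2 ≤
      inner ℝ x (blockMap (Gr.lapMatrix ℝ) x)) ∧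
    (∀ x : Stack N F, ‖blockMap (Gr.lapMatrix ℝ) x‖ ≤
      lamN hN Gr * ‖x - diagVec N (blockMean x)‖) ∧
    ∃ R : Stack N F →L[ℝ] Stack N F,
      (∀ v u, blockMean v = 0 →
        inner ℝ (R v) (R (blockMap (Gr.lapMatrix ℝ) u)) = (inner ℝ v u : ℝ)) ∧
      ∀ v, lam2 hN Gr * ‖R v‖ ^ 2 ≤ ‖v‖ ^ 2 := by
  obtain ⟨U, l, hU, hUL, hl, hl0, hlN, hker⟩ := exists_graphFourier hN Gr hGr h2
  have hN0 : N ≠ 0 := by omega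
  have hNpos : 0 < lamN hN Gr := h2.trans_le (lam2_le_lamN hN Gr)
  have hiso : ∀ x y : Stack N F, inner ℝ (blockMap U x) (blockMap U y) = (inner ℝ x y : ℝ) := by
    intro x y
    rw [inner_blockMap, ← blockMap_mul, hU, blockMap_one]
  have hnorm : ∀ x : Stack N F, ‖x‖ ^ 2 = ∑ k, ‖blockMap U x k‖ ^ 2 := by
    intro x
    rw [← PiLp.norm_sq_eq_of_L2, ← real_inner_self_eq_norm_sq, ← real_inner_self_eq_norm_sq, hiso]
  have hdiag : ∀ x : Stack N F, ∀ k,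
      blockMap U (blockMap (Gr.lapMatrix ℝ) x) k = l k • blockMap U x k := by
    intro x k
    rw [← blockMap_mul, hUL, blockMap_mul]
    simp [blockMap_apply, Matrix.diagonal_apply]
  have hzero : ∀ v : Stack N F, blockMean v = 0 → ∀ k, l k = 0 → blockMap U v k = 0 := by
    intro v hv k hk
    have : ∀ j, U k j = U k ⟨0, by omega⟩ := fun j => hker k hk _ _
    simp only [blockMap_apply, this, ← Finset.smul_sum]
    rw [sum_eq_smul_blockMean hN0, hv, smul_zero, smul_zero]
  have hxhat := fun x : Stack N F => blockMean_sub_diagVec hN0 x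
  -- everything is read off in the Fourier coordinates `blockMap U x`
  refine ⟨fun x => ?_, fun x => ?_, ?_⟩
  · set y := x - diagVec N (blockMean x) with hy
    have h1 : inner ℝ x (blockMap (Gr.lapMatrix ℝ) x) =
        (inner ℝ y (blockMap (Gr.lapMatrix ℝ) y) : ℝ) := by
      have hL : blockMap (Gr.lapMatrix ℝ) y = blockMap (Gr.lapMatrix ℝ) x :=
        blockMap_lapMatrix_sub_diagVec Gr x _
      calc inner ℝ x (blockMap (Gr.lapMatrix ℝ) x)
          = inner ℝ x (blockMap (Gr.lapMatrix ℝ) y) := by rw [hL]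
        _ = inner ℝ y (blockMap (Gr.lapMatrix ℝ) x) := by
          rw [← inner_blockMap_lapMatrix_comm, real_inner_comm]
        _ = _ := by rw [hL]
    rw [h1, ← hiso, hnorm, Finset.mul_sum, PiLp.inner_apply]
    refine Finset.sum_le_sum fun k _ => ?_
    rw [hdiag, real_inner_smul_right, real_inner_self_eq_norm_sq]
    rcases hl k with h | h
    · rw [hzero y (hxhat x) k h]
      simp
    · exact mul_le_mul_of_nonneg_right h (sq_nonneg _)
  · set y := x - diagVec N (blockMean x) with hy
    rw [← blockMap_lapMatrix_sub_diagVec Gr x (blockMean x), ← hy]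
    refine (abs_le_of_sq_le_sq' ?_ (by positivity)).2
    rw [mul_pow, hnorm, hnorm y, Finset.mul_sum]
    refine Finset.sum_le_sum fun k _ => ?_
    rw [hdiag, norm_smul, mul_pow, Real.norm_of_nonneg (hl0 k)]
    gcongr
    · exact hl0 k
    · exact hlN k
  · -- `√(0⁻¹) = 0` makes this the square root of the pseudo-inverse on the kernel as well
    refine ⟨(blockMap (Matrix.diagonal fun k => √(l k)⁻¹)).comp (blockMap U), ?_, ?_⟩
    · intro v u hv
      rw [← hiso v u, PiLp.inner_apply, PiLp.inner_apply]
      refine Finset.sum_congr rfl fun k _ => ?_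
      have hD : ∀ x : Stack N F, (blockMap (Matrix.diagonal fun k => √(l k)⁻¹)) x k =
          √(l k)⁻¹ • x k := by
        intro x
        simp [blockMap_apply, Matrix.diagonal_apply]
      rw [ContinuousLinearMap.comp_apply, ContinuousLinearMap.comp_apply, hD, hD, hdiag,
        real_inner_smul_left, real_inner_smul_right, real_inner_smul_right]
      rcases eq_or_ne (l k) 0 with h | h
      · rw [hzero v hv k h]
        simp
      · have h3 : √(l k)⁻¹ * √(l k)⁻¹ = (l k)⁻¹ := Real.mul_self_sqrt (inv_nonneg.mpr (hl0 k))
        rw [← mul_assoc, ← mul_assoc, h3, inv_mul_cancel₀ h, one_mul]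
    · intro v
      rw [hnorm v, PiLp.norm_sq_eq_of_L2, Finset.mul_sum]
      refine Finset.sum_le_sum fun k _ => ?_
      have hD : ((blockMap (Matrix.diagonal fun k => √(l k)⁻¹)).comp (blockMap U)) v k =
          √(l k)⁻¹ • blockMap U v k := by
        rw [ContinuousLinearMap.comp_apply, blockMap_apply]
        simp only [Matrix.diagonal_apply, ite_smul, zero_smul, Finset.sum_ite_eq,
          Finset.mem_univ, if_true]
      rw [hD, norm_smul, mul_pow, Real.norm_of_nonneg (Real.sqrt_nonneg _),
        Real.sq_sqrt (inv_nonneg.mpr (hl0 k)), ← mul_assoc]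
      refine mul_le_of_le_one_left (sq_nonneg _) ?_
      rcases hl k with h | h
      · simp [h]
      · rw [← div_eq_mul_inv, div_le_one (h2.trans_le h)]
        exact h

/-- The largest Laplacian eigenvalue dominates every diagonal entry of the Laplacian, that is,
every degree. -/
lemma one_le_lamN (hGr : Gr.Connected) (h2 : 0 < lam2 hN Gr) : 1 ≤ lamN hN Gr := by
  obtain ⟨U, l, hU, hUL, -, -, hlN, -⟩ := exists_graphFourier hN Gr hGr h2
  set i : Fin N := ⟨0, by omega⟩
  have hdeg : 1 ≤ Gr.degree i := by
    have : Nontrivial (Fin N) := Fin.nontrivial_iff_two_le.mpr hN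
    exact hGr.preconnected.degree_pos_of_nontrivial i
  have h1 : Gr.lapMatrix ℝ i i = Gr.degree i := by
    simp [SimpleGraph.lapMatrix, SimpleGraph.degMatrix]
  have hL : Gr.lapMatrix ℝ = U.transpose * (Matrix.diagonal l * U) := by
    rw [← hUL, ← Matrix.mul_assoc, hU, Matrix.one_mul]
  have hUi : ∑ k, U k i * U k i = 1 := by
    have := congrFun (congrFun hU i) i
    simpa [Matrix.mul_apply] using this
  have h3 : Gr.lapMatrix ℝ i i ≤ lamN hN Gr := by
    rw [hL, Matrix.mul_apply]
    calc ∑ k, U.transpose i k * (Matrix.diagonal l * U) k i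
        = ∑ k, l k * (U k i * U k i) := by
          refine Finset.sum_congr rfl fun k _ => ?_
          rw [Matrix.diagonal_mul, Matrix.transpose_apply]
          ring
      _ ≤ ∑ k, lamN hN Gr * (U k i * U k i) :=
          Finset.sum_le_sum fun k _ => mul_le_mul_of_nonneg_right (hlN k) (mul_self_nonneg _)
      _ = lamN hN Gr := by rw [← Finset.mul_sum, hUi, mul_one]
  rw [h1] at h3
  exact le_trans (by exact_mod_cast hdeg) h3

end Graph

/-! ### Projections and constrained minimizers -/

section Projection

variable {p : ℕ} {K : Set (Out p)}

/-- The variational inequality that characterizes the projection onto a convex set. -/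
lemma IsProj.inner_le_zero (hK : Convex ℝ K) {v s : Out p} (h : IsProj K v s) :
    ∀ w ∈ K, inner ℝ (v - s) (w - s) ≤ (0 : ℝ) := by
  refine (norm_eq_iInf_iff_real_inner_le_zero hK h.1).mp ?_
  have : Nonempty K := ⟨⟨s, h.1⟩⟩
  refine le_antisymm (le_ciInf fun w => ?_) (ciInf_le ⟨0, ?_⟩ (⟨s, h.1⟩ : K))
  · rw [norm_sub_rev v s, norm_sub_rev v w]
    exact h.2 w w.2
  · rintro _ ⟨w, rfl⟩
    exact norm_nonneg _

lemma isProj_of_inner_le_zero {v s : Out p} (hs : s ∈ K)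
    (h : ∀ w ∈ K, inner ℝ (v - s) (w - s) ≤ (0 : ℝ)) : IsProj K v s := by
  refine ⟨hs, fun w hw => ?_⟩
  have h1 := h w hw
  have h2 : ‖w - v‖ ^ 2 = ‖s - v‖ ^ 2 - 2 * inner ℝ (v - s) (w - s) + ‖w - s‖ ^ 2 := by
    rw [show w - v = (s - v) + (w - s) by abel, norm_add_sq_real, ← neg_sub v s, inner_neg_left]
    ring
  refine (abs_le_of_sq_le_sq' ?_ (norm_nonneg _)).2
  nlinarith [sq_nonneg ‖w - s‖]

lemma exists_isProj (hK : IsCompact K) (hne : K.Nonempty) (v : Out p) : ∃ s, IsProj K v s := by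
  obtain ⟨s, hs, hmin⟩ := hK.exists_isMinOn hne
    (f := fun w => ‖w - v‖) (by fun_prop)
  exact ⟨s, hs, fun w hw => hmin hw⟩

/-- Monotonicity of the normal components `v - P_K v`. -/
lemma IsProj.inner_sub_normal_nonneg (hK : Convex ℝ K) {v s v' s' : Out p} (h : IsProj K v s)
    (h' : IsProj K v' s') : (0 : ℝ) ≤ inner ℝ (s - s') ((v - s) - (v' - s')) := by
  have h1 := h.inner_le_zero hK s' h'.1
  have h2 := h'.inner_le_zero hK s h.1
  rw [inner_sub_right, real_inner_comm, real_inner_comm (v' - s')]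
  rw [← neg_sub s s', inner_neg_right] at h1
  linarith

lemma IsProj.norm_sub_le (hK : Convex ℝ K) {v s v' s' : Out p} (h : IsProj K v s)
    (h' : IsProj K v' s') : ‖s - s'‖ ≤ ‖v - v'‖ := by
  have h1 := h.inner_sub_normal_nonneg hK h'
  rw [show v - s - (v' - s') = (v - v') - (s - s') by abel, inner_sub_right,
    real_inner_self_eq_norm_sq] at h1
  have h2 := real_inner_le_norm (s - s') (v - v')
  by_contra hlt
  push Not at hlt
  nlinarith [norm_nonneg (v - v'), norm_nonneg (s - s')]

lemma IsProj.unique (hK : Convex ℝ K) {v s s' : Out p} (h : IsProj K v s)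
    (h' : IsProj K v s') : s = s' := by
  have := h.norm_sub_le hK h'
  rw [sub_self, norm_zero] at this
  exact sub_eq_zero.mp (norm_le_zero_iff.mp this)

/-- Projections of a point onto nested convex sets differ by an amount that is small with the
Hausdorff distance of the sets. -/
lemma norm_sub_sq_le_of_subset {A B : Set (Out p)} (hB : Convex ℝ B) (hBb : IsCompact B)
    (hAB : A ⊆ B) {v s s' : Out p} (h : IsProj A v s) (h' : IsProj B v s') :
    ‖s - s'‖ ^ 2 ≤ Metric.hausdorffDist A B * (2 * ‖v - s'‖ + Metric.hausdorffDist A B) := by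
  have hA : A.Nonempty := ⟨s, h.1⟩
  set d := Metric.hausdorffDist A B with hd
  -- finiteness rules out the junk value `0` of the real Hausdorff distance
  have hfin : Metric.hausdorffEDist B A ≠ ⊤ :=
    Metric.hausdorffEDist_ne_top_of_nonempty_of_bounded ⟨s', h'.1⟩ hA hBb.isBounded
      (hBb.isBounded.subset hAB)
  have hinf : Metric.infDist s' A ≤ d := by
    have := Metric.infDist_le_hausdorffDist_of_mem h'.1 hfin
    rwa [Metric.hausdorffDist_comm] at this
  have hd0 : 0 ≤ d := Metric.hausdorffDist_nonneg
  -- `A` comes within `d` of `s'`, so `s` is almost as close to `v` as `s'`; as `s ∈ B`, the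
  -- obtuse angle at `s'` then keeps `s` near `s'`
  have h1 : ‖s - v‖ ≤ ‖s' - v‖ + d := by
    refine le_of_forall_pos_le_add fun ε hε => ?_
    obtain ⟨w, hw, hlt⟩ :=
      (Metric.infDist_lt_iff hA).mp (lt_of_le_of_lt hinf (lt_add_of_pos_right d hε))
    have h2 := h.2 w hw
    have h3 : ‖w - v‖ ≤ ‖w - s'‖ + ‖s' - v‖ := norm_sub_le_norm_sub_add_norm_sub _ _ _
    rw [dist_comm, dist_eq_norm] at hlt
    linarith
  have h2 := h'.inner_le_zero hB s (hAB h.1)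
  have h3 : ‖s - v‖ ^ 2 = ‖s' - v‖ ^ 2 - 2 * inner ℝ (v - s') (s - s') + ‖s - s'‖ ^ 2 := by
    rw [show s - v = (s' - v) + (s - s') by abel, norm_add_sq_real, ← neg_sub v s',
      inner_neg_left]
    ring
  rw [norm_sub_rev v s']
  nlinarith [norm_nonneg (s - v), norm_nonneg (s' - v)]

end Projection

section Minimizer

variable {N p : ℕ} {f : Fin N → Out p → ℝ} {σ L : Fin N → ℝ} {K : Set (Out p)}

/-- First-order optimality condition. -/
lemma IsMinimizer.inner_gradient_nonneg (hf : ∀ i, IsNiceCost (f i) (σ i) (L i))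
    (hK : Convex ℝ K) {y : Out p} (hy : IsMinimizer f K y) :
    ∀ w ∈ K, (0 : ℝ) ≤ inner ℝ (∑ i, gradient (f i) y) (w - y) := by
  intro w hw
  have hd : HasFDerivAt (fun v => ∑ i, f i v)
      (∑ i, InnerProductSpace.toDual ℝ (Out p) (gradient (f i) y)) y :=
    HasFDerivAt.fun_sum fun i _ => ((hf i).differentiable y).hasGradientAt.hasFDerivAt
  have h := hy.2.localize.hasFDerivWithinAt_nonneg hd.hasFDerivWithinAt
    (sub_mem_posTangentConeAt_of_segment_subset (hK.segment_subset hy.1 hw))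
  rw [← map_sum] at h
  simpa only [InnerProductSpace.toDual_apply_apply] using h

lemma IsMinimizer.unique (hN : N ≠ 0) (hf : ∀ i, IsNiceCost (f i) (σ i) (L i))
    (hK : Convex ℝ K) {y y' : Out p} (hy : IsMinimizer f K y) (hy' : IsMinimizer f K y') :
    y' = y := by
  have h1 := hy.inner_gradient_nonneg hf hK y' hy'.1
  have h2 := hy'.inner_gradient_nonneg hf hK y hy.1
  have h3 : ∑ i, σ i * ‖y' - y‖ ^ 2 ≤
      inner ℝ (∑ i, gradient (f i) y' - ∑ i, gradient (f i) y) (y' - y) := by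
    rw [← Finset.sum_sub_distrib, sum_inner]
    exact Finset.sum_le_sum fun i _ => (hf i).strongly_monotone y' y
  rw [inner_sub_left, ← Finset.sum_mul] at h3
  rw [← neg_sub y' y, inner_neg_right] at h2
  have h4 : 0 < ∑ i, σ i := by
    have : Nonempty (Fin N) := ⟨⟨0, by omega⟩⟩
    exact Finset.sum_pos (fun i _ => (hf i).strong_pos) Finset.univ_nonempty
  have h5 : ‖y' - y‖ ^ 2 ≤ 0 := by
    by_contra hlt
    push Not at hlt
    nlinarith [mul_pos h4 hlt]
  have h6 : ‖y' - y‖ = 0 := by nlinarith [norm_nonneg (y' - y)]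
  exact sub_eq_zero.mp (norm_eq_zero.mp h6)

lemma exists_isMinimizer (hf : ∀ i, IsNiceCost (f i) (σ i) (L i)) (hK : IsCompact K)
    (hne : K.Nonempty) : ∃ y, IsMinimizer f K y := by
  obtain ⟨y, hy, hmin⟩ := hK.exists_isMinOn hne (f := fun v => ∑ i, f i v)
    (continuous_finsetSum _ fun i _ => (hf i).differentiable.continuous).continuousOn
  exact ⟨y, hy, hmin⟩

end Minimizer

/-! ### Dissipation of the consensus and optimization errors -/

section Dissipation

variable {N : ℕ} {F : Type*} [NormedAddCommGroup F] [InnerProductSpace ℝ F]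

/-- Blockwise application of maps `gᵢ : F → F` to a stacked vector. -/
def blockwise (g : Fin N → F → F) (x : Stack N F) : Stack N F :=
  WithLp.toLp 2 (fun i => g i (x i))

@[simp] lemma blockwise_apply (g : Fin N → F → F) (x : Stack N F) (i : Fin N) :
    blockwise g x i = g i (x i) := rfl

lemma norm_blockwise_sub_le {g : Fin N → F → F} {L : ℝ} (hL : 0 ≤ L)
    (hg : ∀ i x y, ‖g i x - g i y‖ ≤ L * ‖x - y‖) (x y : Stack N F) :
    ‖blockwise g x - blockwise g y‖ ≤ L * ‖x - y‖ := by
  refine (abs_le_of_sq_le_sq' ?_ (by positivity)).2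
  rw [mul_pow, PiLp.norm_sq_eq_of_L2, PiLp.norm_sq_eq_of_L2, Finset.mul_sum]
  refine Finset.sum_le_sum fun i _ => ?_
  rw [← mul_pow]
  exact pow_le_pow_left₀ (norm_nonneg _) (hg i _ _) 2

/-- The averaged gradient mismatch `γ = N⁻¹ ∑ (gᵢ(sᵢ) - gᵢ(y))`. -/
def meanMismatch (g : Fin N → F → F) (s : Stack N F) (y : F) : F :=
  blockMean (blockwise g s - blockwise g (diagVec N y))

variable {g : Fin N → F → F} {L σ : ℝ} {τ : Fin N → ℝ} {π : F → F}

lemma norm_diagVec_blockMean_le (hN : N ≠ 0) (x : Stack N F) :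
    ‖diagVec N (blockMean x)‖ ≤ ‖x‖ := by
  refine (abs_le_of_sq_le_sq' ?_ (norm_nonneg _)).2
  rw [norm_sq_eq_mean_add_deviation hN x]
  nlinarith [sq_nonneg ‖x - diagVec N (blockMean x)‖]

/-- A blockwise nonexpansive map does not increase the disagreement of the blocks. -/
lemma norm_projection_deviation_le (hN : N ≠ 0) (hπ : ∀ x y, ‖π x - π y‖ ≤ ‖x - y‖)
    (η : Stack N F) :
    ‖blockwise (fun _ => π) η - diagVec N (blockMean (blockwise (fun _ => π) η))‖ ≤
      ‖η - diagVec N (blockMean η)‖ := by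
  refine (norm_sub_blockMean_le hN _ (π (blockMean η))).trans ?_
  have := norm_blockwise_sub_le (g := fun _ : Fin N => π) (L := 1) zero_le_one
    (fun _ x y => by rw [one_mul]; exact hπ x y) η (diagVec N (blockMean η))
  rwa [one_mul] at this

lemma norm_sub_diagVec_le (s : Stack N F) (y : F) :
    ‖s - diagVec N y‖ ≤
      ‖s - diagVec N (blockMean s)‖ + ‖diagVec N (blockMean s - y)‖ := by
  rw [diagVec_sub]
  exact norm_sub_le_norm_sub_add_norm_sub _ _ _

lemma norm_diagVec_meanMismatch_le (hN : N ≠ 0) (hL : 0 ≤ L)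
    (hg : ∀ i x y, ‖g i x - g i y‖ ≤ L * ‖x - y‖) (s : Stack N F) (y : F) :
    ‖diagVec N (meanMismatch g s y)‖ ≤ L * ‖s - diagVec N y‖ :=
  (norm_diagVec_blockMean_le hN _).trans (norm_blockwise_sub_le hL hg _ _)

/-- Strong monotonicity of the average gradient: it acts on the mean of the blocks, and the
disagreement of the blocks enters through a cross term only. -/
lemma inner_meanMismatch_ge (hN : N ≠ 0) (hL : 0 ≤ L)
    (hg : ∀ i x y, ‖g i x - g i y‖ ≤ L * ‖x - y‖)
    (hm : ∀ i x y, τ i * ‖x - y‖ ^ 2 ≤ inner ℝ (g i x - g i y) (x - y))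
    (hσ : σ = (∑ i, τ i) / N) (s : Stack N F) (y : F) :
    σ * ‖diagVec N (blockMean s - y)‖ ^ 2 -
        L * ‖s - diagVec N (blockMean s)‖ * ‖diagVec N (blockMean s - y)‖ ≤
      inner ℝ (s - diagVec N y) (diagVec N (meanMismatch g s y)) := by
  have hN' : (N : ℝ) ≠ 0 := by exact_mod_cast hN
  set m := blockMean s with hmdef
  have h1 : inner ℝ (s - diagVec N y) (diagVec N (meanMismatch g s y)) =
      (inner ℝ (blockwise g s - blockwise g (diagVec N m)) (diagVec N (m - y)) : ℝ) +
      inner ℝ (blockwise g (diagVec N m) - blockwise g (diagVec N y)) (diagVec N (m - y)) := by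
    rw [← inner_add_left, sub_add_sub_cancel, inner_diagVec hN, inner_diagVec hN, blockMean_sub,
      blockMean_diagVec hN, real_inner_comm]
    rfl
  have h2 : -(L * ‖s - diagVec N m‖ * ‖diagVec N (m - y)‖) ≤
      inner ℝ (blockwise g s - blockwise g (diagVec N m)) (diagVec N (m - y)) := by
    refine neg_le_of_abs_le ((abs_real_inner_le_norm _ _).trans ?_)
    exact mul_le_mul_of_nonneg_right (norm_blockwise_sub_le hL hg _ _) (norm_nonneg _)
  have h3 : σ * ‖diagVec N (m - y)‖ ^ 2 ≤
      inner ℝ (blockwise g (diagVec N m) - blockwise g (diagVec N y)) (diagVec N (m - y)) := by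
    rw [norm_diagVec_sq, ← mul_assoc, hσ, div_mul_cancel₀ _ hN', Finset.sum_mul,
      PiLp.inner_apply]
    exact Finset.sum_le_sum fun i _ => hm i m y
  linarith

/-- Decay of the stacked error `η - η*` along the slow dynamics. Here `a` is the disagreement of
the blocks of `η`, `n` the error of the normal components `ηᵢ - P(ηᵢ)`, `b` the error of the mean
of the projections, and `v`, `w`, `δ` are perturbations, of which `v` has zero mean. -/
lemma inner_slow_dynamics_le (hN : N ≠ 0) [FiniteDimensional ℝ F] (hL : 0 ≤ L)
    (hg : ∀ i x y, ‖g i x - g i y‖ ≤ L * ‖x - y‖)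
    (hm : ∀ i x y, τ i * ‖x - y‖ ^ 2 ≤ inner ℝ (g i x - g i y) (x - y))
    (hσ : σ = (∑ i, τ i) / N) (hπ : ∀ x y, ‖π x - π y‖ ≤ ‖x - y‖)
    (hπm : ∀ x y, (0 : ℝ) ≤ inner ℝ (π x - π y) ((x - π x) - (y - π y)))
    {ℓ : Stack N F → Stack N F} {μ₁ μ₂ : ℝ}
    (hℓ : ∀ x, μ₁ * ‖x - diagVec N (blockMean x)‖ ^ 2 ≤ inner ℝ x (ℓ x))
    (hℓ' : ∀ x, ‖ℓ x‖ ≤ μ₂ * ‖x - diagVec N (blockMean x)‖)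
    (hℓs : ∀ x c, inner ℝ (diagVec N c) (ℓ x) = (0 : ℝ))
    {α k : ℝ} (hα : 0 ≤ α) (hk : 0 ≤ k) {η v w δ s n r : Stack N F} {e : F}
    (hv : blockMean v = 0) (hs : s = blockwise (fun _ => π) η)
    (hn : n = (η - s) - diagVec N (e - π e)) {a b : ℝ}
    (ha : a = ‖η - diagVec N (blockMean η)‖) (hb : b = ‖diagVec N (blockMean s - π e)‖)
    (hr : r = -(k • ℓ η) - n + δ - α • (v + w + diagVec N (meanMismatch g s (π e)))) :
    inner ℝ (η - diagVec N e) r ≤ -(k * μ₁) * a ^ 2 - ‖n‖ ^ 2 - α * σ * b ^ 2 + α * L * a * b +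
        α * L * ‖n‖ * (a + b) + α * a * ‖v‖ + (a + b + ‖n‖) * (α * ‖w‖ + ‖δ‖) ∧
    ‖r‖ ≤ k * μ₂ * a + ‖n‖ + ‖δ‖ + α * (‖v‖ + ‖w‖ + L * (a + b)) := by
  set γ := diagVec N (meanMismatch g s (π e)) with hγ
  -- `η - e` splits into its projected part `S` and its normal part `n`, which make an acute angle
  set S := s - diagVec N (π e) with hS
  have hη : η - diagVec N e = S + n := by
    rw [hn, hS, diagVec_sub]
    abel
  have ha0 : 0 ≤ a := ha ▸ norm_nonneg _
  have hb0 : 0 ≤ b := hb ▸ norm_nonneg _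
  have hdev : ‖s - diagVec N (blockMean s)‖ ≤ a := by
    rw [hs, ha]
    exact norm_projection_deviation_le hN hπ η
  have hSab : ‖S‖ ≤ a + b := by
    have := norm_sub_diagVec_le s (π e)
    rw [← hb] at this
    linarith
  have hγn : ‖γ‖ ≤ L * (a + b) :=
    (norm_diagVec_meanMismatch_le hN hL hg s (π e)).trans (mul_le_mul_of_nonneg_left hSab hL)
  have hSn : (0 : ℝ) ≤ inner ℝ S n := by
    rw [PiLp.inner_apply]
    refine Finset.sum_nonneg fun i _ => ?_
    have := hπm (η i) e
    rw [hS, hn, hs]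
    exact this
  have hSγ : σ * b ^ 2 - L * a * b ≤ inner ℝ S γ := by
    refine le_trans ?_ (inner_meanMismatch_ge hN hL hg hm hσ s (π e))
    rw [← hb]
    have : L * ‖s - diagVec N (blockMean s)‖ * b ≤ L * a * b := by gcongr
    linarith
  constructor
  · have e1 : inner ℝ (η - diagVec N e) (ℓ η) = (inner ℝ η (ℓ η) : ℝ) := by
      rw [inner_sub_left, hℓs, sub_zero]
    -- `v` has zero mean, so it only meets the disagreement of the blocks
    have e2 : inner ℝ (η - diagVec N e) v ≤ a * ‖v‖ ∧
        -(a * ‖v‖) ≤ (inner ℝ (η - diagVec N e) v : ℝ) := by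
      have : inner ℝ (η - diagVec N e) v =
          (inner ℝ (η - diagVec N (blockMean η)) v : ℝ) := by
        have h : ∀ c : F, inner ℝ (diagVec N c) v = (0 : ℝ) := fun c => by
          rw [real_inner_comm, inner_diagVec hN, hv, inner_zero_left, mul_zero]
        rw [inner_sub_left, inner_sub_left, h, h]
      rw [this, ha]
      exact ⟨real_inner_le_norm _ _, neg_le_of_abs_le (abs_real_inner_le_norm _ _)⟩
    have e3 : ‖η - diagVec N e‖ ≤ a + b + ‖n‖ := by
      rw [hη]
      exact (norm_add_le _ _).trans (add_le_add_left hSab _)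
    have e4 : -((a + b + ‖n‖) * ‖w‖) ≤ inner ℝ (η - diagVec N e) w :=
      neg_le_of_abs_le ((abs_real_inner_le_norm _ _).trans
        (mul_le_mul_of_nonneg_right e3 (norm_nonneg _)))
    have e5 : inner ℝ (η - diagVec N e) δ ≤ (a + b + ‖n‖) * ‖δ‖ :=
      (real_inner_le_norm _ _).trans (mul_le_mul_of_nonneg_right e3 (norm_nonneg _))
    have e6 : -(‖n‖ * (L * (a + b))) ≤ inner ℝ n γ :=
      neg_le_of_abs_le ((abs_real_inner_le_norm _ _).trans
        (mul_le_mul_of_nonneg_left hγn (norm_nonneg _)))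
    have e7 : ‖n‖ ^ 2 ≤ inner ℝ (η - diagVec N e) n := by
      rw [hη, inner_add_left, real_inner_self_eq_norm_sq]
      linarith
    have e8 : inner ℝ (η - diagVec N e) γ = (inner ℝ S γ + inner ℝ n γ : ℝ) := by
      rw [hη, inner_add_left]
    have e9 := hℓ η
    rw [← ha] at e9
    rw [hr]
    simp only [inner_sub_right, inner_add_right, inner_neg_right, inner_smul_right]
    rw [e1, e8]
    have f1 := mul_le_mul_of_nonneg_left e9 hk
    have f2 := mul_le_mul_of_nonneg_left e2.2 hα
    have f3 := mul_le_mul_of_nonneg_left e4 hα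
    have f4 := mul_le_mul_of_nonneg_left e6 hα
    have f5 := mul_le_mul_of_nonneg_left hSγ hα
    linarith
  · rw [hr]
    refine (norm_sub_le _ _).trans (add_le_add ((norm_add_le _ _).trans (add_le_add
      ((norm_sub_le _ _).trans (add_le_add ?_ le_rfl)) le_rfl)) ?_)
    · rw [norm_neg, norm_smul, Real.norm_of_nonneg hk, mul_assoc, ha]
      exact mul_le_mul_of_nonneg_left (hℓ' η) hk
    · rw [norm_smul, Real.norm_of_nonneg hα]
      refine mul_le_mul_of_nonneg_left ?_ hα
      exact (norm_add_le _ _).trans (add_le_add (norm_add_le _ _) hγn)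

end Dissipation

/-! ### Absolutely continuous signals and Gronwall's inequality -/

section Analysis

open MeasureTheory Set

lemma absolutelyContinuous_comp_of_contDiff {E : Type*} [NormedAddCommGroup E] [NormedSpace ℝ E]
    {f : ℝ → E} {C : NNReal} {a b : ℝ} (hf : LipschitzOnWith C f (uIcc a b)) {Q : E → ℝ}
    (hQ : ContDiff ℝ 1 Q) : AbsolutelyContinuousOnInterval (fun t => Q (f t)) a b := by
  have hc : IsCompact (f '' uIcc a b) := isCompact_uIcc.image_of_continuousOn hf.continuousOn
  obtain ⟨K, hK⟩ := LocallyLipschitzOn.exists_lipschitzOnWith_of_compact hc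
    (hQ.locallyLipschitz.locallyLipschitzOn (s := f '' uIcc a b))
  exact (hK.comp hf (mapsTo_image f _)).absolutelyContinuousOnInterval

/-- The primitive of a bounded function is Lipschitz, and it is differentiable almost everywhere
with the expected derivative. -/
lemma lipschitzOn_and_ae_hasDerivAt_of_eq_integral {E : Type*} [NormedAddCommGroup E]
    [NormedSpace ℝ E] [CompleteSpace E] {x φ : ℝ → E} {T M : ℝ} (hT : 0 ≤ T)
    (hφ : IntervalIntegrable φ volume 0 T) (hM : ∀ t ∈ Icc 0 T, ‖φ t‖ ≤ M)
    (hx : ∀ t ∈ Icc 0 T, x t = x 0 + ∫ τ in (0 : ℝ)..t, φ τ) :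
    LipschitzOnWith (Real.toNNReal M) x (Icc 0 T) ∧
      ∀ᵐ t, t ∈ Ioo 0 T → HasDerivAt x (φ t) t := by
  have hM0 : 0 ≤ M := (norm_nonneg _).trans (hM 0 ⟨le_rfl, hT⟩)
  have hsub : ∀ a ∈ Icc 0 T, ∀ b ∈ Icc 0 T, IntervalIntegrable φ volume a b := fun a ha b hb =>
    hφ.mono_set (by
      rw [uIcc_of_le hT]
      exact uIcc_subset_Icc ha hb)
  have h0 : (0 : ℝ) ∈ Icc 0 T := ⟨le_rfl, hT⟩
  refine ⟨LipschitzOnWith.of_dist_le_mul fun s hs t ht => ?_, ?_⟩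
  · rw [dist_eq_norm, dist_eq_norm, Real.coe_toNNReal _ hM0, hx s hs, hx t ht,
      add_sub_add_left_eq_sub, intervalIntegral.integral_interval_sub_left (hsub 0 h0 s hs)
      (hsub 0 h0 t ht), Real.norm_eq_abs]
    refine intervalIntegral.norm_integral_le_of_norm_le_const fun τ hτ => hM τ ?_
    exact uIcc_subset_Icc ht hs (uIoc_subset_uIcc hτ)
  · filter_upwards [hφ.ae_hasDerivAt_integral] with t ht htT
    have h1 := (ht (by rw [uIcc_of_le hT]; exact Ioo_subset_Icc_self htT) 0
      (by rw [uIcc_of_le hT]; exact h0)).const_add (x 0)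
    refine h1.congr_of_eventuallyEq ?_
    filter_upwards [Ioo_mem_nhds htT.1 htT.2] with s hs
    exact hx s (Ioo_subset_Icc_self hs)

/-- A nonnegative absolutely continuous function that satisfies
`V' ≤ -c V + ρ(t) (1 + V)` almost everywhere, with `ρ(t) → 0`, tends to zero. -/
lemma tendsto_zero_of_ae_deriv_le {V ρ : ℝ → ℝ} {c : ℝ} (hc : 0 < c)
    (hV : ∀ t, 0 ≤ t → 0 ≤ V t) (hAC : ∀ T, 0 ≤ T → AbsolutelyContinuousOnInterval V 0 T)
    (hρ : Tendsto ρ atTop (𝓝 0))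
    (hd : ∀ᵐ t, 0 < t → deriv V t ≤ -c * V t + ρ t * (1 + V t)) :
    Tendsto V atTop (𝓝 0) := by
  rw [Metric.tendsto_atTop]
  intro ε hε
  -- once `ρ ≤ m`, the hypothesis gives `V' ≤ -κ V + m`, so `exp (κ t) (V - m / κ)` decreases
  set κ := c / 2 with hκ
  have hκ0 : 0 < κ := by positivity
  set m := min κ (ε * κ / 2) with hm
  have hm0 : 0 < m := lt_min hκ0 (by positivity)
  obtain ⟨t₀, ht₀⟩ := (Metric.tendsto_atTop.mp hρ) m hm0
  set t₁ := max t₀ 0 with ht₁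
  have ht₁0 : 0 ≤ t₁ := le_max_right _ _
  have hbound : ∀ t, t₁ ≤ t →
      V t ≤ m / κ + Real.exp (-(κ * (t - t₁))) * V t₁ := by
    intro t ht
    have hVAC : AbsolutelyContinuousOnInterval V t₁ t := by
      refine (hAC t (ht₁0.trans ht)).mono ?_
      rw [uIcc_of_le ht, uIcc_of_le (ht₁0.trans ht)]
      exact Icc_subset_Icc_left ht₁0
    have hE : AbsolutelyContinuousOnInterval (fun t => Real.exp (κ * t)) t₁ t :=
      absolutelyContinuous_comp_of_contDiff (f := fun t => t) (C := 1)
        (LipschitzWith.id.lipschitzOnWith) (Q := fun t => Real.exp (κ * t)) (by fun_prop)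
    have hcst : AbsolutelyContinuousOnInterval (fun _ : ℝ => m / κ) t₁ t :=
      (LipschitzWith.const (m / κ)).lipschitzOnWith.absolutelyContinuousOnInterval (K := 0)
    set Y : ℝ → ℝ := fun t => Real.exp (κ * t) * (V t - m / κ) with hY
    have hYAC : AbsolutelyContinuousOnInterval Y t₁ t := hE.mul (hVAC.sub hcst)
    have hYd : ∀ᵐ s, s ∈ Ioc t₁ t → deriv Y s ≤ 0 := by
      filter_upwards [hd, hVAC.ae_differentiableAt] with s hs hs' hst
      have hs0 : 0 < s := ht₁0.trans_lt hst.1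
      have hdV := (hs' (by rw [uIcc_of_le ht]; exact Ioc_subset_Icc_self hst)).hasDerivAt
      have h1 : HasDerivAt Y (Real.exp (κ * s) * (κ * 1) * (V s - m / κ) +
          Real.exp (κ * s) * deriv V s) s :=
        (((hasDerivAt_id s).const_mul κ).exp).mul (hdV.sub_const _)
      rw [h1.deriv]
      have h2 := hs hs0
      have h3 : |ρ s| < m := by
        have := ht₀ s ((le_max_left _ _).trans hst.1.le)
        rwa [Real.dist_eq, sub_zero] at this
      have h4 : ρ s ≤ m := (le_abs_self _).trans h3.le
      have h5 := hV s hs0.le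
      have h6 : ρ s * (1 + V s) ≤ m + κ * V s := by
        have h7 : m ≤ κ := min_le_left _ _
        nlinarith
      have h8 : κ * (V s - m / κ) = κ * V s - m := by field_simp
      have h9 : κ * (V s - m / κ) + deriv V s ≤ 0 := by
        rw [h8]
        have : c = 2 * κ := by rw [hκ]; ring
        rw [this] at h2
        linarith
      have h10 := mul_nonpos_of_nonneg_of_nonpos (Real.exp_pos (κ * s)).le h9
      linarith
    have hint : ∫ s in t₁..t, deriv Y s ≤ 0 := by
      rw [intervalIntegral.integral_of_le ht]
      refine setIntegral_nonpos_of_ae_restrict ?_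
      exact (ae_restrict_iff' measurableSet_Ioc).mpr hYd
    rw [hYAC.integral_deriv_eq_sub] at hint
    have h1 : Real.exp (κ * t) * (V t - m / κ) ≤ Real.exp (κ * t₁) * (V t₁ - m / κ) := by
      linarith
    have h2 : Real.exp (κ * t₁) = Real.exp (κ * t) * Real.exp (-(κ * (t - t₁))) := by
      rw [← Real.exp_add]
      congr 1
      ring
    rw [h2, mul_assoc] at h1
    have h3 := le_of_mul_le_mul_left h1 (Real.exp_pos _)
    have h4 : 0 ≤ Real.exp (-(κ * (t - t₁))) * (m / κ) := by positivity
    linarith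
  have hlim : Tendsto (fun t => Real.exp (-(κ * (t - t₁))) * V t₁) atTop (𝓝 0) := by
    rw [← zero_mul (V t₁)]
    refine Tendsto.mul_const _ (Real.tendsto_exp_neg_atTop_nhds_zero.comp ?_)
    exact (tendsto_atTop_add_const_right _ (-t₁) tendsto_id).const_mul_atTop hκ0
  obtain ⟨t₂, ht₂⟩ := (Metric.tendsto_atTop.mp hlim) (ε / 2) (by positivity)
  refine ⟨max t₁ t₂, fun t ht => ?_⟩
  have h1 := hbound t ((le_max_left _ _).trans ht)
  have h2 := ht₂ t ((le_max_right _ _).trans ht)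
  rw [Real.dist_eq, sub_zero] at h2
  have h3 : m / κ ≤ ε / 2 := by
    rw [div_le_iff₀ hκ0]
    calc m ≤ ε * κ / 2 := min_le_right _ _
      _ = ε / 2 * κ := by ring
  rw [Real.dist_eq, sub_zero, abs_of_nonneg (hV t (ht₁0.trans ((le_max_left _ _).trans ht)))]
  have h4 := (le_abs_self _).trans_lt h2
  linarith

/-- The derivative of a curve composed with a Lipschitz map is bounded by the Lipschitz constant
times the speed of the curve. -/
lemma norm_deriv_comp_le {E E' : Type*} [NormedAddCommGroup E] [NormedSpace ℝ E]
    [NormedAddCommGroup E'] [NormedSpace ℝ E'] {x : ℝ → E} {q : E → E'} {C : ℝ}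
    (hq : ∀ u v, ‖q u - q v‖ ≤ C * ‖u - v‖) {t : ℝ} {x' : E} {y' : E'}
    (hx : HasDerivAt x x' t) (hy : HasDerivAt (fun s => q (x s)) y' t) : ‖y'‖ ≤ C * ‖x'‖ := by
  have h1 := (hasDerivAt_iff_tendsto_slope.mp hx).norm.const_mul C
  have h2 := (hasDerivAt_iff_tendsto_slope.mp hy).norm
  refine le_of_tendsto_of_tendsto h2 h1 (Eventually.of_forall fun s => ?_)
  simp only [slope_def_module, norm_smul]
  calc ‖(s - t)⁻¹‖ * ‖q (x s) - q (x t)‖ ≤ ‖(s - t)⁻¹‖ * (C * ‖x s - x t‖) := by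
        gcongr
        exact hq _ _
    _ = C * (‖(s - t)⁻¹‖ * ‖x s - x t‖) := by ring

end Analysis

/-! ### Scalar estimates -/

/-- The consequences of the gain conditions on which the stability proof rests. Here `κ = k₁ λ₂`,
`q = k₁ λ_N` and `Λ = k₂ λ₂`. -/
structure GainBounds (α β σ L κ q Λ c D : ℝ) : Prop where
  α_pos : 0 < α
  β_pos : 0 < β
  β_le : β ≤ 1
  σ_pos : 0 < σ
  L_pos : 0 < L
  c_pos : 0 < c
  D_nonneg : 0 ≤ D
  step_small : 12 * (α * L ^ 2) ≤ σ
  αL_le : α * L ≤ 1 / 12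
  ασ_le : α * σ ≤ 1 / 12
  κ_ge : 3 ≤ κ
  q_ge : κ ≤ q
  agent_fast : 4608 * (β ^ 2 * (α * L ^ 2 / σ) * D * q ^ 2) ≤ c ^ 2
  tracking_fast : 576 * q ≤ Λ

/-- The gain conditions in the form in which they are used. Positivity of `β₁`, which follows from
`β < γ_η / (2 γ'_θ)`, makes the step `α` small; the last term of the small-gain bound makes the
agents fast compared with the slow variables, and the second cross condition on `k₂` does the same
for the gradient tracking. -/
lemma Scalars.gainBounds (d : Scalars) (hgain : d.GainsLarge) (hβ : d.SmallGain) (hα : 0 < d.α)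
    (hσ : 0 < d.σ) (hσL : d.σ ≤ d.Lmax) (hN : 2 ≤ d.N) (h12 : d.lam2 ≤ d.lamN)
    (hlamN : 0 < d.lam2 → 1 ≤ d.lamN) (hc : 0 < d.c) (hD : 0 ≤ d.Dmax) (hC : 1 ≤ d.Cmax)
    (hCPi : 0 ≤ d.CPi) (hCcl : 0 ≤ d.Ccl) :
    GainBounds d.α d.β d.σ d.Lmax (d.k₁ * d.lam2) (d.k₁ * d.lamN) (d.k₂ * d.lam2) d.c d.Dmax := by
  obtain ⟨hβ0, hβlt⟩ := hβ
  obtain ⟨hk₁, hk₂, hcons, -, -, hcross⟩ := hgain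
  have hL : 0 < d.Lmax := hσ.trans_le hσL
  simp only [lt_min_iff] at hβlt
  obtain ⟨⟨hβ1, hβη⟩, -, hβx⟩ := hβlt
  have hγde : 0 ≤ d.γηde := by unfold γηde; positivity
  have hγθ' : 0 ≤ d.γθ' := le_trans (by positivity) (le_max_right _ _)
  -- otherwise the bound on `β` would not be positive, even if the quotient is `x / 0 = 0`
  have hγη : 0 < d.γη := by
    by_contra hneg
    have := div_nonpos_of_nonpos_of_nonneg (not_lt.mp hneg) (mul_nonneg zero_le_two hγθ')
    linarith
  have hγηβ : d.γη ≤ d.β₁ / 2 := (min_le_right _ _).trans (min_le_right _ _)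
  have hβ₁ : 0 < d.β₁ := by linarith
  have hb1 : d.β₁ ≤ d.σ * d.α / 4 - d.α ^ 2 * (d.Lmax + d.G * d.M₁) ^ 2 -
      3 * d.α ^ 2 * d.Lmax ^ 2 := (min_le_left _ _).trans (min_le_left _ _)
  have hb2 : d.β₁ ≤ 1 / 6 - 2 * d.σ * d.α := (min_le_left _ _).trans (min_le_right _ _)
  have hb3 : d.β₁ ≤ 1 / 2 * (d.σ₁ - 2 * d.α ^ 2 * d.Lmax ^ 2) :=
    (min_le_right _ _).trans (min_le_left _ _)
  have hb4 : d.β₁ ≤ 1 / 4 := (min_le_right _ _).trans (min_le_right _ _)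
  have hσ₁ : d.σ₁ ≤ d.σ := min_le_left _ _
  have hb5 : d.β₁ ≤ d.σ / 2 := by linarith [sq_nonneg (d.α * d.Lmax)]
  have hstep : 12 * (d.α * d.Lmax ^ 2) ≤ d.σ := by
    have h1 : 0 ≤ d.α * (d.σ / 4 - 3 * (d.α * d.Lmax ^ 2)) := by
      linarith [sq_nonneg (d.α * (d.Lmax + d.G * d.M₁))]
    have h2 := nonneg_of_mul_nonneg_right h1 hα
    linarith
  have hαL : d.α * d.Lmax ≤ 1 / 12 := by
    have h1 : d.Lmax * (12 * (d.α * d.Lmax)) ≤ d.Lmax * 1 := by linarith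
    have h2 := le_of_mul_le_mul_left h1 hL
    linarith
  have hασ : d.α * d.σ ≤ 1 / 12 := by linarith
  have hN0 : 0 < d.N := by linarith
  -- the requirement on `k₁` gives both `k₁ λ₂ ≥ 3` and `k₁ λ₂ ≥ 3 / (2 σ)`
  have hκ : 3 + 3 / (2 * d.σ) ≤ d.k₁ * d.lam2 := by
    have h1 : (6 * d.α * d.Lmax ^ 2 + 3) / (d.N * d.σ) + (2 + 4 * d.α ^ 2 * d.Lmax ^ 2) / d.N ≤
        d.β₂ := le_max_left _ _
    have h2 : 0 ≤ (2 + 4 * d.α ^ 2 * d.Lmax ^ 2) / d.N := by positivity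
    have h3 : 3 / (d.N * d.σ) ≤ (6 * d.α * d.Lmax ^ 2 + 3) / (d.N * d.σ) := by
      gcongr
      have : 0 ≤ 6 * d.α * d.Lmax ^ 2 := by positivity
      linarith
    have h4 : d.N * (3 / (d.N * d.σ)) / 2 = 3 / (2 * d.σ) := by field_simp
    have h5 : d.N * (3 / (d.N * d.σ)) ≤ d.N * d.β₂ :=
      mul_le_mul_of_nonneg_left (by linarith) hN0.le
    linarith
  have h32 : 0 < 3 / (2 * d.σ) := by positivity
  have hlam2 : 0 < d.lam2 := pos_of_mul_pos_right (by linarith : 0 < d.k₁ * d.lam2) hk₁.le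
  have hlN := hlamN hlam2
  set q := d.k₁ * d.lamN with hq
  have hκq : d.k₁ * d.lam2 ≤ q := mul_le_mul_of_nonneg_left h12 hk₁.le
  have hq0 : 0 < q := by positivity
  refine ⟨hα, hβ0, hβ1.le, hσ, hL, hc, hD, hstep, hαL, hασ, by linarith, hκq, ?_, ?_⟩
  · -- the last term of the small-gain bound, keeping from `γ_θ^x̃` only `3 α L² / σ`
    have hω : 3 * (d.α * d.Lmax ^ 2 / d.σ) ≤ d.γθx := by
      have h1 : 6 * d.α * d.Lmax ^ 2 / (d.σ * d.N) + 4 * d.α ^ 2 * d.Lmax ^ 2 / d.N ≤ d.β₃ :=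
        le_max_left _ _
      have h2 : 0 ≤ 4 * d.α ^ 2 * d.Lmax ^ 2 / d.N := by positivity
      have h3 : d.N * (6 * d.α * d.Lmax ^ 2 / (d.σ * d.N)) / 2 =
          3 * (d.α * d.Lmax ^ 2 / d.σ) := by field_simp; ring
      have h4 : d.N * (6 * d.α * d.Lmax ^ 2 / (d.σ * d.N)) ≤ d.N * d.β₃ :=
        mul_le_mul_of_nonneg_left (by linarith) hN0.le
      have h5 : 3 * (d.α * d.Lmax ^ 2 / d.σ) ≤ d.γηe := by
        have : 0 ≤ 36 * d.α ^ 2 * d.Lmax ^ 4 / d.k₂ := by positivity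
        unfold γηe
        linarith
      have h6 : 0 ≤ d.γηe := le_trans (by positivity) h5
      have h7 : d.γηe ≤ d.γηe * d.Cmax := le_mul_of_one_le_right h6 hC
      have h8 : 0 ≤ d.γηde * d.Ccl := by positivity
      have h9 : 0 ≤ d.γηde * d.CPi * d.Cmax * d.α * d.Lmax := by positivity
      unfold γθx
      linarith
    set m := max d.γxz (2 * d.γxη) with hm
    have hm1 : 4 * d.Dmax / d.c * (3 * q ^ 2) ≤ m := by
      refine le_trans ?_ (le_max_right _ _)
      have h1 : 0 ≤ 4 * d.Dmax / d.c * (12 + 9 * d.α ^ 2 * d.Lmax ^ 2) := by positivity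
      have h2 : 2 * d.γxη = 4 * d.Dmax / d.c * (3 * q ^ 2) +
          4 * d.Dmax / d.c * (12 + 9 * d.α ^ 2 * d.Lmax ^ 2) := by
        unfold γxη
        rw [hq]
        ring
      linarith
    have hm0 : 0 ≤ m := le_trans (by positivity) hm1
    have hθ0 : 0 < d.γθx := lt_of_lt_of_le (by positivity) hω
    have h16 : 16 * d.β ^ 2 * (d.γθx * m) ≤ d.c * d.γη := by
      have h1 : 4 * d.β < √(d.c * d.γη / (d.γθx * m)) := by linarith
      have h2 := (Real.lt_sqrt (by positivity)).mp h1
      rcases hm0.eq_or_lt with h0 | h0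
      · rw [← h0]
        simp only [mul_zero]
        positivity
      · rw [lt_div_iff₀ (by positivity)] at h2
        linarith
    have h3 : 3 * (d.α * d.Lmax ^ 2 / d.σ) * (4 * d.Dmax / d.c * (3 * q ^ 2)) ≤ d.γθx * m :=
      mul_le_mul hω hm1 (by positivity) hθ0.le
    have h4 : 16 * d.β ^ 2 * (3 * (d.α * d.Lmax ^ 2 / d.σ) * (4 * d.Dmax / d.c * (3 * q ^ 2))) ≤
        d.c * (1 / 8) :=
      (mul_le_mul_of_nonneg_left h3 (by positivity)).trans
        (h16.trans (mul_le_mul_of_nonneg_left (by linarith) hc.le))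
    have h5 : 16 * d.β ^ 2 * (3 * (d.α * d.Lmax ^ 2 / d.σ) * (4 * d.Dmax / d.c * (3 * q ^ 2))) =
        576 * (d.β ^ 2 * (d.α * d.Lmax ^ 2 / d.σ) * d.Dmax * q ^ 2) / d.c := by
      field_simp
      ring
    rw [h5, div_le_iff₀ hc] at h4
    linarith
  · -- `cross₂` with `L ≥ σ` and `N ≥ 2` gives `k₂ ≥ 384 σ q²`, and `σ k₁ λ₂ ≥ 3 / 2`, `λ_N ≥ 1`
    have h1 : 8 * d.Lmax ^ 2 * d.N / d.k₂ * (6 * q ^ 2) ≤ d.σ / 4 := by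
      have h2 : 0 ≤ 8 * d.Lmax ^ 2 * d.N / d.k₂ := by positivity
      have h3 : 6 * q ^ 2 ≤
          6 * d.lamN ^ 2 * d.k₁ ^ 2 + 24 + 18 * d.α ^ 2 * d.Lmax ^ 2 := by
        have : 0 ≤ 18 * d.α ^ 2 * d.Lmax ^ 2 := by positivity
        rw [hq]
        linarith
      have := mul_le_mul_of_nonneg_left h3 h2
      linarith
    have h2 : 192 * (d.Lmax ^ 2 * d.N * q ^ 2) ≤ d.σ * d.k₂ := by
      rw [div_mul_eq_mul_div, div_le_iff₀ hk₂] at h1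
      linarith
    have h3 : d.σ ^ 2 * 2 * q ^ 2 ≤ d.Lmax ^ 2 * d.N * q ^ 2 := by gcongr
    have h4 : d.σ * (384 * d.σ * q ^ 2) ≤ d.σ * d.k₂ := by linarith
    have h5 : 384 * d.σ * q ^ 2 ≤ d.k₂ := le_of_mul_le_mul_left h4 hσ
    have h6 : 384 * d.σ * q ^ 2 * d.lam2 ≤ d.k₂ * d.lam2 := mul_le_mul_of_nonneg_right h5 hlam2.le
    have h7 : 384 * d.σ * q ^ 2 * d.lam2 = 384 * q * (d.σ * (d.k₁ * d.lam2)) * d.lamN := by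
      rw [hq]
      ring
    have h8 : 3 / 2 ≤ d.σ * (d.k₁ * d.lam2) := by
      have : d.σ * (3 / (2 * d.σ)) ≤ d.σ * (d.k₁ * d.lam2) :=
        mul_le_mul_of_nonneg_left (by linarith) hσ.le
      have h9 : d.σ * (3 / (2 * d.σ)) = 3 / 2 := by field_simp
      linarith
    have h9 : 384 * q * (3 / 2) ≤ 384 * q * (d.σ * (d.k₁ * d.lam2)) :=
      mul_le_mul_of_nonneg_left h8 (by positivity)
    have h10 : 384 * q * (d.σ * (d.k₁ * d.lam2)) ≤
        384 * q * (d.σ * (d.k₁ * d.lam2)) * d.lamN :=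
      le_mul_of_one_le_right (by positivity) hlN
    linarith

section Young

variable {α β σ L κ q Λ c D : ℝ}

/-- Young's inequality applied to all cross terms of the slow dynamics. -/
lemma GainBounds.slow_le (h : GainBounds α β σ L κ q Λ c D) {a b n V X Δ : ℝ} (ha : 0 ≤ a)
    (hn : 0 ≤ n) :
    -κ * a ^ 2 - n ^ 2 - α * σ * b ^ 2 + α * L * a * b + α * L * n * (a + b) + α * a * V +
        (a + b + n) * (α * (L * X) + Δ) ≤
      -(33 / 50 * κ) * a ^ 2 - 3 / 5 * n ^ 2 - 17 / 25 * (α * σ * b ^ 2) +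
        5 / 4 * ((α * V) ^ 2 / κ) + 3 * (α * L ^ 2 / σ * X ^ 2) + 15 / (α * σ) * Δ ^ 2 := by
  obtain ⟨hα, -, -, hσ, hL, -, -, hstep, hαL, hασ, hκ, -, -, -⟩ := h
  set ℓ := α * L with hℓ
  set θ := α * σ with hθ
  set ω := α * L ^ 2 / σ with hω
  have hℓ0 : 0 < ℓ := by positivity
  have hθ0 : 0 < θ := by positivity
  have hω0 : 0 < ω := by positivity
  have hω1 : ω ≤ 1 / 12 := by
    rw [hω, div_le_iff₀ hσ]
    linarith
  have hℓ2 : ℓ ^ 2 = ω * θ := by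
    rw [hℓ, hθ, hω]
    field_simp
  have hκ0 : 0 < κ := by linarith
  have hℓθ : ℓ ^ 2 ≤ θ / 12 := by
    rw [hℓ2]; linarith [mul_le_mul_of_nonneg_right hω1 hθ0.le]
  have hℓω : ℓ ^ 2 ≤ ω / 12 := by
    rw [hℓ2]; linarith [mul_le_mul_of_nonneg_left hασ hω0.le]
  have y1 : ℓ * a * b ≤ θ * b ^ 2 / 12 + a ^ 2 / 4 := by
    linarith [sq_nonneg (ℓ * b - a / 2), mul_le_mul_of_nonneg_right hℓθ (sq_nonneg b)]
  have y2 : ℓ * n * b ≤ θ * b ^ 2 / 12 + n ^ 2 / 4 := by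
    linarith [sq_nonneg (ℓ * b - n / 2), mul_le_mul_of_nonneg_right hℓθ (sq_nonneg b)]
  have y3 : ℓ * n * a ≤ (n ^ 2 + a ^ 2) / 24 := by
    have : ℓ * (n * a) ≤ 1 / 12 * (n * a) := mul_le_mul_of_nonneg_right hαL (by positivity)
    linarith [sq_nonneg (n - a)]
  have y4 : α * a * V ≤ κ * a ^ 2 / 5 + 5 / 4 * ((α * V) ^ 2 / κ) := by
    have h1 : κ * a ^ 2 / 5 + 5 / 4 * ((α * V) ^ 2 / κ) - α * a * V =
        (κ * a * 2 / 5 - α * V) ^ 2 * (5 / 4) / κ := by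
      field_simp
      ring
    have h2 : 0 ≤ (κ * a * 2 / 5 - α * V) ^ 2 * (5 / 4) / κ := by positivity
    linarith
  have y5 : b * (ℓ * X) ≤ θ * b ^ 2 / 10 + 5 / 2 * (ω * X ^ 2) := by
    have h1 : θ * (b * (ℓ * X)) ≤ θ * (θ * b ^ 2 / 10 + 5 / 2 * (ω * X ^ 2)) := by
      have h2 : ℓ ^ 2 * X ^ 2 = ω * θ * X ^ 2 := by rw [hℓ2]
      linarith [sq_nonneg (θ * b / 5 - ℓ * X)]
    exact le_of_mul_le_mul_left h1 hθ0
  have y6 : ∀ r : ℝ, r * (ℓ * X) ≤ r ^ 2 / 10 + 5 / 24 * (ω * X ^ 2) := fun r => by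
    linarith [sq_nonneg (r / 5 - ℓ * X), mul_le_mul_of_nonneg_right hℓω (sq_nonneg X)]
  have y7 : ∀ r : ℝ, r * Δ ≤ θ * r ^ 2 / 20 + 5 / θ * Δ ^ 2 := fun r => by
    have h1 : θ * r ^ 2 / 20 + 5 / θ * Δ ^ 2 - r * Δ = (θ * r / 10 - Δ) ^ 2 * 5 / θ := by
      field_simp
      ring
    have h2 : 0 ≤ (θ * r / 10 - Δ) ^ 2 * 5 / θ := by positivity
    linarith
  have y8 : ∀ r : ℝ, θ * r ^ 2 ≤ r ^ 2 / 12 := fun r => by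
    linarith [mul_le_mul_of_nonneg_right hασ (sq_nonneg r)]
  have y9 : 3 * a ^ 2 ≤ κ * a ^ 2 := mul_le_mul_of_nonneg_right hκ (sq_nonneg a)
  have y10 : 15 / θ * Δ ^ 2 = 3 * (5 / θ * Δ ^ 2) := by ring
  have hX : α * (L * X) = ℓ * X := by rw [hℓ]; ring
  rw [hX, y10]
  have p1 : (a + b + n) * (ℓ * X + Δ) =
      a * (ℓ * X) + b * (ℓ * X) + n * (ℓ * X) + (a * Δ + b * Δ + n * Δ) := by ring
  have p2 : ℓ * n * (a + b) = ℓ * n * a + ℓ * n * b := by ring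
  have w0 : 0 ≤ ω * X ^ 2 := by positivity
  have b0 : 0 ≤ θ * b ^ 2 := by positivity
  rw [p1, p2]
  linarith [y6 a, y6 n, y7 a, y7 b, y7 n, y8 a, y8 n, sq_nonneg a, sq_nonneg n]

/-- The speed `u` of the slow variables, weighted with its gains towards the agents and towards
the gradient tracking, is absorbed by the dissipation. -/
lemma GainBounds.speed_le (h : GainBounds α β σ L κ q Λ c D) {a b n V X Δ u : ℝ} (hu0 : 0 ≤ u)
    (hu : u ≤ β * (q * a + n + Δ + α * (V + L * X + L * (a + b)))) :
    (40 * (α * L ^ 2 / σ) * D / c ^ 2) * u ^ 2 + 16 / κ * (β * (α * L) * u / Λ) ^ 2 ≤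
      7 / 100 * a ^ 2 + 1 / 100 * n ^ 2 + 1 / 100 * (α * σ * b ^ 2) +
        1 / 20 * ((α * V) ^ 2 / κ) + 1 / 100 * (α * L ^ 2 / σ * X ^ 2) + Δ ^ 2 := by
  obtain ⟨hα, hβ0, hβ1, hσ, hL, hc, hD, hstep, hαL, hασ, hκ, hκq, hfast, hΛ⟩ := h
  set ℓ := α * L with hℓ
  set θ := α * σ with hθ
  set ω := α * L ^ 2 / σ with hω
  have hℓ0 : 0 < ℓ := by positivity
  have hθ0 : 0 < θ := by positivity
  have hω0 : 0 < ω := by positivity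
  have hω1 : ω ≤ 1 / 12 := by
    rw [hω, div_le_iff₀ hσ]
    linarith
  have hℓ2 : ℓ ^ 2 = ω * θ := by
    rw [hℓ, hθ, hω]
    field_simp
  have hκ0 : 0 < κ := by linarith
  have hq0 : 0 < q := by linarith
  have hΛ0 : 0 < Λ := by linarith
  have hℓθ : ℓ ^ 2 ≤ θ / 12 := by
    rw [hℓ2]; linarith [mul_le_mul_of_nonneg_right hω1 hθ0.le]
  have hℓω : ℓ ^ 2 ≤ ω / 12 := by
    rw [hℓ2]; linarith [mul_le_mul_of_nonneg_left hασ hω0.le]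
  -- the speed in units of `β q`, the scale at which both gains are small
  set ρ := u / (β * q) with hρ
  have huρ : u = ρ * (β * q) := by rw [hρ]; field_simp
  have hρ0 : 0 ≤ ρ := by positivity
  have t1 : (40 * ω * D / c ^ 2) * u ^ 2 ≤ 40 / 4608 * ρ ^ 2 := by
    have h1 : (40 * ω * D / c ^ 2) * u ^ 2 =
        40 * (β ^ 2 * ω * D * q ^ 2) / c ^ 2 * ρ ^ 2 := by rw [huρ]; ring
    rw [h1]
    refine mul_le_mul_of_nonneg_right ?_ (sq_nonneg _)
    rw [div_le_div_iff₀ (by positivity) (by norm_num)]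
    linarith
  have t2 : 16 / κ * (β * ℓ * u / Λ) ^ 2 ≤ 1 / 1000 * ρ ^ 2 := by
    have h1 : β * ℓ * u / Λ ≤ 1 / 1000 * ρ := by
      rw [div_le_iff₀ hΛ0, huρ]
      have h2 : β * ℓ * (ρ * (β * q)) ≤ 1 * (1 / 12) * (ρ * (1 * q)) := by gcongr
      have h3 : ρ * (576 * q) ≤ ρ * Λ := mul_le_mul_of_nonneg_left hΛ hρ0
      have h4 : 0 ≤ ρ * q := by positivity
      linarith
    have h5 : 0 ≤ β * ℓ * u / Λ := by positivity
    have h6 : 16 / κ ≤ 16 / 3 := by gcongr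
    have h7 : (β * ℓ * u / Λ) ^ 2 ≤ (1 / 1000 * ρ) ^ 2 := pow_le_pow_left₀ h5 h1 2
    have h8 : 16 / κ * (β * ℓ * u / Λ) ^ 2 ≤ 16 / 3 * (1 / 1000 * ρ) ^ 2 := by gcongr
    linarith [sq_nonneg ρ]
  have t3 : q * ρ ≤ (q + ℓ) * a + n + Δ + α * V + ℓ * X + ℓ * b := by
    have h1 : β * (q * ρ) ≤ β * (q * a + n + Δ + α * (V + L * X + L * (a + b))) := by
      rw [huρ] at hu
      linarith
    have h2 := le_of_mul_le_mul_left h1 hβ0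
    have h3 : (q + ℓ) * a + n + Δ + α * V + ℓ * X + ℓ * b =
        q * a + n + Δ + α * (V + L * X + L * (a + b)) := by rw [hℓ]; ring
    linarith
  have t4 : (q * ρ) ^ 2 ≤ 6 * (((q + ℓ) * a) ^ 2 + n ^ 2 + Δ ^ 2 + (α * V) ^ 2 + (ℓ * X) ^ 2 +
      (ℓ * b) ^ 2) := by
    refine (pow_le_pow_left₀ (by positivity) t3 2).trans ?_
    generalize (q + ℓ) * a = x1
    generalize α * V = x4
    generalize ℓ * X = x5
    generalize ℓ * b = x6
    have hsum := sq_sum_le_card_mul_sum_sq (s := Finset.univ) (f := ![x1, n, Δ, x4, x5, x6])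
    simp only [Fin.sum_univ_six, Finset.card_univ, Fintype.card_fin] at hsum
    exact_mod_cast hsum
  have hq9 : 9 ≤ q ^ 2 := by
    have := pow_le_pow_left₀ (by norm_num) (by linarith : (3 : ℝ) ≤ q) 2
    linarith
  have t5 : ((q + ℓ) * a) ^ 2 ≤ q ^ 2 * (53 / 50 * a ^ 2) := by
    have h1 : q + ℓ ≤ 37 / 36 * q := by linarith
    have h2 : (q + ℓ) ^ 2 ≤ (37 / 36 * q) ^ 2 := pow_le_pow_left₀ (by positivity) h1 2
    rw [mul_pow]
    have h3 := mul_le_mul_of_nonneg_right h2 (sq_nonneg a)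
    linarith [mul_nonneg (sq_nonneg q) (sq_nonneg a)]
  have t6 : ∀ r : ℝ, r ^ 2 ≤ q ^ 2 * (r ^ 2 / 9) := fun r => by
    linarith [mul_le_mul_of_nonneg_right hq9 (sq_nonneg r)]
  have t7 : (α * V) ^ 2 ≤ q ^ 2 * ((α * V) ^ 2 / κ / 3) := by
    have h1 : 3 * κ ≤ q ^ 2 := by
      rw [sq]
      exact mul_le_mul (by linarith) hκq hκ0.le hq0.le
    have h2 : (α * V) ^ 2 = (3 * κ) * ((α * V) ^ 2 / κ / 3) := by field_simp
    calc (α * V) ^ 2 = (3 * κ) * ((α * V) ^ 2 / κ / 3) := h2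
      _ ≤ q ^ 2 * ((α * V) ^ 2 / κ / 3) := by gcongr
  have t8 : (ℓ * X) ^ 2 ≤ ω * X ^ 2 / 12 := by
    rw [mul_pow]
    linarith [mul_le_mul_of_nonneg_right hℓω (sq_nonneg X)]
  have t9 : (ℓ * b) ^ 2 ≤ θ * b ^ 2 / 12 := by
    rw [mul_pow]
    linarith [mul_le_mul_of_nonneg_right hℓθ (sq_nonneg b)]
  have w0 : 0 ≤ ω * X ^ 2 := by positivity
  have b0 : 0 ≤ θ * b ^ 2 := by positivity
  have v0 : 0 ≤ (α * V) ^ 2 / κ := by positivity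
  have t10 : ρ ^ 2 ≤ 6 * (53 / 50 * a ^ 2 + n ^ 2 / 9 + Δ ^ 2 / 9 + (α * V) ^ 2 / κ / 3 +
      ω * X ^ 2 / 12 / 9 + θ * b ^ 2 / 12 / 9) := by
    have h1 : q ^ 2 * ρ ^ 2 ≤ q ^ 2 * (6 * (53 / 50 * a ^ 2 + n ^ 2 / 9 + Δ ^ 2 / 9 +
        (α * V) ^ 2 / κ / 3 + ω * X ^ 2 / 12 / 9 + θ * b ^ 2 / 12 / 9)) := by
      have h2 := mul_le_mul_of_nonneg_right hq9 (by positivity : 0 ≤ ω * X ^ 2 / 12 / 9)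
      have h3 := mul_le_mul_of_nonneg_right hq9 (by positivity : 0 ≤ θ * b ^ 2 / 12 / 9)
      rw [← mul_pow]
      linarith [t6 n, t6 Δ]
    exact le_of_mul_le_mul_left h1 (by positivity)
  linarith [sq_nonneg a, sq_nonneg n, sq_nonneg Δ]

/-- The composite dissipation inequality: `dE`, `dΦ`, `dW` are the derivatives of the storage
functions of the slow variables, of the gradient tracking and of the agents. The weights are such
that the decay `-16 (α V)² / κ` of the tracking and `-5 (α L² / σ) W` of the agents, less their own
cross terms, exceeds what these errors contribute to the slow variables. -/
lemma GainBounds.dissipation (h : GainBounds α β σ L κ q Λ c D)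
    {k₂ lam a b n V X W Δ u K dE dΦ dW : ℝ} (hk₂ : 0 < k₂) (hlam : 0 < lam) (hΛ : Λ = k₂ * lam)
    (ha : 0 ≤ a) (hn : 0 ≤ n) (hu0 : 0 ≤ u) (hXW : X ^ 2 ≤ W)
    (hu : u ≤ β * (q * a + n + Δ + α * (V + L * X + L * (a + b))))
    (hE : dE ≤ -κ * a ^ 2 - n ^ 2 - α * σ * b ^ 2 + α * L * a * b + α * L * n * (a + b) +
      α * a * V + (a + b + n) * (α * (L * X) + Δ))
    (hΦ : dΦ ≤ -(k₂ / β) * (V ^ 2 - V * (L * X)) + V * (L * u) / lam)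
    (hW : dW ≤ -(c / 2) * W + 4 / c * D * u ^ 2 + K * Δ ^ 2) :
    dE + 16 * α ^ 2 * β / (κ * k₂) * dΦ + 10 * (α * L ^ 2 / σ) / c * dW ≤
      -(1 / 10 * (a ^ 2 + n ^ 2 + α * σ * b ^ 2) + α ^ 2 / κ * V ^ 2 + α * L ^ 2 / σ * W) +
        (15 / (α * σ) + 1 + 10 * (α * L ^ 2 / σ) / c * K) * Δ ^ 2 := by
  have s1 := h.slow_le (b := b) (V := V) (X := X) (Δ := Δ) ha hn
  have s2 := h.speed_le hu0 hu
  obtain ⟨hα, hβ0, hβ1, hσ, hL, hc, hD, hstep, hαL, hασ, hκ, hκq, hfast, -⟩ := h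
  have hκ0 : 0 < κ := by linarith
  set ω := α * L ^ 2 / σ with hω
  have hω0 : 0 < ω := by positivity
  have hℓω : (α * L) ^ 2 ≤ ω / 12 := by
    have : (α * L) ^ 2 = ω * (α * σ) := by
      rw [hω]
      field_simp
    rw [this]
    linarith [mul_le_mul_of_nonneg_left hασ hω0.le]
  have s3 : 16 * α ^ 2 * β / (κ * k₂) * dΦ ≤ -4 * ((α * V) ^ 2 / κ) + 1 / 4 * (ω * X ^ 2) +
      16 / κ * (β * (α * L) * u / Λ) ^ 2 := by
    refine (mul_le_mul_of_nonneg_left hΦ (by positivity)).trans ?_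
    set y := α * V with hy
    set r := β * (α * L) * u / Λ with hr
    have e1 : 16 * α ^ 2 * β / (κ * k₂) *
        (-(k₂ / β) * (V ^ 2 - V * (L * X)) + V * (L * u) / lam) =
        16 / κ * (-(y ^ 2) + y * (α * L * X) + y * r) := by
      rw [hr, hy, hΛ]
      field_simp
      ring
    have e2 : -(y ^ 2) + y * (α * L * X) + y * r ≤
        -(1 / 4) * y ^ 2 + 1 / 2 * (α * L * X) ^ 2 + r ^ 2 := by
      linarith [sq_nonneg (y - α * L * X), sq_nonneg (y / 2 - r)]
    have e3 : (α * L * X) ^ 2 ≤ ω * X ^ 2 / 12 := by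
      rw [mul_pow]
      linarith [mul_le_mul_of_nonneg_right hℓω (sq_nonneg X)]
    have e4 : 16 / κ * (-(1 / 4) * y ^ 2 + 1 / 2 * (α * L * X) ^ 2 + r ^ 2) =
        -4 * (y ^ 2 / κ) + 8 / κ * (α * L * X) ^ 2 + 16 / κ * r ^ 2 := by ring
    have e5 : 8 / κ * (α * L * X) ^ 2 ≤ 8 / 3 * (ω * X ^ 2 / 12) := by gcongr
    have e6 := mul_le_mul_of_nonneg_left e2 (by positivity : 0 ≤ 16 / κ)
    have w0 : 0 ≤ ω * X ^ 2 := by positivity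
    rw [e1]
    linarith
  have s4 : 10 * ω / c * dW ≤
      -5 * (ω * W) + 40 * ω * D / c ^ 2 * u ^ 2 + 10 * ω / c * K * Δ ^ 2 := by
    refine (mul_le_mul_of_nonneg_left hW (by positivity)).trans (le_of_eq ?_)
    field_simp
    ring
  have s5 : ω * X ^ 2 ≤ ω * W := mul_le_mul_of_nonneg_left hXW hω0.le
  have s6 : 3 * a ^ 2 ≤ κ * a ^ 2 := mul_le_mul_of_nonneg_right hκ (sq_nonneg a)
  have s7 : α ^ 2 / κ * V ^ 2 = (α * V) ^ 2 / κ := by ring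
  have v0 : 0 ≤ (α * V) ^ 2 / κ := by positivity
  have b0 : 0 ≤ α * σ * b ^ 2 := by positivity
  have w0 : 0 ≤ ω * X ^ 2 := by positivity
  rw [s7]
  linarith [sq_nonneg a, sq_nonneg n]

end Young

/-! ### Storage functions of the agents and of the gradient tracking -/

section Storage

open MeasureTheory Set

/-- Young's inequality for the inner product defined by `P`. -/
lemma inner_le_young {E : Type*} [NormedAddCommGroup E] [InnerProductSpace ℝ E] {P : E →L[ℝ] E}
    (hsym : ∀ x y, inner ℝ (P x) y = (inner ℝ x (P y) : ℝ))
    (hpos : ∀ x, ‖x‖ ^ 2 ≤ inner ℝ x (P x)) {ε : ℝ} (hε : 0 < ε) (x y : E) :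
    2 * inner ℝ y (P x) ≤ ε * inner ℝ x (P x) + ε⁻¹ * inner ℝ y (P y) := by
  have h := (sq_nonneg _).trans (hpos (ε • x - y))
  have hc : inner ℝ x (P y) = (inner ℝ y (P x) : ℝ) := by rw [← hsym, real_inner_comm]
  simp only [map_sub, map_smul, inner_sub_left, inner_sub_right, real_inner_smul_left,
    real_inner_smul_right, hc] at h
  have h2 : 0 ≤ ε⁻¹ * (ε * (ε * inner ℝ x (P x)) - ε * inner ℝ y (P x) -
      (ε * inner ℝ y (P x) - inner ℝ y (P y))) := mul_nonneg (by positivity) (by linarith)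
  have h3 : ε⁻¹ * (ε * (ε * inner ℝ x (P x)) - ε * inner ℝ y (P x) -
      (ε * inner ℝ y (P x) - inner ℝ y (P y))) =
      ε * inner ℝ x (P x) - 2 * inner ℝ y (P x) + ε⁻¹ * (inner ℝ y (P y) : ℝ) := by
    field_simp
    ring
  linarith

/-- Decay of the Lyapunov function of one agent that tracks a moving reference with speed `p`
and reference error `δ`. -/
lemma agent_storage_le {E F : Type*} [NormedAddCommGroup E] [InnerProductSpace ℝ E]
    [NormedAddCommGroup F] [NormedSpace ℝ F] {A P : E →L[ℝ] E} {Γ : F →L[ℝ] E} {c D : ℝ}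
    (hc : 0 < c) (hsym : ∀ x y, inner ℝ (P x) y = (inner ℝ x (P y) : ℝ))
    (hpos : ∀ x, ‖x‖ ^ 2 ≤ inner ℝ x (P x))
    (hlyap : ∀ x, 2 * inner ℝ (A x) (P x) ≤ -c * inner ℝ x (P x))
    (hΓ : ∀ u, inner ℝ (Γ u) (P (Γ u)) ≤ D * ‖u‖ ^ 2) (x : E) (p δ : F) :
    2 * inner ℝ (A x - Γ p - A (Γ δ)) (P x) ≤ -(c / 2) * inner ℝ x (P x) +
      4 / c * D * ‖p‖ ^ 2 + 4 / c * (‖P‖ * ‖A.comp Γ‖ ^ 2) * ‖δ‖ ^ 2 := by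
  have y1 := inner_le_young hsym hpos (by positivity : 0 < c / 4) x (-(Γ p))
  have y2 := inner_le_young hsym hpos (by positivity : 0 < c / 4) x (-(A (Γ δ)))
  simp only [map_neg, inner_neg_left, inner_neg_right, neg_neg] at y1 y2
  have hinv : (c / 4)⁻¹ = 4 / c := inv_div c 4
  rw [hinv] at y1 y2
  have h1 : 4 / c * inner ℝ (Γ p) (P (Γ p)) ≤ 4 / c * (D * ‖p‖ ^ 2) :=
    mul_le_mul_of_nonneg_left (hΓ p) (by positivity)
  have h2 : inner ℝ (A (Γ δ)) (P (A (Γ δ))) ≤ ‖P‖ * ‖A.comp Γ‖ ^ 2 * ‖δ‖ ^ 2 := by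
    have h3 : ‖A (Γ δ)‖ ≤ ‖A.comp Γ‖ * ‖δ‖ := (A.comp Γ).le_opNorm δ
    calc inner ℝ (A (Γ δ)) (P (A (Γ δ))) ≤ ‖A (Γ δ)‖ * ‖P (A (Γ δ))‖ := real_inner_le_norm _ _
      _ ≤ ‖A (Γ δ)‖ * (‖P‖ * ‖A (Γ δ)‖) := by gcongr; exact P.le_opNorm _
      _ = ‖P‖ * ‖A (Γ δ)‖ ^ 2 := by ring
      _ ≤ ‖P‖ * (‖A.comp Γ‖ * ‖δ‖) ^ 2 := by gcongr
      _ = ‖P‖ * ‖A.comp Γ‖ ^ 2 * ‖δ‖ ^ 2 := by ring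
  have h4 : 4 / c * inner ℝ (A (Γ δ)) (P (A (Γ δ))) ≤
      4 / c * (‖P‖ * ‖A.comp Γ‖ ^ 2 * ‖δ‖ ^ 2) := mul_le_mul_of_nonneg_left h2 (by positivity)
  rw [inner_sub_left, inner_sub_left]
  linarith [hlyap x]

/-- Decay of the energy `½ ‖R v‖²` of the gradient-tracking error, where `R` is a square root of
the pseudo-inverse of `ℓ`: in this energy the term `ℓ w` costs `⟪v, w⟫` only. -/
lemma tracking_storage_le {H : Type*} [NormedAddCommGroup H] [InnerProductSpace ℝ H]
    {ℓ R : H →L[ℝ] H} {lam K : ℝ} (hlam : 0 < lam) (hK : 0 ≤ K) {v w d : H}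
    (hR : ∀ u, inner ℝ (R v) (R (ℓ u)) = (inner ℝ v u : ℝ))
    (hR' : ∀ u, lam * ‖R u‖ ^ 2 ≤ ‖u‖ ^ 2) {B U : ℝ} (hw : ‖w‖ ≤ B) (hd : ‖d‖ ≤ U) :
    inner ℝ (R v) (R (-(K • ℓ (v + w)) + d)) ≤ -K * (‖v‖ ^ 2 - ‖v‖ * B) + ‖v‖ * U / lam := by
  have h1 : ‖R v‖ * ‖R d‖ ≤ ‖v‖ * U / lam := by
    rw [le_div_iff₀ hlam]
    have h2 : (‖R v‖ * ‖R d‖ * lam) ^ 2 ≤ (‖v‖ * ‖d‖) ^ 2 := by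
      calc (‖R v‖ * ‖R d‖ * lam) ^ 2 = (lam * ‖R v‖ ^ 2) * (lam * ‖R d‖ ^ 2) := by ring
        _ ≤ ‖v‖ ^ 2 * ‖d‖ ^ 2 := mul_le_mul (hR' v) (hR' d) (by positivity) (by positivity)
        _ = _ := by ring
    exact ((abs_le_of_sq_le_sq' h2 (by positivity)).2).trans
      (mul_le_mul_of_nonneg_left hd (norm_nonneg _))
  rw [map_add, map_neg, map_smul, inner_add_right, inner_neg_right, real_inner_smul_right, hR,
    inner_add_right, real_inner_self_eq_norm_sq]
  have h2 := (real_inner_le_norm (R v) (R d)).trans h1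
  have h3 : -(‖v‖ * B) ≤ inner ℝ v w :=
    neg_le_of_abs_le ((abs_real_inner_le_norm _ _).trans
      (mul_le_mul_of_nonneg_left hw (norm_nonneg _)))
  have h4 := mul_le_mul_of_nonneg_left h3 hK
  linarith

/-- Subtraction of the mean of the blocks, as a linear map. -/
def deviation (N : ℕ) (F : Type*) [NormedAddCommGroup F] [InnerProductSpace ℝ F]
    [FiniteDimensional ℝ F] : Stack N F →L[ℝ] Stack N F :=
  blockMap (1 - Matrix.of fun _ _ => (N : ℝ)⁻¹)

variable {N : ℕ} {F : Type} [NormedAddCommGroup F] [InnerProductSpace ℝ F]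
  [FiniteDimensional ℝ F]

lemma deviation_apply (x : Stack N F) : deviation N F x = x - diagVec N (blockMean x) := by
  ext i : 1
  simp [deviation, blockMap_apply, sub_smul, Finset.sum_sub_distrib, Matrix.one_apply, blockMean,
    Finset.smul_sum]

lemma norm_deviation_le (hN : N ≠ 0) (x : Stack N F) : ‖deviation N F x‖ ≤ ‖x‖ := by
  refine (abs_le_of_sq_le_sq' ?_ (norm_nonneg _)).2
  rw [deviation_apply, norm_sq_eq_mean_add_deviation hN x]
  nlinarith [sq_nonneg ‖diagVec N (blockMean x)‖]

end Storage

/-! ### Signals that are Lipschitz on bounded time intervals -/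

section LipschitzSignals

open MeasureTheory Set

/-- `f` is Lipschitz on every interval `[0, T]`. -/
def LipschitzInTime {E : Type*} [PseudoMetricSpace E] (f : ℝ → E) : Prop :=
  ∀ T, 0 ≤ T → ∃ C, LipschitzOnWith C f (Icc 0 T)

variable {E E' : Type*} [NormedAddCommGroup E] [NormedSpace ℝ E] [NormedAddCommGroup E']
  [NormedSpace ℝ E']

lemma LipschitzInTime.comp {f : ℝ → E} (hf : LipschitzInTime f) {q : E → E'} {K : NNReal}
    (hq : LipschitzWith K q) : LipschitzInTime fun t => q (f t) := fun T hT => by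
  obtain ⟨C, hC⟩ := hf T hT
  exact ⟨K * C, hq.comp_lipschitzOnWith hC⟩

lemma LipschitzInTime.comp_of_norm_le {f : ℝ → E} (hf : LipschitzInTime f) {q : E → E'} {K : ℝ}
    (hq : ∀ u v, ‖q u - q v‖ ≤ K * ‖u - v‖) : LipschitzInTime fun t => q (f t) :=
  hf.comp (K := K.toNNReal) (LipschitzWith.of_dist_le_mul fun u v => by
    rw [dist_eq_norm, dist_eq_norm]
    exact (hq u v).trans (mul_le_mul_of_nonneg_right (Real.le_coe_toNNReal K) (norm_nonneg _)))

lemma LipschitzInTime.add {f f' : ℝ → E} (hf : LipschitzInTime f) (hf' : LipschitzInTime f') :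
    LipschitzInTime fun t => f t + f' t := fun T hT => by
  obtain ⟨C, hC⟩ := hf T hT
  obtain ⟨C', hC'⟩ := hf' T hT
  exact ⟨C + C', hC.add hC'⟩

lemma LipschitzInTime.sub {f f' : ℝ → E} (hf : LipschitzInTime f) (hf' : LipschitzInTime f') :
    LipschitzInTime fun t => f t - f' t := fun T hT => by
  obtain ⟨C, hC⟩ := hf T hT
  obtain ⟨C', hC'⟩ := hf' T hT
  exact ⟨C + C', hC.sub hC'⟩

lemma LipschitzInTime.absolutelyContinuous {f : ℝ → E} (hf : LipschitzInTime f) {Q : E → ℝ}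
    (hQ : ContDiff ℝ 1 Q) {T : ℝ} (hT : 0 ≤ T) :
    AbsolutelyContinuousOnInterval (fun t => Q (f t)) 0 T := by
  obtain ⟨C, hC⟩ := hf T hT
  exact absolutelyContinuous_comp_of_contDiff (by rwa [uIcc_of_le hT]) hQ

/-- A property of almost every `t` in each bounded interval holds for almost every `t > 0`. -/
lemma ae_pos_of_forall_nat {p : ℝ → Prop} (h : ∀ n : ℕ, ∀ᵐ t, t ∈ Ioo (0 : ℝ) n → p t) :
    ∀ᵐ t, 0 < t → p t := by
  filter_upwards [ae_all_iff.mpr h] with t ht h0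
  obtain ⟨n, hn⟩ := exists_nat_gt t
  exact ht n ⟨h0, hn⟩

lemma LipschitzInTime.ae_differentiableAt [FiniteDimensional ℝ E] {f : ℝ → E}
    (hf : LipschitzInTime f) : ∀ᵐ t, 0 < t → DifferentiableAt ℝ f t := by
  refine ae_pos_of_forall_nat fun n => ?_
  obtain ⟨C, hC⟩ := hf n (Nat.cast_nonneg n)
  filter_upwards [hC.ae_differentiableWithinAt_of_mem_real] with t ht htn
  exact (ht (Ioo_subset_Icc_self htn)).differentiableAt (Icc_mem_nhds htn.1 htn.2)

lemma absolutelyContinuous_finsetSum {ι : Type*} (s : Finset ι) {f : ι → ℝ → ℝ} {a b : ℝ}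
    (hf : ∀ i ∈ s, AbsolutelyContinuousOnInterval (f i) a b) :
    AbsolutelyContinuousOnInterval (fun t => ∑ i ∈ s, f i t) a b := by
  classical
  induction s using Finset.induction_on with
  | empty =>
    simp only [Finset.sum_empty]
    exact (LipschitzWith.const (0 : ℝ)).lipschitzOnWith.absolutelyContinuousOnInterval (K := 0)
  | insert i s hi ih =>
    simp only [Finset.sum_insert hi]
    exact (hf i (Finset.mem_insert_self i s)).add
      (ih fun j hj => hf j (Finset.mem_insert_of_mem hj))

end LipschitzSignals

/-! ### Convergence of the closed loop -/

section Loop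

open MeasureTheory Set

variable {N : ℕ} {F : Type} [NormedAddCommGroup F] [InnerProductSpace ℝ F]
  [FiniteDimensional ℝ F] {E : Fin N → Type} [∀ i, NormedAddCommGroup (E i)]
  [∀ i, InnerProductSpace ℝ (E i)]

/-- The closed loop in operator form, with a fixed constraint set. `π` stands for the projection
onto that set, `g i` for the gradients with monotonicity constants `τ i`, `ℓ` for the Laplacian and
`R` for a square root of its pseudo-inverse; `e` is the equilibrium of the variables `η i`, so that
`π e` is the minimizer. For agent `i`, `A i` is the closed-loop matrix, `P i` its Lyapunov matrix,
`Γ i` the steady-state map and `C i` the output map. The signal `s` agrees with `π ∘ η` up to an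
error controlled by `h → 0`, and `ζ = z - ∇f(y)` is used in place of `z` because its equation does
not involve the derivative of `∇f(y)`. -/
structure OperatorLoop (N : ℕ) (F : Type) [NormedAddCommGroup F] [InnerProductSpace ℝ F]
    [FiniteDimensional ℝ F] (E : Fin N → Type) [∀ i, NormedAddCommGroup (E i)]
    [∀ i, InnerProductSpace ℝ (E i)] (α β k₁ k₂ σ L lam lamN c D : ℝ) where
  N_ne_zero : N ≠ 0
  bounds : GainBounds α β σ L (k₁ * lam) (k₁ * lamN) (k₂ * lam) c D
  k₁_pos : 0 < k₁
  k₂_pos : 0 < k₂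
  lam_pos : 0 < lam
  τ : Fin N → ℝ
  g : Fin N → F → F
  mean_τ : σ = (∑ i, τ i) / N
  g_lip : ∀ i x y, ‖g i x - g i y‖ ≤ L * ‖x - y‖
  g_mono : ∀ i x y, τ i * ‖x - y‖ ^ 2 ≤ inner ℝ (g i x - g i y) (x - y)
  π : F → F
  π_lip : ∀ x y, ‖π x - π y‖ ≤ ‖x - y‖
  π_mono : ∀ x y, (0 : ℝ) ≤ inner ℝ (π x - π y) ((x - π x) - (y - π y))
  e : F
  equilibrium : e - π e = -(α • blockMean (blockwise g (diagVec N (π e))))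
  ℓ : Stack N F →L[ℝ] Stack N F
  ℓ_diag : ∀ c, ℓ (diagVec N c) = 0
  inner_diag_ℓ : ∀ x c, inner ℝ (diagVec N c) (ℓ x) = (0 : ℝ)
  ℓ_lower : ∀ x, lam * ‖x - diagVec N (blockMean x)‖ ^ 2 ≤ inner ℝ x (ℓ x)
  ℓ_upper : ∀ x, ‖ℓ x‖ ≤ lamN * ‖x - diagVec N (blockMean x)‖
  R : Stack N F →L[ℝ] Stack N F
  R_inv : ∀ v u, blockMean v = 0 → inner ℝ (R v) (R (ℓ u)) = (inner ℝ v u : ℝ)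
  R_bound : ∀ v, lam * ‖R v‖ ^ 2 ≤ ‖v‖ ^ 2
  A : ∀ i, E i →L[ℝ] E i
  P : ∀ i, E i →L[ℝ] E i
  Γ : ∀ i, F →L[ℝ] E i
  C : ∀ i, E i →L[ℝ] F
  P_symm : ∀ i x y, inner ℝ (P i x) y = (inner ℝ x (P i y) : ℝ)
  P_ge : ∀ i x, ‖x‖ ^ 2 ≤ inner ℝ x (P i x)
  lyapunov : ∀ i x, 2 * inner ℝ (A i x) (P i x) ≤ -c * inner ℝ x (P i x)
  P_Γ : ∀ i u, inner ℝ (Γ i u) (P i (Γ i u)) ≤ D * ‖u‖ ^ 2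
  C_Γ : ∀ i u, C i (Γ i u) = u
  C_le : ∀ i x, ‖C i x‖ ≤ ‖x‖
  x : ∀ i, ℝ → E i
  η : ℝ → Stack N F
  s : ℝ → Stack N F
  ζ : ℝ → Stack N F
  h : ℝ → ℝ
  h_nonneg : ∀ t, 0 ≤ h t
  h_tendsto : Tendsto h atTop (𝓝 0)
  s_near : ∀ t, 0 < t → ∀ i, ‖s t i - π (η t i)‖ ^ 2 ≤ h t * (2 * ‖η t i - π (η t i)‖ + h t)
  x_lip : ∀ i, LipschitzInTime (x i)
  η_lip : LipschitzInTime η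
  ζ_lip : LipschitzInTime ζ
  x_der : ∀ i, ∀ᵐ t, 0 < t → HasDerivAt (x i) (A i (x i t - Γ i (s t i))) t
  η_der : ∀ᵐ t, 0 < t → HasDerivAt η (β • (-(k₁ • ℓ (η t)) + (s t - η t) -
    α • (ζ t + WithLp.toLp 2 fun i => g i (C i (x i t))))) t
  ζ_der : ∀ᵐ t, 0 < t → HasDerivAt ζ (-((k₂ / β) •
    ℓ (ζ t + WithLp.toLp 2 fun i => g i (C i (x i t))))) t
  ζ_mean : ∀ t, 0 ≤ t → blockMean (ζ t) = 0

namespace OperatorLoop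

variable {α β k₁ k₂ σ L lam lamN c D : ℝ} (Q : OperatorLoop N F E α β k₁ k₂ σ L lam lamN c D)

/-- Stacked outputs `yᵢ = Cᵢ xᵢ`. -/
def y (t : ℝ) : Stack N F := WithLp.toLp 2 fun i => Q.C i (Q.x i t)

/-- Stacked projections of `ηᵢ` onto the fixed set. -/
def sHat (t : ℝ) : Stack N F := blockwise (fun _ => Q.π) (Q.η t)

/-- Gradients at the projected points. -/
def gHat (t : ℝ) : Stack N F := blockwise Q.g (Q.sHat t)

/-- Deviation of agent `i` from the steady state that corresponds to the projected point. -/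
def xErr (i : Fin N) (t : ℝ) : E i := Q.x i t - Q.Γ i (Q.sHat t i)

/-- Gradient-tracking error. It has zero mean. -/
def v (t : ℝ) : Stack N F := Q.ζ t + deviation N F (Q.gHat t)

/-- Gradient mismatch caused by the output errors. -/
def w (t : ℝ) : Stack N F := blockwise Q.g (Q.y t) - Q.gHat t

/-- Error of the normal components `ηᵢ - π(ηᵢ)`. -/
def n (t : ℝ) : Stack N F := (Q.η t - Q.sHat t) - diagVec N (Q.e - Q.π Q.e)

/-- Storage function of the slow variables. -/
def storageSlow (t : ℝ) : ℝ := 1 / 2 * ‖Q.η t - diagVec N Q.e‖ ^ 2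

/-- Storage function of the gradient tracking. -/
def storageTracking (t : ℝ) : ℝ := 1 / 2 * ‖Q.R (Q.v t)‖ ^ 2

/-- Storage function of the agents. -/
def storageAgents (t : ℝ) : ℝ := ∑ i, inner ℝ (Q.xErr i t) (Q.P i (Q.xErr i t))

/-- The composite Lyapunov function. The factor `1 / β` undoes the time scale of the slow variables;
the other two weights are those of `GainBounds.dissipation`. -/
def lyapunovFun (t : ℝ) : ℝ :=
  1 / β * Q.storageSlow t + 16 * α ^ 2 * β / (k₁ * lam * k₂) * Q.storageTracking t +
    10 * (α * L ^ 2 / σ) / c * Q.storageAgents t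

lemma sHat_lip : LipschitzInTime Q.sHat :=
  Q.η_lip.comp_of_norm_le (norm_blockwise_sub_le (L := 1) zero_le_one fun _ x y => by
    rw [one_mul]
    exact Q.π_lip x y)

lemma gHat_lip : LipschitzInTime Q.gHat :=
  Q.sHat_lip.comp_of_norm_le (norm_blockwise_sub_le Q.bounds.L_pos.le Q.g_lip)

lemma v_lip : LipschitzInTime Q.v :=
  Q.ζ_lip.add (Q.gHat_lip.comp (deviation N F).lipschitz)

lemma xErr_lip (i : Fin N) : LipschitzInTime (Q.xErr i) :=
  (Q.x_lip i).sub (Q.sHat_lip.comp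
    ((Q.Γ i).comp (PiLp.proj 2 (fun _ : Fin N => F) i : Stack N F →L[ℝ] F)).lipschitz)

lemma blockMean_v {t : ℝ} (ht : 0 ≤ t) : blockMean (Q.v t) = 0 := by
  rw [v, blockMean_add, Q.ζ_mean t ht, deviation_apply, blockMean_sub_diagVec Q.N_ne_zero,
    add_zero]

lemma lyapunovFun_absolutelyContinuous {T : ℝ} (hT : 0 ≤ T) :
    AbsolutelyContinuousOnInterval Q.lyapunovFun 0 T := by
  have h1 : AbsolutelyContinuousOnInterval Q.storageSlow 0 T :=
    Q.η_lip.absolutelyContinuous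
      (Q := fun η => 1 / 2 * ‖η - diagVec N Q.e‖ ^ 2)
      (((contDiff_id.sub contDiff_const).norm_sq ℝ).const_smul (1 / 2 : ℝ)) hT
  have h2 : AbsolutelyContinuousOnInterval Q.storageTracking 0 T :=
    Q.v_lip.absolutelyContinuous (Q := fun v => 1 / 2 * ‖Q.R v‖ ^ 2)
      ((Q.R.contDiff.norm_sq ℝ).const_smul (1 / 2 : ℝ)) hT
  have h3 : AbsolutelyContinuousOnInterval Q.storageAgents 0 T :=
    absolutelyContinuous_finsetSum _ fun i _ => (Q.xErr_lip i).absolutelyContinuous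
      (Q := fun x => inner ℝ x (Q.P i x)) (contDiff_id.inner ℝ (Q.P i).contDiff) hT
  exact ((h1.const_mul _).add (h2.const_mul _)).add (h3.const_mul _)

/-- Decomposition of `z` into the tracking error, the gradient mismatch, the mismatch of the mean
gradient and the mean gradient at the equilibrium. -/
lemma tracking_decomposition (t : ℝ) :
    Q.ζ t + blockwise Q.g (Q.y t) = Q.v t + Q.w t +
      diagVec N (meanMismatch Q.g (Q.sHat t) (Q.π Q.e)) +
      diagVec N (blockMean (blockwise Q.g (diagVec N (Q.π Q.e)))) := by
  have h : diagVec N (meanMismatch Q.g (Q.sHat t) (Q.π Q.e)) =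
      diagVec N (blockMean (Q.gHat t)) -
        diagVec N (blockMean (blockwise Q.g (diagVec N (Q.π Q.e)))) := by
    rw [meanMismatch, blockMean_sub, diagVec_sub]
    rfl
  rw [h, v, w, deviation_apply]
  abel

lemma norm_w_le (t : ℝ) : ‖Q.w t‖ ≤ L * √(∑ i, ‖Q.xErr i t‖ ^ 2) := by
  have hL := Q.bounds.L_pos
  refine (norm_blockwise_sub_le hL.le Q.g_lip _ _).trans
    (mul_le_mul_of_nonneg_left ?_ hL.le)
  refine Real.le_sqrt_of_sq_le ?_
  rw [PiLp.norm_sq_eq_of_L2]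
  refine Finset.sum_le_sum fun i _ => pow_le_pow_left₀ (norm_nonneg _) ?_ 2
  have h : (Q.y t - Q.sHat t) i = Q.C i (Q.xErr i t) := by
    rw [xErr, map_sub, Q.C_Γ]
    rfl
  rw [h]
  exact Q.C_le i _

lemma sum_norm_xErr_sq_le (t : ℝ) : ∑ i, ‖Q.xErr i t‖ ^ 2 ≤ Q.storageAgents t :=
  Finset.sum_le_sum fun i _ => Q.P_ge i _

lemma norm_n_le (t : ℝ) : ‖Q.n t‖ ≤ 2 * ‖Q.η t - diagVec N Q.e‖ := by
  have h1 : Q.n t = (Q.η t - diagVec N Q.e) - (Q.sHat t - diagVec N (Q.π Q.e)) := by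
    rw [n, diagVec_sub]
    abel
  have h2 : ‖Q.sHat t - diagVec N (Q.π Q.e)‖ ≤ 1 * ‖Q.η t - diagVec N Q.e‖ :=
    norm_blockwise_sub_le (g := fun _ : Fin N => Q.π) zero_le_one
      (fun _ x y => by rw [one_mul]; exact Q.π_lip x y) (Q.η t) (diagVec N Q.e)
  rw [h1]
  exact (norm_sub_le _ _).trans (by linarith)

lemma lyapunovFun_nonneg_parts (t : ℝ) :
    0 ≤ Q.storageSlow t ∧ 0 ≤ Q.storageTracking t ∧ 0 ≤ Q.storageAgents t :=
  ⟨by unfold storageSlow; positivity, by unfold storageTracking; positivity,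
    (Finset.sum_nonneg fun _ _ => sq_nonneg _).trans (Q.sum_norm_xErr_sq_le t)⟩

lemma weights_pos (Q : OperatorLoop N F E α β k₁ k₂ σ L lam lamN c D) :
    0 < β ∧ 0 < 16 * α ^ 2 * β / (k₁ * lam * k₂) ∧
    0 < 10 * (α * L ^ 2 / σ) / c := by
  have h1 := Q.bounds.α_pos
  have h2 := Q.bounds.β_pos
  have h3 := Q.bounds.σ_pos
  have h4 := Q.bounds.L_pos
  have h5 := Q.bounds.c_pos
  have h6 := Q.k₁_pos
  have h7 := Q.k₂_pos
  have h8 := Q.lam_pos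
  refine ⟨h2, by positivity, by positivity⟩

lemma lyapunovFun_nonneg (t : ℝ) : 0 ≤ Q.lyapunovFun t := by
  obtain ⟨h1, h2, h3⟩ := Q.lyapunovFun_nonneg_parts t
  obtain ⟨w1, w2, w3⟩ := Q.weights_pos
  unfold lyapunovFun
  positivity

/-- The disagreement of the `ηᵢ`. -/
def a (t : ℝ) : ℝ := ‖Q.η t - diagVec N (blockMean (Q.η t))‖

/-- The error of the mean of the projected points. -/
def b (t : ℝ) : ℝ := ‖diagVec N (blockMean (Q.sHat t) - Q.π Q.e)‖

/-- The dissipation rate of the composite Lyapunov function. -/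
def dissipationRate (t : ℝ) : ℝ :=
  1 / 10 * (Q.a t ^ 2 + ‖Q.n t‖ ^ 2 + α * σ * Q.b t ^ 2) + α ^ 2 / (k₁ * lam) * ‖Q.v t‖ ^ 2 +
    α * L ^ 2 / σ * Q.storageAgents t

/-- The dissipation inequality holds at almost every time. -/
lemma ae_deriv_lyapunovFun_le : ∃ K, 0 ≤ K ∧ ∀ᵐ t, 0 < t →
    deriv Q.lyapunovFun t ≤ -Q.dissipationRate t + K * ‖Q.s t - Q.sHat t‖ ^ 2 := by
  obtain ⟨hβ0, hμ, hω⟩ := Q.weights_pos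
  have hα := Q.bounds.α_pos
  have hσ := Q.bounds.σ_pos
  have hL := Q.bounds.L_pos
  have hc := Q.bounds.c_pos
  have hN := Q.N_ne_zero
  set K₁ := ∑ i, 4 / c * (‖Q.P i‖ * ‖(Q.A i).comp (Q.Γ i)‖ ^ 2) with hK₁
  have hK₁0 : 0 ≤ K₁ := Finset.sum_nonneg fun i _ => by positivity
  refine ⟨15 / (α * σ) + 1 + 10 * (α * L ^ 2 / σ) / c * K₁, by positivity, ?_⟩
  filter_upwards [ae_all_iff.mpr Q.x_der, Q.η_der, Q.ζ_der, Q.sHat_lip.ae_differentiableAt,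
    Q.gHat_lip.ae_differentiableAt] with t hx hη hζ hsd hgd ht
  specialize hη ht
  specialize hζ ht
  have hs' := (hsd ht).hasDerivAt
  have hg' := (hgd ht).hasDerivAt
  set s' := deriv Q.sHat t with hs'def
  set g' := deriv Q.gHat t with hg'def
  set r : Stack N F := -(k₁ • Q.ℓ (Q.η t)) - Q.n t + (Q.s t - Q.sHat t) -
    α • (Q.v t + Q.w t + diagVec N (meanMismatch Q.g (Q.sHat t) (Q.π Q.e))) with hr
  have hy : (WithLp.toLp 2 fun i => Q.g i (Q.C i (Q.x i t)) : Stack N F) =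
      blockwise Q.g (Q.y t) := rfl
  rw [hy] at hη hζ
  have hηr : -(k₁ • Q.ℓ (Q.η t)) + (Q.s t - Q.η t) - α • (Q.ζ t + blockwise Q.g (Q.y t)) = r := by
    rw [Q.tracking_decomposition, hr, n, Q.equilibrium,
      show ∀ u : F, diagVec N (-u) = -diagVec N u from fun _ => rfl, diagVec_smul,
      smul_add _ _ (diagVec N (blockMean _))]
    abel
  rw [hηr] at hη
  have hζr : Q.ℓ (Q.ζ t + blockwise Q.g (Q.y t)) = Q.ℓ (Q.v t + Q.w t) := by
    rw [Q.tracking_decomposition, map_add, map_add, Q.ℓ_diag, Q.ℓ_diag, add_zero, add_zero]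
  rw [hζr] at hζ
  -- the projected points and the gradients there are Lipschitz images of `η`, hence no faster
  -- than `‖β • r‖` and `L ‖β • r‖`
  have hu1 : ‖s'‖ ≤ ‖β • r‖ := by
    have := norm_deriv_comp_le (q := blockwise fun _ : Fin N => Q.π) (C := 1)
      (norm_blockwise_sub_le zero_le_one fun _ x y => by rw [one_mul]; exact Q.π_lip x y) hη hs'
    rwa [one_mul] at this
  have hu2 : ‖g'‖ ≤ L * ‖β • r‖ :=
    (norm_deriv_comp_le (q := blockwise Q.g) (norm_blockwise_sub_le hL.le Q.g_lip) hs' hg').trans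
      (mul_le_mul_of_nonneg_left hu1 hL.le)
  have hβr : ‖β • r‖ = β * ‖r‖ := by rw [norm_smul, Real.norm_of_nonneg hβ0.le]
  have hslow := inner_slow_dynamics_le (ℓ := Q.ℓ) (e := Q.e) hN hL.le Q.g_lip Q.g_mono Q.mean_τ
    Q.π_lip Q.π_mono Q.ℓ_lower Q.ℓ_upper Q.inner_diag_ℓ hα.le Q.k₁_pos.le
    (Q.blockMean_v ht.le) (s := Q.sHat t) rfl (n := Q.n t) rfl (a := Q.a t) rfl (b := Q.b t) rfl hr
  have hdE : HasDerivAt (fun t => 1 / β * Q.storageSlow t)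
      (inner ℝ (Q.η t - diagVec N Q.e) r) t := by
    have h1 := (((hη.sub_const (diagVec N Q.e)).norm_sq).const_mul (1 / 2)).const_mul (1 / β)
    refine h1.congr_deriv ?_
    rw [real_inner_smul_right]
    field_simp
  have hdv : HasDerivAt Q.v (-((k₂ / β) • Q.ℓ (Q.v t + Q.w t)) + deviation N F g') t :=
    hζ.add ((deviation N F).hasFDerivAt.comp_hasDerivAt t hg')
  have hdΦ := ((Q.R.hasFDerivAt.comp_hasDerivAt t hdv).norm_sq).const_mul (1 / 2)
  set X := √(∑ i, ‖Q.xErr i t‖ ^ 2) with hX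
  have hXsq : X ^ 2 = ∑ i, ‖Q.xErr i t‖ ^ 2 :=
    Real.sq_sqrt (Finset.sum_nonneg fun _ _ => sq_nonneg _)
  have hΦ := tracking_storage_le (R := Q.R) (ℓ := Q.ℓ) (d := deviation N F g') Q.lam_pos
    (div_pos Q.k₂_pos hβ0).le (fun u => Q.R_inv (Q.v t) u (Q.blockMean_v ht.le)) Q.R_bound
    (Q.norm_w_le t) ((norm_deviation_le hN g').trans hu2)
  have hdx : ∀ i, HasDerivAt (Q.xErr i) (Q.A i (Q.xErr i t) - Q.Γ i (s' i) -
      Q.A i (Q.Γ i ((Q.s t - Q.sHat t) i))) t := by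
    intro i
    have h1 := (hx i ht).sub
      (((Q.Γ i).comp (PiLp.proj 2 (fun _ : Fin N => F) i :
        Stack N F →L[ℝ] F)).hasFDerivAt.comp_hasDerivAt t hs')
    refine h1.congr_deriv ?_
    simp only [xErr, ContinuousLinearMap.comp_apply, PiLp.proj_apply, PiLp.sub_apply, map_sub]
    abel
  have hdW : HasDerivAt Q.storageAgents (∑ i, 2 * inner ℝ (Q.A i (Q.xErr i t) - Q.Γ i (s' i) -
      Q.A i (Q.Γ i ((Q.s t - Q.sHat t) i))) (Q.P i (Q.xErr i t))) t := by
    refine HasDerivAt.fun_sum fun i _ => ?_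
    have h1 := (hdx i).inner ℝ ((Q.P i).hasFDerivAt.comp_hasDerivAt t (hdx i))
    refine h1.congr_deriv ?_
    simp only [Function.comp_apply]
    rw [← Q.P_symm, real_inner_comm]
    ring
  have hW : ∑ i, 2 * inner ℝ (Q.A i (Q.xErr i t) - Q.Γ i (s' i) -
      Q.A i (Q.Γ i ((Q.s t - Q.sHat t) i))) (Q.P i (Q.xErr i t)) ≤
      -(c / 2) * Q.storageAgents t + 4 / c * D * ‖β • r‖ ^ 2 +
        K₁ * ‖Q.s t - Q.sHat t‖ ^ 2 := by
    have h1 := Finset.sum_le_sum fun i (_ : i ∈ Finset.univ) =>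
      agent_storage_le hc (Q.P_symm i) (Q.P_ge i) (Q.lyapunov i) (Q.P_Γ i) (Q.xErr i t) (s' i)
        ((Q.s t - Q.sHat t) i)
    refine h1.trans ?_
    rw [Finset.sum_add_distrib, Finset.sum_add_distrib, ← Finset.mul_sum, ← Finset.mul_sum,
      ← PiLp.norm_sq_eq_of_L2]
    have h2 : 4 / c * D * ‖s'‖ ^ 2 ≤ 4 / c * D * ‖β • r‖ ^ 2 := by
      have := Q.bounds.D_nonneg
      gcongr
    have h3 : ∑ i, 4 / c * (‖Q.P i‖ * ‖(Q.A i).comp (Q.Γ i)‖ ^ 2) *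
        ‖(Q.s t - Q.sHat t) i‖ ^ 2 ≤ K₁ * ‖Q.s t - Q.sHat t‖ ^ 2 := by
      rw [hK₁, Finset.sum_mul]
      refine Finset.sum_le_sum fun i _ => mul_le_mul_of_nonneg_left ?_ (by positivity)
      exact pow_le_pow_left₀ (norm_nonneg _) (PiLp.norm_apply_le _ i) 2
    exact add_le_add (add_le_add le_rfl h2) h3
  have hdV := (hdE.add (hdΦ.const_mul (16 * α ^ 2 * β / (k₁ * lam * k₂)))).add
    (hdW.const_mul (10 * (α * L ^ 2 / σ) / c))
  have hderiv : deriv Q.lyapunovFun t = _ := hdV.deriv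
  rw [hderiv]
  refine Q.bounds.dissipation (lam := lam) (k₂ := k₂) (X := X) (Δ := ‖Q.s t - Q.sHat t‖)
    (u := ‖β • r‖) (V := ‖Q.v t‖) Q.k₂_pos Q.lam_pos rfl (norm_nonneg _) (norm_nonneg _)
    (norm_nonneg _) (hXsq.trans_le (Q.sum_norm_xErr_sq_le t)) ?_ ?_ ?_ hW
  · rw [hβr]
    refine mul_le_mul_of_nonneg_left (hslow.2.trans ?_) hβ0.le
    have := mul_le_mul_of_nonneg_left (Q.norm_w_le t) hα.le
    linarith
  · refine hslow.1.trans ?_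
    have h1 : 0 ≤ Q.a t + Q.b t + ‖Q.n t‖ :=
      add_nonneg (add_nonneg (norm_nonneg _) (norm_nonneg _)) (norm_nonneg _)
    have h2 := mul_le_mul_of_nonneg_left (mul_le_mul_of_nonneg_left (Q.norm_w_le t) hα.le) h1
    linarith
  · have h1 : ∀ p : ℝ, 1 / 2 * (2 * p) = p := fun p => by ring
    rw [h1]
    exact hΦ

/-- The dissipation rate dominates the composite Lyapunov function. -/
lemma exists_lyapunovFun_le_dissipationRate :
    ∃ c₀, 0 < c₀ ∧ ∀ t, c₀ * Q.lyapunovFun t ≤ Q.dissipationRate t := by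
  obtain ⟨hβ0, hμ, hω⟩ := Q.weights_pos
  have hα := Q.bounds.α_pos
  have hσ := Q.bounds.σ_pos
  have hL := Q.bounds.L_pos
  have hk₁ := Q.k₁_pos
  have hlam := Q.lam_pos
  have hσα := Q.bounds.ασ_le
  set μ := 16 * α ^ 2 * β / (k₁ * lam * k₂) with hμdef
  set ν := 10 * (α * L ^ 2 / σ) / c with hνdef
  have hθ : 0 < α * σ := by positivity
  set c₀ := min (α * σ / 20 * β) (min (α ^ 2 / (k₁ * lam) / (μ / (2 * lam)))
    (α * L ^ 2 / σ / ν)) with hc₀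
  have hc0 : 0 < c₀ := by
    refine lt_min (by positivity) (lt_min (by positivity) (by positivity))
  refine ⟨c₀, hc0, fun t => ?_⟩
  have h1 : c₀ * (1 / β) ≤ α * σ / 20 := by
    rw [mul_one_div, div_le_iff₀ hβ0]
    exact min_le_left _ _
  have h2 : c₀ * (μ / (2 * lam)) ≤ α ^ 2 / (k₁ * lam) := by
    rw [← le_div_iff₀ (by positivity)]
    exact (min_le_right _ _).trans (min_le_left _ _)
  have h3 : c₀ * ν ≤ α * L ^ 2 / σ := by
    rw [← le_div_iff₀ hω]
    exact (min_le_right _ _).trans (min_le_right _ _)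
  obtain ⟨p1, p2, p3⟩ := Q.lyapunovFun_nonneg_parts t
  have ha : 0 ≤ Q.a t := norm_nonneg _
  have hb : 0 ≤ Q.b t := norm_nonneg _
  have e1 : Q.storageSlow t ≤ 2 * Q.a t ^ 2 + 2 * Q.b t ^ 2 + ‖Q.n t‖ ^ 2 := by
    have f1 : Q.η t - diagVec N Q.e = (Q.sHat t - diagVec N (Q.π Q.e)) + Q.n t := by
      rw [n, diagVec_sub]
      abel
    have f2 : ‖Q.sHat t - diagVec N (Q.π Q.e)‖ ≤ Q.a t + Q.b t :=
      (norm_sub_diagVec_le _ _).trans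
        (add_le_add (norm_projection_deviation_le Q.N_ne_zero Q.π_lip (Q.η t)) le_rfl)
    have f3 : ‖Q.η t - diagVec N Q.e‖ ≤ Q.a t + Q.b t + ‖Q.n t‖ := by
      rw [f1]
      exact (norm_add_le _ _).trans (add_le_add f2 le_rfl)
    have f4 := pow_le_pow_left₀ (norm_nonneg _) f3 2
    unfold storageSlow
    nlinarith [sq_nonneg (Q.a t - Q.b t), sq_nonneg (Q.a t + Q.b t - ‖Q.n t‖)]
  have e2 : Q.storageTracking t ≤ 1 / (2 * lam) * ‖Q.v t‖ ^ 2 := by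
    have := Q.R_bound (Q.v t)
    unfold storageTracking
    calc 1 / 2 * ‖Q.R (Q.v t)‖ ^ 2 = 1 / (2 * lam) * (lam * ‖Q.R (Q.v t)‖ ^ 2) := by field_simp
      _ ≤ 1 / (2 * lam) * ‖Q.v t‖ ^ 2 := by gcongr
  have g1 : c₀ * (1 / β) * Q.storageSlow t ≤
      1 / 10 * (Q.a t ^ 2 + ‖Q.n t‖ ^ 2 + α * σ * Q.b t ^ 2) := by
    have q1 : c₀ * (1 / β) * Q.storageSlow t ≤
        α * σ / 20 * (2 * Q.a t ^ 2 + 2 * Q.b t ^ 2 + ‖Q.n t‖ ^ 2) := by gcongr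
    have q2 := mul_le_mul_of_nonneg_right hσα (sq_nonneg (Q.a t))
    have q3 := mul_le_mul_of_nonneg_right hσα (sq_nonneg ‖Q.n t‖)
    linarith [sq_nonneg (Q.a t), sq_nonneg ‖Q.n t‖]
  have g2 : c₀ * μ * Q.storageTracking t ≤ α ^ 2 / (k₁ * lam) * ‖Q.v t‖ ^ 2 := by
    calc c₀ * μ * Q.storageTracking t ≤ c₀ * μ * (1 / (2 * lam) * ‖Q.v t‖ ^ 2) := by gcongr
      _ = c₀ * (μ / (2 * lam)) * ‖Q.v t‖ ^ 2 := by ring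
      _ ≤ _ := by gcongr
  have g3 : c₀ * ν * Q.storageAgents t ≤ α * L ^ 2 / σ * Q.storageAgents t := by gcongr
  unfold lyapunovFun dissipationRate
  rw [← hμdef, ← hνdef]
  linarith

/-- The error made by projecting onto the moving sets instead of the fixed one is small compared
with the Lyapunov function. -/
lemma norm_projectionError_sq_le {t : ℝ} (ht : 0 < t) :
    ‖Q.s t - Q.sHat t‖ ^ 2 ≤
      Q.h t * (N + N * Q.h t + 2 * ‖diagVec N (Q.e - Q.π Q.e)‖ ^ 2 + 16 * β) *
        (1 + Q.lyapunovFun t) := by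
  obtain ⟨hβ0, hμ, hω⟩ := Q.weights_pos
  obtain ⟨p1, p2, p3⟩ := Q.lyapunovFun_nonneg_parts t
  have hV0 := Q.lyapunovFun_nonneg t
  have hh := Q.h_nonneg t
  set d := ‖diagVec N (Q.e - Q.π Q.e)‖ with hd
  have h1 : ‖Q.s t - Q.sHat t‖ ^ 2 ≤ Q.h t * (N + N * Q.h t + ‖Q.η t - Q.sHat t‖ ^ 2) := by
    rw [PiLp.norm_sq_eq_of_L2, PiLp.norm_sq_eq_of_L2]
    calc ∑ i, ‖(Q.s t - Q.sHat t) i‖ ^ 2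
        ≤ ∑ i, Q.h t * (1 + Q.h t + ‖(Q.η t - Q.sHat t) i‖ ^ 2) := by
          refine Finset.sum_le_sum fun i _ => (Q.s_near t ht i).trans ?_
          refine mul_le_mul_of_nonneg_left ?_ hh
          change 2 * ‖Q.η t i - Q.π (Q.η t i)‖ + Q.h t ≤
            1 + Q.h t + ‖Q.η t i - Q.π (Q.η t i)‖ ^ 2
          nlinarith [sq_nonneg (‖Q.η t i - Q.π (Q.η t i)‖ - 1)]
      _ = Q.h t * (N + N * Q.h t + ∑ i, ‖(Q.η t - Q.sHat t) i‖ ^ 2) := by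
          rw [← Finset.mul_sum, Finset.sum_add_distrib, Finset.sum_const, Finset.card_univ,
            Fintype.card_fin, nsmul_eq_mul]
          ring
  have h2 : ‖Q.η t - Q.sHat t‖ ≤ ‖Q.n t‖ + d := by
    have : Q.η t - Q.sHat t = Q.n t + diagVec N (Q.e - Q.π Q.e) := by
      rw [n]
      abel
    rw [this]
    exact norm_add_le _ _
  have h3 : ‖Q.η t - Q.sHat t‖ ^ 2 ≤ 2 * ‖Q.n t‖ ^ 2 + 2 * d ^ 2 := by
    have := pow_le_pow_left₀ (norm_nonneg _) h2 2
    nlinarith [sq_nonneg (‖Q.n t‖ - d)]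
  have h4 : ‖Q.n t‖ ^ 2 ≤ 8 * Q.storageSlow t := by
    have := pow_le_pow_left₀ (norm_nonneg _) (Q.norm_n_le t) 2
    unfold storageSlow
    linarith
  have h5 : Q.storageSlow t ≤ β * Q.lyapunovFun t := by
    have h6 : 0 ≤ 16 * α ^ 2 * β / (k₁ * lam * k₂) * Q.storageTracking t := by positivity
    have h7 : 0 ≤ 10 * (α * L ^ 2 / σ) / c * Q.storageAgents t := by positivity
    have h8 : β * (1 / β * Q.storageSlow t) ≤ β * Q.lyapunovFun t := by
      refine mul_le_mul_of_nonneg_left ?_ hβ0.le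
      unfold lyapunovFun
      linarith
    rwa [← mul_assoc, mul_one_div_cancel hβ0.ne', one_mul] at h8
  refine h1.trans ?_
  rw [mul_assoc]
  refine mul_le_mul_of_nonneg_left ?_ hh
  have h9 : 0 ≤ (N + N * Q.h t + 2 * d ^ 2) * Q.lyapunovFun t := by positivity
  nlinarith

theorem tendsto_lyapunovFun : Tendsto Q.lyapunovFun atTop (𝓝 0) := by
  obtain ⟨K, hK, hdiss⟩ := Q.ae_deriv_lyapunovFun_le
  obtain ⟨c₀, hc₀, hle⟩ := Q.exists_lyapunovFun_le_dissipationRate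
  set ρ : ℝ → ℝ := fun t => K * (Q.h t *
    (N + N * Q.h t + 2 * ‖diagVec N (Q.e - Q.π Q.e)‖ ^ 2 + 16 * β)) with hρ
  refine tendsto_zero_of_ae_deriv_le (ρ := ρ) hc₀ (fun t _ => Q.lyapunovFun_nonneg t)
    (fun T hT => Q.lyapunovFun_absolutelyContinuous hT) ?_ ?_
  · have h := Q.h_tendsto
    have h1 := ((h.mul ((((h.const_mul (N : ℝ)).const_add (N : ℝ)).add_const
      (2 * ‖diagVec N (Q.e - Q.π Q.e)‖ ^ 2)).add_const (16 * β))).const_mul K)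
    rwa [zero_mul, mul_zero] at h1
  · filter_upwards [hdiss] with t ht h0
    have h1 := mul_le_mul_of_nonneg_left (Q.norm_projectionError_sq_le h0) hK
    have h2 := ht h0
    have h3 := hle t
    have h4 : ρ t * (1 + Q.lyapunovFun t) = K * (Q.h t * (N + N * Q.h t +
        2 * ‖diagVec N (Q.e - Q.π Q.e)‖ ^ 2 + 16 * β) * (1 + Q.lyapunovFun t)) := by
      rw [hρ]
      ring
    rw [h4]
    linarith

/-- The outputs converge to the projection of the equilibrium: `yᵢ` tracks `π (ηᵢ)`, and `ηᵢ`
converges to `e`. -/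
theorem tendsto_output (i : Fin N) :
    Tendsto (fun t => Q.C i (Q.x i t)) atTop (𝓝 (Q.π Q.e)) := by
  obtain ⟨hβ0, hμ, hω⟩ := Q.weights_pos
  set ν := 10 * (α * L ^ 2 / σ) / c with hν
  have hV := Q.tendsto_lyapunovFun
  refine tendsto_iff_norm_sub_tendsto_zero.mpr ?_
  have hlim : Tendsto (fun t => √(ν⁻¹ * Q.lyapunovFun t) + √(2 * β * Q.lyapunovFun t))
      atTop (𝓝 0) := by
    have h1 := (hV.const_mul ν⁻¹).sqrt.add (hV.const_mul (2 * β)).sqrt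
    rwa [mul_zero, mul_zero, Real.sqrt_zero, add_zero] at h1
  refine squeeze_zero (fun t => norm_nonneg _) (fun t => ?_) hlim
  obtain ⟨p1, p2, p3⟩ := Q.lyapunovFun_nonneg_parts t
  have q1 : 0 ≤ 1 / β * Q.storageSlow t := by positivity
  have q2 : 0 ≤ 16 * α ^ 2 * β / (k₁ * lam * k₂) * Q.storageTracking t := by positivity
  have q3 : 0 ≤ ν * Q.storageAgents t := by positivity
  have e1 : ‖Q.xErr i t‖ ≤ √(ν⁻¹ * Q.lyapunovFun t) := by
    refine Real.le_sqrt_of_sq_le ?_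
    have h1 : ‖Q.xErr i t‖ ^ 2 ≤ ∑ j, ‖Q.xErr j t‖ ^ 2 :=
      Finset.single_le_sum (f := fun j => ‖Q.xErr j t‖ ^ 2) (fun _ _ => sq_nonneg _)
        (Finset.mem_univ i)
    refine (h1.trans (Q.sum_norm_xErr_sq_le t)).trans ?_
    rw [← div_eq_inv_mul, le_div_iff₀' hω]
    unfold lyapunovFun
    linarith
  have e2 : ‖Q.η t i - Q.e‖ ≤ √(2 * β * Q.lyapunovFun t) := by
    refine (PiLp.norm_apply_le (Q.η t - diagVec N Q.e) i).trans (Real.le_sqrt_of_sq_le ?_)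
    have h1 : ‖Q.η t - diagVec N Q.e‖ ^ 2 = 2 * β * (1 / β * Q.storageSlow t) := by
      unfold storageSlow
      field_simp
    rw [h1]
    refine mul_le_mul_of_nonneg_left ?_ (by positivity)
    unfold lyapunovFun
    linarith
  have e3 : Q.C i (Q.x i t) - Q.π Q.e = Q.C i (Q.xErr i t) + (Q.π (Q.η t i) - Q.π Q.e) := by
    rw [xErr, map_sub, Q.C_Γ]
    simp only [sHat, blockwise_apply]
    abel
  rw [e3]
  refine (norm_add_le _ _).trans (add_le_add ((Q.C_le i _).trans e1) ((Q.π_lip _ _).trans e2))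

end OperatorLoop

end Loop

open MeasureTheory Set

/-! ### Integral equations with bounded right-hand sides -/

section Integral

variable {N : ℕ} {E F : Type*} [NormedAddCommGroup E] [NormedSpace ℝ E]
  [NormedAddCommGroup F] [NormedSpace ℝ F]

/-- Integrability and boundedness of a signal on every interval `[0, T]`. -/
def LocallyBoundedIntegrable (φ : ℝ → E) : Prop :=
  ∀ T, 0 ≤ T → IntervalIntegrable φ volume 0 T ∧ ∃ M, ∀ t ∈ Icc 0 T, ‖φ t‖ ≤ M

lemma ContinuousOn.locallyBoundedIntegrable {φ : ℝ → E} (h : ContinuousOn φ (Ici 0)) :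
    LocallyBoundedIntegrable φ := fun T hT => by
  have h' : ContinuousOn φ (Icc 0 T) := h.mono Icc_subset_Ici_self
  exact ⟨ContinuousOn.intervalIntegrable (by rwa [uIcc_of_le hT]),
    isCompact_Icc.exists_bound_of_continuousOn h'⟩

namespace LocallyBoundedIntegrable

lemma add {φ ψ : ℝ → E} (h : LocallyBoundedIntegrable φ) (h' : LocallyBoundedIntegrable ψ) :
    LocallyBoundedIntegrable (fun t => φ t + ψ t) := fun T hT => by
  obtain ⟨hi, M, hM⟩ := h T hT
  obtain ⟨hi', M', hM'⟩ := h' T hT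
  exact ⟨hi.add hi', M + M', fun t ht => (norm_add_le _ _).trans (add_le_add (hM t ht) (hM' t ht))⟩

lemma comp_clm {φ : ℝ → E} (h : LocallyBoundedIntegrable φ) (A : E →L[ℝ] F) :
    LocallyBoundedIntegrable (fun t => A (φ t)) := fun T hT => by
  obtain ⟨hi, M, hM⟩ := h T hT
  exact ⟨⟨A.integrable_comp hi.1, A.integrable_comp hi.2⟩, ‖A‖ * M, fun t ht =>
    (A.le_opNorm _).trans (mul_le_mul_of_nonneg_left (hM t ht) (norm_nonneg _))⟩

lemma const_smul {φ : ℝ → E} (h : LocallyBoundedIntegrable φ) (r : ℝ) :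
    LocallyBoundedIntegrable (fun t => r • φ t) :=
  h.comp_clm (r • ContinuousLinearMap.id ℝ E)

lemma sub {φ ψ : ℝ → E} (h : LocallyBoundedIntegrable φ) (h' : LocallyBoundedIntegrable ψ) :
    LocallyBoundedIntegrable (fun t => φ t - ψ t) := by
  simpa [sub_eq_add_neg] using h.add (h'.const_smul (-1))

lemma zero : LocallyBoundedIntegrable (fun _ => (0 : E)) :=
  ContinuousOn.locallyBoundedIntegrable continuousOn_const

lemma sum {ι : Type*} (s : Finset ι) {φ : ι → ℝ → E} (h : ∀ i, LocallyBoundedIntegrable (φ i)) :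
    LocallyBoundedIntegrable (fun t => ∑ i ∈ s, φ i t) := by
  classical
  induction s using Finset.induction_on with
  | empty => simpa using zero
  | insert i s hi ih => simpa [Finset.sum_insert hi] using (h i).add ih

lemma lipschitzInTime_and_ae_hasDerivAt [FiniteDimensional ℝ E] {φ x : ℝ → E}
    (h : LocallyBoundedIntegrable φ)
    (hx : ∀ t, 0 ≤ t → x t = x 0 + ∫ τ in (0 : ℝ)..t, φ τ) :
    LipschitzInTime x ∧ ∀ᵐ t, 0 < t → HasDerivAt x (φ t) t := by
  have key := fun T (hT : 0 ≤ T) => 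
    lipschitzOn_and_ae_hasDerivAt_of_eq_integral hT (h T hT).1 (h T hT).2.choose_spec
      fun t ht => hx t ht.1
  exact ⟨fun T hT => ⟨_, (key T hT).1⟩, ae_pos_of_forall_nat fun n => (key n n.cast_nonneg).2⟩

end LocallyBoundedIntegrable

end Integral

section Stacked

variable {N : ℕ} {F : Type*} [NormedAddCommGroup F] [InnerProductSpace ℝ F]
  [FiniteDimensional ℝ F]

lemma lipschitzInTime_stack {ξ : Fin N → ℝ → F} (h : ∀ i, LipschitzInTime (ξ i)) :
    LipschitzInTime (fun t => (WithLp.toLp 2 fun i => ξ i t : Stack N F)) := fun T hT => by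
  choose C hC using fun i => h i T hT
  have h1 : LipschitzOnWith (∑ i, C i) (fun t i => ξ i t) (Icc 0 T) := by
    refine LipschitzOnWith.of_dist_le_mul fun s hs t ht => ?_
    refine (dist_pi_le_iff (by positivity)).2 fun i => ((hC i).dist_le_mul s hs t ht).trans ?_
    gcongr
    exact_mod_cast Finset.single_le_sum (f := C) (fun _ _ => zero_le) (Finset.mem_univ i)
  exact ⟨_, (PiLp.lipschitzWith_toLp 2 (fun _ : Fin N => F)).comp_lipschitzOnWith h1⟩

lemma hasDerivAt_stack {ξ : Fin N → ℝ → F} {ξ' : Fin N → F} {t : ℝ}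
    (h : ∀ i, HasDerivAt (ξ i) (ξ' i) t) :
    HasDerivAt (fun t => (WithLp.toLp 2 fun i => ξ i t : Stack N F)) (WithLp.toLp 2 ξ') t :=
  ((PiLp.continuousLinearEquiv 2 ℝ (fun _ : Fin N => F)).symm :
    (Fin N → F) →L[ℝ] Stack N F).hasFDerivAt.comp_hasDerivAt t (hasDerivAt_pi.2 h)

/-- Componentwise integral equations, read as a differential equation of the stacked signal. -/
lemma stack_lipschitzInTime_and_ae_hasDerivAt {ξ φ : Fin N → ℝ → F}
    (hφ : ∀ i, LocallyBoundedIntegrable (φ i))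
    (hξ : ∀ i t, 0 ≤ t → ξ i t = ξ i 0 + ∫ τ in (0 : ℝ)..t, φ i τ) :
    LipschitzInTime (fun t => (WithLp.toLp 2 fun i => ξ i t : Stack N F)) ∧
      ∀ᵐ t, 0 < t → HasDerivAt (fun t => (WithLp.toLp 2 fun i => ξ i t : Stack N F))
        (WithLp.toLp 2 fun i => φ i t) t := by
  have key := fun i => (hφ i).lipschitzInTime_and_ae_hasDerivAt (hξ i)
  refine ⟨lipschitzInTime_stack fun i => (key i).1, ?_⟩
  filter_upwards [ae_all_iff.2 fun i => (key i).2] with t ht h0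
  exact hasDerivAt_stack fun i => ht i h0

variable (Gr : SimpleGraph (Fin N)) [DecidableRel Gr.Adj]

lemma locallyBoundedIntegrable_graph {ξ : Fin N → ℝ → F}
    (h : ∀ i, LocallyBoundedIntegrable (ξ i)) (i : Fin N) :
    LocallyBoundedIntegrable fun t => ∑ j, Gr.adjMatrix ℝ i j • (ξ j t - ξ i t) :=
  .sum _ fun j => ((h j).sub (h i)).const_smul _

/-- The consensus protocol in stacked form. -/
lemma consensus_field_eq {α β k₁ : ℝ} (η s z ζ γ : Fin N → F) (hz : ∀ i, z i = ζ i + γ i) :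
    (WithLp.toLp 2 fun i => (β * k₁) • (∑ j, Gr.adjMatrix ℝ i j • (η j - η i)) +
      β • (s i - η i) - (α * β) • z i : Stack N F) =
    β • (-(k₁ • blockMap (Gr.lapMatrix ℝ) (WithLp.toLp 2 η : Stack N F)) +
      ((WithLp.toLp 2 s : Stack N F) - WithLp.toLp 2 η) -
      α • ((WithLp.toLp 2 ζ : Stack N F) + WithLp.toLp 2 γ)) := by
  ext i
  have h := blockMap_lapMatrix_apply Gr (WithLp.toLp 2 η : Stack N F) i
  simp only at h
  simp only [PiLp.add_apply, PiLp.sub_apply, PiLp.smul_apply, PiLp.neg_apply, h, hz]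
  module

/-- The gradient tracking protocol in stacked form, for the variables `ζᵢ = zᵢ - γᵢ`. -/
lemma tracking_field_eq (r : ℝ) (z ζ γ : Fin N → F) (hz : ∀ i, z i = ζ i + γ i) :
    (WithLp.toLp 2 fun i => r • (∑ j, Gr.adjMatrix ℝ i j • (z j - z i)) : Stack N F) =
    -(r • blockMap (Gr.lapMatrix ℝ) ((WithLp.toLp 2 ζ : Stack N F) + WithLp.toLp 2 γ)) := by
  obtain rfl : z = fun i => ζ i + γ i := funext hz
  ext i
  have h := blockMap_lapMatrix_apply Gr ((WithLp.toLp 2 ζ : Stack N F) + WithLp.toLp 2 γ) i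
  simp only [PiLp.add_apply] at h
  simp only [PiLp.smul_apply, PiLp.neg_apply, h, smul_neg]

/-- The graph coupling does not change the mean. -/
lemma blockMean_tracking_integral (hN : N ≠ 0) (r : ℝ) {z : Fin N → ℝ → F}
    (h : ∀ i, LocallyBoundedIntegrable (z i)) {t : ℝ} (ht : 0 ≤ t) :
    blockMean (WithLp.toLp 2 fun i => ∫ τ in (0 : ℝ)..t,
      r • (∑ j, Gr.adjMatrix ℝ i j • (z j τ - z i τ)) : Stack N F) = 0 := by
  have h0 : ∀ τ, ∑ i, r • (∑ j, Gr.adjMatrix ℝ i j • (z j τ - z i τ)) = 0 := fun τ => by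
    have h1 := congrArg blockMean (tracking_field_eq Gr r (fun i => z i τ) (fun i => z i τ) 0
      (by simp))
    rw [show ∀ x : Stack N F, blockMean (-(r • x)) = -(r • blockMean x) from fun x => by
      rw [← neg_smul, blockMean_smul, neg_smul], blockMean_blockMap_lapMatrix Gr hN, smul_zero,
      neg_zero, blockMean] at h1
    exact (smul_eq_zero.1 h1).resolve_left (inv_ne_zero (Nat.cast_ne_zero.2 hN))
  rw [blockMean]
  simp only
  rw [← intervalIntegral.integral_finsetSum fun i _ =>
    ((locallyBoundedIntegrable_graph Gr h i).const_smul r t ht).1]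
  simp only [h0, intervalIntegral.integral_zero, smul_zero]

end Stacked

/-! ### Matrices acting on Euclidean vectors -/

section Matrices

variable {a b e : Type} [Fintype a] [DecidableEq a] [Fintype b] [DecidableEq b] [Fintype e]
  [DecidableEq e]

/-- A matrix as a continuous linear map between Euclidean spaces. -/
def actCLM (M : Matrix a b ℝ) : EuclideanSpace ℝ b →L[ℝ] EuclideanSpace ℝ a :=
  LinearMap.toContinuousLinearMap (Matrix.toEuclideanLin M)

lemma actCLM_apply (M : Matrix a b ℝ) (v : EuclideanSpace ℝ b) : actCLM M v = act M v := rfl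

lemma norm_act_le (M : Matrix a b ℝ) (v : EuclideanSpace ℝ b) : ‖act M v‖ ≤ ‖M‖ * ‖v‖ :=
  Matrix.l2_opNorm_mulVec M v

lemma act_mul (M : Matrix a b ℝ) (M' : Matrix b e ℝ) (v : EuclideanSpace ℝ e) :
    act (M * M') v = act M (act M' v) := by
  ext i
  simp [Matrix.toLpLin_apply, Matrix.mulVec_mulVec]

lemma act_one (v : EuclideanSpace ℝ a) : act (1 : Matrix a a ℝ) v = v := by
  ext i
  simp

lemma act_add (M M' : Matrix a b ℝ) (v : EuclideanSpace ℝ b) :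
    act (M + M') v = act M v + act M' v := by
  simp [act]

lemma inner_act (M : Matrix a b ℝ) (v : EuclideanSpace ℝ b) (u : EuclideanSpace ℝ a) :
    inner ℝ (act M v) u = inner ℝ v (act M.transpose u) := by
  simp only [act, EuclideanSpace.inner_eq_star_dotProduct, Matrix.toLpLin_apply, star_trivial]
  rw [Matrix.dotProduct_mulVec, ← Matrix.mulVec_transpose, dotProduct_comm]

lemma inner_act_nonneg {M : Matrix a a ℝ} (hM : M.PosSemidef) (v : EuclideanSpace ℝ a) :
    0 ≤ inner ℝ v (act M v) := by
  have h := hM.dotProduct_mulVec_nonneg (WithLp.ofLp v)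
  simp only [act, EuclideanSpace.inner_eq_star_dotProduct, Matrix.toLpLin_apply]
  rwa [dotProduct_comm]

end Matrices

section Agents

variable {N p : ℕ} {S : MAS N p}

lemma norm_act_C_le (i : Fin N) (x : EuclideanSpace ℝ (StIdx p (S.q i))) :
    ‖act (S.C i) x‖ ≤ ‖x‖ := by
  refine (sq_le_sq₀ (norm_nonneg _) (norm_nonneg _)).1 ?_
  rw [EuclideanSpace.norm_sq_eq, EuclideanSpace.norm_sq_eq, Fintype.sum_sum_type]
  have h : ∀ k, act (S.C i) x k = x (Sum.inl k) := fun k => by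
    simp [act, MAS.C, Matrix.toLpLin_apply]
  simp only [h]
  exact le_add_of_nonneg_right (Finset.sum_nonneg fun _ _ => sq_nonneg _)

lemma one_le_norm_C (hp : 0 < p) (i : Fin N) : 1 ≤ ‖S.C i‖ := by
  have h := norm_act_le (S.C i) (EuclideanSpace.single (Sum.inl (⟨0, hp⟩ : Fin p)) (1 : ℝ))
  have h' : act (S.C i) (EuclideanSpace.single (Sum.inl (⟨0, hp⟩ : Fin p)) (1 : ℝ)) =
      EuclideanSpace.single (⟨0, hp⟩ : Fin p) (1 : ℝ) := by
    ext k
    simp [act, MAS.C, Matrix.toLpLin_apply, Matrix.one_apply]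
  rw [h', PiLp.norm_single, PiLp.norm_single] at h
  simpa using h

namespace Controller

variable (K : Controller S)

/-- The regulator equations turn the dynamics of an agent into a stable linear system driven by
the deviation from the steady state `Πᵢ s`. -/
lemma Admissible.closedLoop_field_eq {K : Controller S} (hK : K.Admissible) (i : Fin N)
    (x : EuclideanSpace ℝ (StIdx p (S.q i))) (s : Out p) :
    act (S.A i) x + act (S.B i) (act (K.K1 i) x + act (K.K2 i) s) =
      act (K.cl i) (x - act (K.Pi i) s) := by
  have h : K.cl i * K.Pi i = -(S.B i * K.K2 i) := by
    rw [Controller.cl, Controller.K2, Matrix.add_mul, Matrix.mul_sub, Matrix.mul_assoc,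
      eq_neg_of_add_eq_zero_left (hK.regulator i)]
    abel
  have h1 : act (K.cl i) (act (K.Pi i) s) = -act (S.B i) (act (K.K2 i) s) := by
    rw [← act_mul, h, ← act_mul]
    simp [act]
  calc _ = act (S.A i) x + (act (S.B i) (act (K.K1 i) x) + act (S.B i) (act (K.K2 i) s)) :=
        congrArg _ (map_add _ _ _)
    _ = act (K.cl i) x - act (K.cl i) (act (K.Pi i) s) := by
        rw [h1, Controller.cl, act_add, act_mul]
        abel
    _ = _ := (map_sub _ _ _).symm

namespace Certificate

variable {K} (T : K.Certificate)

lemma inner_P_comm (i : Fin N) (x y : EuclideanSpace ℝ (StIdx p (S.q i))) :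
    inner ℝ (act (T.P i) x) y = inner ℝ x (act (T.P i) y) := by
  rw [inner_act, show (T.P i).transpose = T.P i from (T.posDef i).isHermitian]

lemma norm_sq_le_inner_P (i : Fin N) (x : EuclideanSpace ℝ (StIdx p (S.q i))) :
    ‖x‖ ^ 2 ≤ inner ℝ x (act (T.P i) x) := by
  have h := inner_act_nonneg (T.normalized i) x
  have h' : act (T.P i - 1) x = act (T.P i) x - x := by
    nth_rw 3 [← act_one x]
    simp [act]
  rw [h', inner_sub_right, real_inner_self_eq_norm_sq] at h
  linarith

lemma two_mul_inner_cl_P_le (i : Fin N) (x : EuclideanSpace ℝ (StIdx p (S.q i))) :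
    2 * inner ℝ (act (K.cl i) x) (act (T.P i) x) ≤ -T.c * inner ℝ x (act (T.P i) x) := by
  have h := inner_act_nonneg (T.lyapunov i) x
  have h' : act (-((K.cl i).transpose * T.P i + T.P i * K.cl i + T.c • T.P i)) x =
      -(act (K.cl i).transpose (act (T.P i) x) + act (T.P i) (act (K.cl i) x) +
        T.c • act (T.P i) x) := by
    rw [← act_mul, ← act_mul]
    simp [act]
  rw [h', inner_neg_right, inner_add_right, inner_add_right, ← inner_act,
    inner_smul_right, ← T.inner_P_comm i x (act (K.cl i) x),
    real_inner_comm (act (K.cl i) x) (act (T.P i) x)] at h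
  linarith

lemma inner_Pi_P_le (i : Fin N) (u : Out p) :
    inner ℝ (act (K.Pi i) u) (act (T.P i) (act (K.Pi i) u)) ≤
      ‖T.P i‖ * ‖K.Pi i‖ ^ 2 * ‖u‖ ^ 2 := by
  have h1 := norm_act_le (K.Pi i) u
  calc _ ≤ ‖act (K.Pi i) u‖ * (‖T.P i‖ * ‖act (K.Pi i) u‖) :=
        (real_inner_le_norm _ _).trans (mul_le_mul_of_nonneg_left (norm_act_le _ _) (norm_nonneg _))
    _ = ‖T.P i‖ * ‖act (K.Pi i) u‖ ^ 2 := by ring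
    _ ≤ ‖T.P i‖ * (‖K.Pi i‖ * ‖u‖) ^ 2 := by gcongr
    _ = _ := by ring

end Certificate

end Controller

end Agents

/-! ### The closed loop -/

section Bounds

variable {N p : ℕ} {f : Fin N → Out p → ℝ} {σ L : Fin N → ℝ}

/-- Strong monotonicity and the Lipschitz bound can be compared on any two distinct points, which
exist once `p > 0`. -/
lemma IsNiceCost.strong_le_lip {f : Out p → ℝ} {σ L : ℝ} (hf : IsNiceCost f σ L) (hp : 0 < p) :
    σ ≤ L := by
  set v : Out p := EuclideanSpace.single ⟨0, hp⟩ 1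
  have hv : ‖v - 0‖ = 1 := by simp [v]
  have h1 := hf.strongly_monotone v 0
  have h2 := (real_inner_le_norm _ _).trans
    (mul_le_mul_of_nonneg_right (hf.lipschitz v 0) (norm_nonneg (v - 0)))
  rw [hv] at h1 h2
  linarith

lemma le_iSup_fin (a : Fin N → ℝ) (i : Fin N) : a i ≤ ⨆ j, a j :=
  le_ciSup (Set.finite_range a).bddAbove i

lemma gainBounds_scalars (hp : 0 < p) (hN : 2 ≤ N) (Gr : SimpleGraph (Fin N)) [DecidableRel Gr.Adj]
    (hGr : Gr.Connected) (hf : ∀ i, IsNiceCost (f i) (σ i) (L i)) {S : MAS N p} {K : Controller S}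
    (T : K.Certificate) {α β k₁ k₂ G M₁ : ℝ} (hα : 0 < α)
    (hgain : (scalars hN S K T Gr σ L α β k₁ k₂ G M₁).GainsLarge)
    (hβ : (scalars hN S K T Gr σ L α β k₁ k₂ G M₁).SmallGain) :
    GainBounds α β ((∑ i, σ i) / N) (⨆ i, L i) (k₁ * lam2 hN Gr) (k₁ * lamN hN Gr)
      (k₂ * lam2 hN Gr) T.c (⨆ i, ‖T.P i‖ * ‖K.Pi i‖ ^ 2) := by
  have hN0 : (0 : ℝ) < N := by exact_mod_cast (by omega : 0 < N)
  have hne : Nonempty (Fin N) := ⟨⟨0, by omega⟩⟩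
  refine Scalars.gainBounds _ hgain hβ hα ?_ ?_ (Nat.ofNat_le_cast.2 hN) (lam2_le_lamN hN Gr)
    (one_le_lamN hN Gr hGr) T.c_pos (Real.iSup_nonneg fun i => by positivity) ?_
    (Real.iSup_nonneg fun i => norm_nonneg _) (Real.iSup_nonneg fun i => norm_nonneg _)
  · exact div_pos (Finset.sum_pos (fun i _ => (hf i).strong_pos) Finset.univ_nonempty) hN0
  · refine (div_le_iff₀ hN0).2 ((Finset.sum_le_card_nsmul _ _ (⨆ i, L i) fun i _ =>
      ((hf i).strong_le_lip hp).trans (le_iSup_fin L i)).trans_eq ?_)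
    simp [scalars, mul_comm]
  · exact (one_le_norm_C hp _).trans (le_iSup_fin (fun i => ‖S.C i‖) ⟨0, by omega⟩)

end Bounds

section Trajectory

variable {N p : ℕ} {S : MAS N p} {K : Controller S} {Gr : SimpleGraph (Fin N)}
  [DecidableRel Gr.Adj] {f : Fin N → Out p → ℝ} {Ω : Set (Out p)} {Ωb : ℝ → Set (Out p)}
  {α β k₁ k₂ : ℝ} {w : Signals S}

namespace IsClosedLoopSolution

lemma x_locallyBoundedIntegrable
    (hw : IsClosedLoopSolution K Gr f Ω Ωb α β k₁ k₂ w)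
    (i : Fin N) : LocallyBoundedIntegrable (w.x i) :=
  ContinuousOn.locallyBoundedIntegrable (hw.x_cont i)

lemma η_locallyBoundedIntegrable
    (hw : IsClosedLoopSolution K Gr f Ω Ωb α β k₁ k₂ w)
    (i : Fin N) : LocallyBoundedIntegrable (w.η i) :=
  ContinuousOn.locallyBoundedIntegrable (hw.η_cont i)

lemma z_locallyBoundedIntegrable
    (hw : IsClosedLoopSolution K Gr f Ω Ωb α β k₁ k₂ w)
    (i : Fin N) : LocallyBoundedIntegrable (w.z i) :=
  ContinuousOn.locallyBoundedIntegrable (hw.z_cont i)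

/-- The projections stay in the compact set `Ω`, which bounds them. -/
lemma s_locallyBoundedIntegrable
    (hw : IsClosedLoopSolution K Gr f Ω Ωb α β k₁ k₂ w)
    (hΩ : IsCompact Ω) (hsub : ∀ t, 0 ≤ t → Ωb t ⊆ Ω) (i : Fin N) :
    LocallyBoundedIntegrable (w.s i) := fun T hT => by
  obtain ⟨M, hM⟩ := hΩ.isBounded.exists_norm_le
  exact ⟨hw.s_int i T hT, M, fun t ht => hM _ (hsub t ht.1 (hw.s_eq i t ht.1).1)⟩

lemma x_lipschitzInTime_and_ae_hasDerivAt
    (hw : IsClosedLoopSolution K Gr f Ω Ωb α β k₁ k₂ w)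
    (hK : K.Admissible) (hΩ : IsCompact Ω)
    (hsub : ∀ t, 0 ≤ t → Ωb t ⊆ Ω) (i : Fin N) :
    LipschitzInTime (w.x i) ∧ ∀ᵐ t, 0 < t →
      HasDerivAt (w.x i) (actCLM (K.cl i) (w.x i t - actCLM (K.Pi i) (w.s i t))) t := by
  refine LocallyBoundedIntegrable.lipschitzInTime_and_ae_hasDerivAt
    (((hw.x_locallyBoundedIntegrable i).sub
      ((hw.s_locallyBoundedIntegrable hΩ hsub i).comp_clm (actCLM (K.Pi i)))).comp_clm
        (actCLM (K.cl i))) fun t ht => ?_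
  rw [hw.x_eq i t ht]
  congr 1
  exact intervalIntegral.integral_congr fun τ _ => hK.closedLoop_field_eq i _ _

lemma η_field_locallyBoundedIntegrable
    (hw : IsClosedLoopSolution K Gr f Ω Ωb α β k₁ k₂ w)
    (hΩ : IsCompact Ω)
    (hsub : ∀ t, 0 ≤ t → Ωb t ⊆ Ω) (i : Fin N) :
    LocallyBoundedIntegrable fun τ => (β * k₁) • (∑ j, Gr.adjMatrix ℝ i j • (w.η j τ - w.η i τ)) +
      β • (w.s i τ - w.η i τ) - (α * β) • w.z i τ :=
  (((locallyBoundedIntegrable_graph Gr hw.η_locallyBoundedIntegrable i).const_smul _).add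
    (((hw.s_locallyBoundedIntegrable hΩ hsub i).sub (hw.η_locallyBoundedIntegrable i)).const_smul
      _)).sub ((hw.z_locallyBoundedIntegrable i).const_smul _)

/-- The part of `zᵢ` that does not come from the derivative of the gradient. -/
lemma z_sub_gradient_eq
    (hw : IsClosedLoopSolution K Gr f Ω Ωb α β k₁ k₂ w)
    (i : Fin N) {t : ℝ} (ht : 0 ≤ t) :
    w.z i t - gradient (f i) (w.y i t) =
      ∫ τ in (0 : ℝ)..t, (k₂ / β) • ∑ j, Gr.adjMatrix ℝ i j • (w.z j τ - w.z i τ) := by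
  rw [hw.z_eq i t ht, hw.z_init i]
  abel

end IsClosedLoopSolution

end Trajectory

end SafeConsensus

end

open SafeConsensus in
theorem mainTheorem1 {N p : ℕ} (hN : 2 ≤ N)
    -- communication graph
    (Gr : SimpleGraph (Fin N)) [DecidableRel Gr.Adj] (hGr : Gr.Connected)
    -- local costs
    (f : Fin N → Out p → ℝ) (σ L : Fin N → ℝ) (hf : ∀ i, IsNiceCost (f i) (σ i) (L i))
    -- safety zone and expanding constraint sets
    (Ω : Set (Out p)) (hΩ : IsSafetyZone Ω)
    (Ωb : ℝ → Set (Out p)) (M₁ : ℝ) (hΩb : IsExpandingFamily Ω Ωb M₁)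
    (G : ℝ) (hG : GradientBound f Ωb G)
    -- agents
    (S : MAS N p)
    (hstab : ∀ i, IsStabilizable (S.A i) (S.B i))
    (hdet : ∀ i, IsDetectable (S.C i) (S.A i))
    (hzero : ∀ i, S.NoTransmissionZeroAtZero i)
    -- controller and Lyapunov certificate
    (K : Controller S) (hK : K.Admissible) (T : K.Certificate)
    -- scalar parameters
    (α β k₁ k₂ : ℝ) (hα : 0 < α)
    (hgain : (scalars hN S K T Gr σ L α β k₁ k₂ G M₁).GainsLarge)
    (hβ : (scalars hN S K T Gr σ L α β k₁ k₂ G M₁).SmallGain)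
    -- closed-loop trajectory
    (w : Signals S) (hw : IsClosedLoopSolution K Gr f Ω Ωb α β k₁ k₂ w) :
    ∃ ystar : Out p, IsMinimizer f Ω ystar ∧ (∀ y, IsMinimizer f Ω y → y = ystar) ∧
      ∀ i, Tendsto (w.y i) atTop (𝓝 ystar) := by
  have hN0 : N ≠ 0 := by omega
  have hΩne : Ω.Nonempty := hΩ.interior_nonempty.mono interior_subset
  have hsub : ∀ t, 0 ≤ t → Ωb t ⊆ Ω := fun t ht => (hΩb.subset_interior t ht).trans interior_subset
  obtain ⟨ystar, hy⟩ := exists_isMinimizer hf hΩ.compact hΩne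
  refine ⟨ystar, hy, fun y hy' => hy.unique hN0 hf hΩ.convex hy', fun i₀ => ?_⟩
  rcases Nat.eq_zero_or_pos p with rfl | hp
  · -- without outputs there is only one point to converge to
    rw [show w.y i₀ = fun _ => ystar from funext fun _ => Subsingleton.elim _ _]
    exact tendsto_const_nhds
  have hb := gainBounds_scalars hp hN Gr hGr hf T hα hgain hβ
  have hk₁ : 0 < k₁ := hgain.k₁_pos
  have hlam : 0 < lam2 hN Gr := (mul_pos_iff_of_pos_left hk₁).1 (by linarith [hb.κ_ge])
  obtain ⟨hlow, hupp, R, hRinv, hRb⟩ := exists_sqrt_pseudoinverse (F := Out p) hN Gr hGr hlam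
  choose π hπ using exists_isProj hΩ.compact hΩne
  -- the equilibrium of `ηᵢ` lies on the normal ray of `Ω` at the minimizer
  set e : Out p := ystar - α • blockMean (blockwise (fun i => gradient (f i)) (diagVec N ystar))
    with he
  have hπe : π e = ystar := by
    refine (hπ e).unique hΩ.convex (isProj_of_inner_le_zero hy.1 fun v hv => ?_)
    have h := hy.inner_gradient_nonneg hf hΩ.convex v hv
    have h' : e - ystar = -((α * (N : ℝ)⁻¹) • ∑ i, gradient (f i) ystar) := by
      rw [he, sub_sub_cancel_left, blockMean, smul_smul]
      rfl
    rw [h', inner_neg_left, real_inner_smul_left]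
    exact neg_nonpos.2 (mul_nonneg (by positivity) h)
  have hx := hw.x_lipschitzInTime_and_ae_hasDerivAt hK hΩ.compact hsub
  have hη := stack_lipschitzInTime_and_ae_hasDerivAt
    (hw.η_field_locallyBoundedIntegrable hΩ.compact hsub) hw.η_eq
  have hζ := stack_lipschitzInTime_and_ae_hasDerivAt
    (fun i => (locallyBoundedIntegrable_graph Gr hw.z_locallyBoundedIntegrable i).const_smul
      (k₂ / β))
    (ξ := fun i t => w.z i t - gradient (f i) (w.y i t)) fun i t ht => by
      rw [hw.z_sub_gradient_eq i le_rfl, hw.z_sub_gradient_eq i ht,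
        intervalIntegral.integral_same, zero_add]
  -- the fixed set `Ω` takes the place of `Ωb t`, and `ζᵢ = zᵢ - ∇fᵢ(yᵢ)` that of `zᵢ`
  let Q : OperatorLoop N (Out p) (fun i => EuclideanSpace ℝ (StIdx p (S.q i))) α β k₁ k₂
      ((∑ i, σ i) / N) (⨆ i, L i) (lam2 hN Gr) (lamN hN Gr) T.c
      (⨆ i, ‖T.P i‖ * ‖K.Pi i‖ ^ 2) :=
    { N_ne_zero := hN0
      bounds := hb
      k₁_pos := hk₁
      k₂_pos := hgain.k₂_pos
      lam_pos := hlam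
      τ := σ
      g := fun i => gradient (f i)
      mean_τ := rfl
      g_lip := fun i x y => ((hf i).lipschitz x y).trans
        (mul_le_mul_of_nonneg_right (le_iSup_fin L i) (norm_nonneg _))
      g_mono := fun i => (hf i).strongly_monotone
      π := π
      π_lip := fun x y => (hπ x).norm_sub_le hΩ.convex (hπ y)
      π_mono := fun x y => (hπ x).inner_sub_normal_nonneg hΩ.convex (hπ y)
      e := e
      equilibrium := by rw [hπe, he, sub_sub_cancel_left]
      ℓ := blockMap (Gr.lapMatrix ℝ)
      ℓ_diag := blockMap_lapMatrix_diagVec Gr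
      inner_diag_ℓ := fun x c => by
        rw [real_inner_comm, inner_diagVec hN0, blockMean_blockMap_lapMatrix Gr hN0,
          inner_zero_left, mul_zero]
      ℓ_lower := hlow
      ℓ_upper := hupp
      R := R
      R_inv := hRinv
      R_bound := hRb
      A := fun i => actCLM (K.cl i)
      P := fun i => actCLM (T.P i)
      Γ := fun i => actCLM (K.Pi i)
      C := fun i => actCLM (S.C i)
      P_symm := T.inner_P_comm
      P_ge := T.norm_sq_le_inner_P
      lyapunov := T.two_mul_inner_cl_P_le
      P_Γ := fun i u => (T.inner_Pi_P_le i u).trans (mul_le_mul_of_nonneg_right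
        (le_iSup_fin (fun i => ‖T.P i‖ * ‖K.Pi i‖ ^ 2) i) (sq_nonneg _))
      C_Γ := fun i u => by
        rw [actCLM_apply, actCLM_apply, ← act_mul, hK.output i, act_one]
      C_le := norm_act_C_le
      x := w.x
      η := fun t => WithLp.toLp 2 fun i => w.η i t
      s := fun t => WithLp.toLp 2 fun i => w.s i t
      ζ := fun t => WithLp.toLp 2 fun i => w.z i t - gradient (f i) (w.y i t)
      h := fun t => Metric.hausdorffDist (Ωb t) Ω
      h_nonneg := fun _ => Metric.hausdorffDist_nonneg
      h_tendsto := hΩb.tendsto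
      s_near := fun t ht i => norm_sub_sq_le_of_subset hΩ.convex hΩ.compact (hsub t ht.le)
        (hw.s_eq i t ht.le) (hπ _)
      x_lip := fun i => (hx i).1
      η_lip := hη.1
      ζ_lip := hζ.1
      x_der := fun i => (hx i).2
      η_der := by
        filter_upwards [hη.2] with t ht h0
        have h := ht h0
        rwa [consensus_field_eq Gr (fun i => w.η i t) (fun i => w.s i t) (fun i => w.z i t)
          (fun i => w.z i t - gradient (f i) (w.y i t)) (fun i => gradient (f i) (w.y i t))
          fun i => (sub_add_cancel _ _).symm] at h
      ζ_der := by
        filter_upwards [hζ.2] with t ht h0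
        have h := ht h0
        rwa [tracking_field_eq Gr (k₂ / β) (fun i => w.z i t)
          (fun i => w.z i t - gradient (f i) (w.y i t)) (fun i => gradient (f i) (w.y i t))
          fun i => (sub_add_cancel _ _).symm] at h
      ζ_mean := fun t ht => by
        rw [show (fun i => w.z i t - gradient (f i) (w.y i t)) = _ from
          funext fun i => hw.z_sub_gradient_eq i ht]
        exact blockMean_tracking_integral Gr hN0 (k₂ / β) hw.z_locallyBoundedIntegrable ht }
  have h := Q.tendsto_output i₀
  rwa [show Q.π Q.e = ystar from hπe] at h
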